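/- Let $N\ge 1$ be an integer, $d>1$, $p>1$, and consider the Cauchy problem $$\text{(VHJ)}\qquad \partial_t u+(-\Delta)^{d/2}u=|\nabla u|^p\ \text{ in } \mathbb R^N\times(0,\infty),\qquad u(\cdot,0)=\phi ,$$ where $\phi:\mathbb R^N\to\mathbb R$ is locally integrable. Let $G_d(x,t)=(2\pi)^{-N}\int_{\mathbb R^N}e^{ix\cdot\xi}e^{-t|\xi|^d}\,d\xi$ be the fundamental solution of $\partial_t u+(-\Delta)^{d/2}u=0$. For $0<T\le\infty$, a solution of (VHJ) in $\mathbb R^N\times[0,T)$ is a function $u$ such that $u$ and $\nabla u=\nabla_x u$ are continuous in $\mathbb R^N\times(0,T)$ and bounded in $\mathbb R^N\times(\tau,T)$ for every $\tau\in(0,T)$, and $$u(x,t)=\int_{\mathbb R^N}G_d(x-y,t)\phi(y)\,dy+\int_0^t\int_{\mathbb R^N}G_d(x-y,t-s)|\nabla u(y,s)|^p\,dy\,ds$$ for all $(x,t)\in\mathbb R^N\times(0,T)$, both integrals being absolutely convergent. A local-in-time solution is a solution in $\mathbb R^N\times[0,T)$ for some $T\in(0,\infty)$. Write $\phi\in L^1_{\rm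 uloc}$ if $\phi$ is measurable and $\sup_x\|\phi\|_{L^1(B(x,1))}<\infty$, write ${-}\!\!\!\!\int_B f$ for $|B|^{-1}\int_B f$, and set $p_{HJ}:=\frac{N+d}{N+1}\in(1,d)$. (a) If $1<p<p_{HJ}$ and $\phi\in L^1_{\rm uloc}$, then (VHJ) possesses a local-in-time solution. (b) Let $p=p_{HJ}$. For $\beta>0$ set $\Phi(s)=s[\log(e+s)]^\beta$ $(s\ge 0)$ and $\rho(s)=s^{-N}[\log(e+s^{-1})]^{-\frac{N}{d-p}}$. For every $\beta>0$ there exist $\gamma>0$ and $C>0$ such that, for every $T\in(0,\infty)$, if $$\sup_{x\in\mathbb R^N}\Phi^{-1}\Bigl({-}\!\!\!\!\int_{B(x,\sigma)}\Phi(T^{N/d}|\phi(y)|)\,dy\Bigr)\le\gamma\,\rho(\sigma T^{-1/d}),\qquad 0<\sigma<T^{1/d},$$ then (VHJ) possesses a solution $u$ in $\mathbb R^N\times[0,T)$ with $$|\nabla^j u(x,t)|\le C\,t^{-\frac Nd-\frac jd}\Bigl|\log\frac{t}{2T}\Bigr|^{-\frac Nd},\qquad (x,t)\in\mathbb R^N\times(0,T),\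 j\in\{0,1\}.$$ In particular, there exists $C_1>0$ such that, if $$|\phi(x)|\le C_1|x|^{-N}\Bigl[\log\Bigl(e+\frac1{|x|}\Bigr)\Bigr]^{-\frac{N}{d-p}-1}+C\qquad\text{for almost every }x\in\mathbb R^N$$ for some $C>0$, then (VHJ) possesses a local-in-time solution. (c) Let $p_{HJ}<p<d$ and $q>1$. There exists $C_2>0$ such that, if $$\sup_{x\in\mathbb R^N}\ \sup_{0<\sigma<T^{1/d}}\sigma^{\frac{d-p}{p-1}}\Bigl({-}\!\!\!\!\int_{B(x,\sigma)}|\phi(y)|^q\,dy\Bigr)^{1/q}\le C_2$$ for some $T\in(0,\infty]$, then (VHJ) possesses a solution in $\mathbb R^N\times[0,T)$. (d) For every $p>1$ there exists $C_3>0$ such that, if $\phi\in L^1_{\rm uloc}$ has a locally integrable weak gradient $\nabla\phi$ with $$\sup_{x\in\mathbb R^N}\ \sup_{0<\sigma<T^{1/d}}\sigma^{\frac{d-1}{p-1}}{-}\!\!\!\!\int_{B(x,\sigma)}|\nabla\phi(y)|\,dy\le C_3$$ for some $T\in(0,\infty]$, then (VHJ) possesses a solution in $\mathbb R^N\times[0,T)$.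 The constants depend only on $N,d,p$ (and on $\beta$ in (b), on $q$ in (c)). -/

import Mathlib

open MeasureTheory Set Metric
open scoped ENNReal ContDiff

noncomputable section

namespace VHJ

/-- Euclidean space `ℝ^N`. -/
abbrev Sp (N : ℕ) : Type := EuclideanSpace ℝ (Fin N)

/-- The fundamental solution of `∂_t u + (-Δ)^{d/2} u = 0` in `ℝ^N × (0,∞)`:
`G_d(x,t) = (2π)^{-N} ∫ e^{i x·ξ} e^{-t|ξ|^d} dξ`. The integral is real; `re` only moves it
from `ℂ` to `ℝ`. -/
def heatKernel {N : ℕ} (d : ℝ) (x : Sp N) (t : ℝ) : ℝ :=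
  (2 * Real.pi) ^ (-(N : ℝ)) *
    (∫ ξ : Sp N, Complex.exp (Complex.I * ((inner ℝ x ξ : ℝ) : ℂ)) *
      ((Real.exp (-t * ‖ξ‖ ^ d) : ℝ) : ℂ)).re

/-- `f` belongs to the uniformly local Lebesgue space `L^r_uloc(ℝ^N)`. -/
def MemLuloc {N : ℕ} (r : ℝ≥0∞) (f : Sp N → ℝ) : Prop :=
  AEStronglyMeasurable f volume ∧
    (⨆ x : Sp N, eLpNorm f r (volume.restrict (ball x 1))) < ⊤

/-- `u` is a solution in `ℝ^N × [0,T)`, `0 < T ≤ ∞`, of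
`∂_t u + (-Δ)^{d/2} u = |∇u|^p`, `u(·,0) = φ`: `u` and `∇u` are continuous in `ℝ^N × (0,T)`
and bounded in `ℝ^N × (τ,T)` for every `τ ∈ (0,T)`, and
`u(x,t) = ∫ G_d(x-y,t) φ(y) dy + ∫_0^t ∫ G_d(x-y,t-s) |∇u(y,s)|^p dy ds`
in `ℝ^N × (0,T)`, where both integrals converge absolutely. -/
structure IsSolution {N : ℕ} (d p : ℝ) (φ : Sp N → ℝ) (T : ℝ≥0∞) (u : Sp N → ℝ → ℝ) :
    Prop where
  differentiable : ∀ t : ℝ, 0 < t → ENNReal.ofReal t < T → Differentiable ℝ (fun x => u x t)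
  continuousOn : ContinuousOn (fun z : Sp N × ℝ => u z.1 z.2)
    {z : Sp N × ℝ | 0 < z.2 ∧ ENNReal.ofReal z.2 < T}
  continuousOn_gradient :
    ContinuousOn (fun z : Sp N × ℝ => gradient (fun x => u x z.2) z.1)
      {z : Sp N × ℝ | 0 < z.2 ∧ ENNReal.ofReal z.2 < T}
  bounded : ∀ τ : ℝ, 0 < τ → ∃ M : ℝ, ∀ (x : Sp N) (t : ℝ), τ < t → ENNReal.ofReal t < T →
    |u x t| ≤ M ∧ ‖gradient (fun y => u y t) x‖ ≤ M
  integrable_initial : ∀ (x : Sp N) (t : ℝ), 0 < t → ENNReal.ofReal t < T →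
    Integrable (fun y : Sp N => heatKernel d (x - y) t * φ y) volume
  integrable_duhamel : ∀ (x : Sp N) (t : ℝ), 0 < t → ENNReal.ofReal t < T →
    IntegrableOn (fun z : Sp N × ℝ =>
      heatKernel d (x - z.1) (t - z.2) * ‖gradient (fun y => u y z.2) z.1‖ ^ p)
      (univ ×ˢ Ioo 0 t) volume
  integral_eq : ∀ (x : Sp N) (t : ℝ), 0 < t → ENNReal.ofReal t < T →
    u x t = (∫ y : Sp N, heatKernel d (x - y) t * φ y) +
      ∫ s in Ioo 0 t, ∫ y : Sp N,
        heatKernel d (x - y) (t - s) * ‖gradient (fun z => u z s) y‖ ^ p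

/-- There is a solution in `ℝ^N × [0,T)` for some `T ∈ (0,∞)`. -/
def HasLocalSolution {N : ℕ} (d p : ℝ) (φ : Sp N → ℝ) : Prop :=
  ∃ T : ℝ, 0 < T ∧ ∃ u : Sp N → ℝ → ℝ, IsSolution d p φ (ENNReal.ofReal T) u

/-- The critical exponent `(N + d) / (N + 1)`. -/
def pHJ (N : ℕ) (d : ℝ) : ℝ := ((N : ℝ) + d) / ((N : ℝ) + 1)

/-- `Φ(s) = s [log(e + s)]^β`. -/
def Phi (β s : ℝ) : ℝ := s * (Real.log (Real.exp 1 + s)) ^ β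

/-- The inverse of the increasing bijection `Φ : [0,∞) → [0,∞)`. -/
def PhiInv (β : ℝ) : ℝ → ℝ := Function.invFunOn (Phi β) (Ici 0)

/-- `ρ(s) = s^{-N} [log(e + 1/s)]^{-N/(d-p)}`. -/
def rho (N : ℕ) (d p s : ℝ) : ℝ :=
  s ^ (-(N : ℝ)) * (Real.log (Real.exp 1 + s⁻¹)) ^ (-((N : ℝ) / (d - p)))

/-- `sup_x sup_{0 < σ < T^{1/d}} σ^a (⨍_{B(x,σ)} |f|^q dy)^{1/q}`, a value in `[0,∞]`. -/
def localMorrey {N : ℕ} {F : Type*} [NormedAddCommGroup F]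
    (d a q : ℝ) (T : ℝ≥0∞) (f : Sp N → F) : ℝ≥0∞ :=
  ⨆ (x : Sp N) (σ : ℝ) (_ : 0 < σ ∧ ENNReal.ofReal σ < T ^ (1 / d)),
    ENNReal.ofReal (σ ^ a) * (⨍⁻ y in ball x σ, ‖f y‖ₑ ^ q ∂volume) ^ (1 / q)

/-- `g` is the weak gradient of `φ`. -/
def IsWeakGradient {N : ℕ} (φ : Sp N → ℝ) (g : Sp N → Sp N) : Prop :=
  LocallyIntegrable φ volume ∧ LocallyIntegrable g volume ∧
    ∀ η : Sp N → ℝ, ContDiff ℝ ∞ η → HasCompactSupport η →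
      ∫ y, φ y • gradient η y = -∫ y, η y • g y

end VHJ

end

noncomputable section

namespace VHJ

variable {N : ℕ}

/-! ### A positive majorant kernel -/

/-! The gradient V = ∇u solves a closed equation, V = ∇S(t)φ + ∫₀ᵗ ∇S(t-s)|V|^p ds, where S(t) is
convolution with G_d. All four parts come down to exhibiting a majorant W (`IsMajorant`): W
dominates the linear term ∇S(t)φ, and the Duhamel integral of W^p against the bound for |∇G_d| is at
most ηW with η small. The Picard map then preserves the set |V| ≤ 2W and halves the distance sup |V
- V'|/W (`picard_props`, `picard_contract`, `exists_picard_fixed`). Inserting the fixed point into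
the Duhamel formula defines u, and differentiating under the integral gives ∇u = V
(`hasFDerivAt_duh`, `exists_isSolution_of_isMajorant`).

Only two facts about the kernel matter. With τ = t^(1/d) and k_τ(x) = τ/(τ+|x|)^(N+1), one has |G_d|
≤ C k_τ and |∇G_d| ≤ C τ⁻¹ k_τ (`exists_heatKernel_bound`). By scaling this is a decay statement at
t = 1. It holds because e^{-|ξ|^d} has at worst a conical singularity at 0 and is analytic
elsewhere, which finite differences of order N + 2 turn into decay of order |x|^(-N-1)
(`exists_norm_fint_le`). Moreover k_a * k_b ≤ C k_τ whenever max(a,b) ≤ τ ≤ a+b (`pot_pot_le`). For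
a = (t-s)^(1/d), b = s^(1/d), τ = t^(1/d) this condition is the subadditivity of r ↦ r^(1/d). Hence
a bound W(s)^p ≤ c(s) k_{s^(1/d)} * f reduces the Duhamel integral to the time integral of
(t-s)^(-κ) c(s), multiplied by k_{t^(1/d)} * f (`duhMaj_le_pot`).

The majorants are as follows. (a) W = A t^(-1/d) k * |φ|. Bounding p - 1 of the p factors by their
supremum gives c(s) ~ s^(-l), and l < 1 exactly when p < p_HJ; a short time interval gives
smallness. (c) W = A t^(-1/d) (k * |φ|^r)^(1/r) with 1 < r ≤ min(q,p). The Morrey condition is scale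
invariant, so no power of t is left over and smallness comes from C₂. (d) The derivative is moved
from the kernel to φ, so W = A k * |∇φ| without the factor t^(-1/d). For p > d this is capped by M
t^(-θ) to keep u bounded for large times. (b) At the critical exponent the time integral becomes ∫
ds/s, which converges only through logarithms. Here W is t^(-1/d) times δ(t/T)^(-ε) + B log^(-β) · k
* Φ(T^(N/d)|φ|), and `lintegral_inv_mul_ell_le` supplies the integral of s⁻¹ log^(-β-1). -/

/-- The kernel `τ / (τ + ‖x‖)^(N+1)`, which dominates the fundamental solution when
`τ = t^(1/d)`. -/
def majKer (τ : ℝ) (x : Sp N) : ℝ := τ / (τ + ‖x‖) ^ (N + 1)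

lemma majKer_pos {τ : ℝ} (hτ : 0 < τ) (x : Sp N) : 0 < majKer τ x := by
  unfold majKer; positivity

lemma continuous_majKer {τ : ℝ} (hτ : 0 < τ) : Continuous (majKer τ : Sp N → ℝ) := by
  unfold majKer
  refine Continuous.div (by fun_prop) (by fun_prop) fun z => by positivity

lemma measurable_majKer : Measurable (fun z : Sp N × ℝ => majKer z.2 z.1) := by
  unfold majKer; fun_prop

/-- Source of the pointwise comparisons: `B` compares the numerators and `A` the denominators. -/
lemma majKer_le {τ τ' A B : ℝ} {x x' : Sp N} (hτ : 0 < τ) (hτ' : 0 < τ') (hB : τ ≤ B * τ')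
    (hA : τ' + ‖x'‖ ≤ A * (τ + ‖x‖)) :
    majKer τ x ≤ B * A ^ (N + 1) * majKer τ' (x') := by
  unfold majKer
  rw [← mul_div_assoc, div_le_div_iff₀ (by positivity) (by positivity)]
  have h1 : (τ' + ‖x'‖) ^ (N + 1) ≤ (A * (τ + ‖x‖)) ^ (N + 1) := by gcongr
  calc τ * (τ' + ‖x'‖) ^ (N + 1) ≤ (B * τ') * (A * (τ + ‖x‖)) ^ (N + 1) := by
        gcongr
        exact hτ.le.trans hB
    _ = _ := by rw [mul_pow]; ring

lemma majKer_scale {τ : ℝ} (hτ : 0 < τ) (x : Sp N) :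
    majKer τ x = (τ ^ N)⁻¹ * majKer 1 (τ⁻¹ • x) := by
  unfold majKer
  rw [norm_smul, norm_inv, Real.norm_of_nonneg hτ.le]
  have : τ + ‖x‖ = τ * (1 + τ⁻¹ * ‖x‖) := by field_simp
  rw [this, mul_pow]
  have h2 : (1 + τ⁻¹ * ‖x‖) ≠ 0 := by positivity
  field_simp
  ring

lemma integrable_majKer_one : Integrable (majKer 1 : Sp N → ℝ) volume := by
  have h := integrable_one_add_norm (E := Sp N) (μ := volume) (r := (N : ℝ) + 1)
    (by simp)
  refine h.congr (Filter.Eventually.of_forall fun x => ?_)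
  simp only [majKer, one_div]
  rw [Real.rpow_neg (by positivity)]
  norm_cast

/-- The total mass of `majKer τ`, which does not depend on `τ`. -/
def majMass (N : ℕ) : ℝ := ∫ x : Sp N, majKer 1 x

lemma integrable_majKer {τ : ℝ} (hτ : 0 < τ) : Integrable (majKer τ : Sp N → ℝ) volume := by
  have h := (integrable_majKer_one (N := N)).comp_smul (R := τ⁻¹) (inv_ne_zero hτ.ne')
  refine (h.const_mul (τ ^ N)⁻¹).congr (Filter.Eventually.of_forall fun x => ?_)
  simp only [majKer_scale hτ x]

lemma integral_majKer {τ : ℝ} (hτ : 0 < τ) : ∫ x : Sp N, majKer τ x = majMass N := by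
  simp_rw [majKer_scale hτ]
  rw [integral_const_mul, Measure.integral_comp_inv_smul]
  simp only [finrank_euclideanSpace, Fintype.card_fin, smul_eq_mul, majMass]
  rw [abs_of_pos (by positivity)]
  field_simp

lemma majMass_pos : 0 < majMass N := by
  unfold majMass
  rw [integral_pos_iff_support_of_nonneg (fun x => (majKer_pos one_pos x).le)
    integrable_majKer_one]
  have : Function.support (majKer 1 : Sp N → ℝ) = univ := by
    ext x; simp [(majKer_pos one_pos x).ne']
  rw [this]
  exact isOpen_univ.measure_pos _ univ_nonempty

lemma lintegral_majKer {τ : ℝ} (hτ : 0 < τ) :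
    ∫⁻ x : Sp N, ENNReal.ofReal (majKer τ x) = ENNReal.ofReal (majMass N) := by
  rw [← integral_majKer hτ, ofReal_integral_eq_lintegral_ofReal (integrable_majKer hτ)
    (Filter.Eventually.of_forall fun x => (majKer_pos hτ x).le)]

lemma lintegral_majKer_sub {τ : ℝ} (hτ : 0 < τ) (x : Sp N) :
    ∫⁻ y : Sp N, ENNReal.ofReal (majKer τ (x - y)) = ENNReal.ofReal (majMass N) := by
  rw [lintegral_sub_left_eq_self (fun y : Sp N => ENNReal.ofReal (majKer τ y)) x,
    lintegral_majKer hτ]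

lemma lintegral_majKer_sub_right {τ : ℝ} (hτ : 0 < τ) (z : Sp N) :
    ∫⁻ y : Sp N, ENNReal.ofReal (majKer τ (y - z)) = ENNReal.ofReal (majMass N) := by
  rw [lintegral_sub_right_eq_self (fun y : Sp N => ENNReal.ofReal (majKer τ y)) z,
    lintegral_majKer hτ]

/-- By the triangle inequality the larger of a + |x-y| and b + |y-z| is at least half of τ + |x-z|,
so the corresponding factor is already comparable with the kernel at x - z. The other factor is
kept, and integrates to a constant. -/
lemma majKer_mul_majKer_le {a b τ : ℝ} (ha : 0 < a) (hb : 0 < b) (haτ : a ≤ τ) (hbτ : b ≤ τ)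
    (hτ : τ ≤ a + b) (x y z : Sp N) :
    majKer a (x - y) * majKer b (y - z) ≤
      2 ^ (N + 1) * majKer τ (x - z) * (majKer a (x - y) + majKer b (y - z)) := by
  have hτ0 : 0 < τ := ha.trans_le haτ
  have htri : ‖x - z‖ ≤ ‖x - y‖ + ‖y - z‖ := norm_sub_le_norm_sub_add_norm_sub x y z
  have p1 := majKer_pos ha (x - y)
  have p2 := majKer_pos hb (y - z)
  have p3 := majKer_pos hτ0 (x - z)
  rcases le_total (b + ‖y - z‖) (a + ‖x - y‖) with h | h
  · have := majKer_le (B := 1) (A := 2) (x := x - y) (x' := x - z) ha hτ0 (by linarith)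
      (by linarith)
    rw [one_mul] at this
    have h4 : majKer a (x - y) * majKer b (y - z) ≤
      2 ^ (N + 1) * majKer τ (x - z) * majKer b (y - z) := by gcongr
    refine h4.trans ?_
    gcongr
    linarith
  · have := majKer_le (B := 1) (A := 2) (x := y - z) (x' := x - z) hb hτ0 (by linarith)
      (by linarith)
    rw [one_mul] at this
    have h4 : majKer a (x - y) * majKer b (y - z) ≤
      majKer a (x - y) * (2 ^ (N + 1) * majKer τ (x - z)) := by gcongr
    refine h4.trans ?_
    rw [mul_comm]
    gcongr
    linarith

lemma lintegral_majKer_mul_majKer_le {a b τ : ℝ} (ha : 0 < a) (hb : 0 < b) (haτ : a ≤ τ)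
    (hbτ : b ≤ τ) (hτ : τ ≤ a + b) (x z : Sp N) :
    ∫⁻ y, ENNReal.ofReal (majKer a (x - y)) * ENNReal.ofReal (majKer b (y - z)) ≤
      ENNReal.ofReal (2 ^ (N + 2) * majMass N) * ENNReal.ofReal (majKer τ (x - z)) := by
  have hτ0 : 0 < τ := ha.trans_le haτ
  calc ∫⁻ y, ENNReal.ofReal (majKer a (x - y)) * ENNReal.ofReal (majKer b (y - z))
      ≤ ∫⁻ y, ENNReal.ofReal (2 ^ (N + 1) * majKer τ (x - z)) *
          (ENNReal.ofReal (majKer a (x - y)) + ENNReal.ofReal (majKer b (y - z))) := by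
        refine lintegral_mono fun y => ?_
        rw [← ENNReal.ofReal_mul (majKer_pos ha _).le, ← ENNReal.ofReal_add
          (majKer_pos ha _).le (majKer_pos hb _).le, ← ENNReal.ofReal_mul
          (by have := majKer_pos hτ0 (x - z); positivity)]
        exact ENNReal.ofReal_le_ofReal (majKer_mul_majKer_le ha hb haτ hbτ hτ x y z)
    _ = ENNReal.ofReal (2 ^ (N + 1) * majKer τ (x - z)) *
          (ENNReal.ofReal (majMass N) + ENNReal.ofReal (majMass N)) := by
        rw [lintegral_const_mul' _ _ ENNReal.ofReal_ne_top, lintegral_add_left,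
          lintegral_majKer_sub ha, lintegral_majKer_sub_right hb]
        have := continuous_majKer (N := N) ha
        fun_prop
    _ = _ := by
        have hm := majMass_pos (N := N)
        have hk := majKer_pos hτ0 (x - z)
        rw [← ENNReal.ofReal_add hm.le hm.le, ← ENNReal.ofReal_mul (by positivity),
          ← ENNReal.ofReal_mul (by positivity)]
        congr 1
        ring

/-! ### The potential of a function with respect to the majorant kernel -/

/-- The convolution of `f` with `majKer τ`, as an extended nonnegative number. -/
def pot (τ : ℝ) (f : Sp N → ℝ≥0∞) (x : Sp N) : ℝ≥0∞ :=
  ∫⁻ y, ENNReal.ofReal (majKer τ (x - y)) * f y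

lemma pot_mono {τ : ℝ} {f g : Sp N → ℝ≥0∞} (h : f ≤ᵐ[volume] g) (x : Sp N) :
    pot τ f x ≤ pot τ g x := by
  refine lintegral_mono_ae ?_
  filter_upwards [h] with y hy
  gcongr

lemma pot_const {τ : ℝ} (hτ : 0 < τ) (c : ℝ≥0∞) (x : Sp N) :
    pot τ (fun _ => c) x = ENNReal.ofReal (majMass N) * c := by
  unfold pot
  rw [lintegral_mul_const, lintegral_majKer_sub hτ]
  have := continuous_majKer (N := N) hτ
  fun_prop

lemma pot_const_mul {τ : ℝ} (hτ : 0 < τ) {c : ℝ≥0∞} (f : Sp N → ℝ≥0∞) (hf : AEMeasurable f)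
    (x : Sp N) : pot τ (fun y => c * f y) x = c * pot τ f x := by
  unfold pot
  rw [← lintegral_const_mul'']
  · congr 1; ext y; ring
  · have := continuous_majKer (N := N) hτ
    exact AEMeasurable.mul (by fun_prop) hf

lemma pot_add {τ : ℝ} (hτ : 0 < τ) (f g : Sp N → ℝ≥0∞) (hf : AEMeasurable f)
    (x : Sp N) : pot τ (fun y => f y + g y) x = pot τ f x + pot τ g x := by
  unfold pot
  rw [← lintegral_add_left']
  · congr 1; ext y; ring
  · have := continuous_majKer (N := N) hτ
    exact AEMeasurable.mul (by fun_prop) hf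

/-- Substitute for the semigroup property: Fubini, then the composition estimate for the two
kernels. -/
lemma pot_pot_le {a b τ : ℝ} (ha : 0 < a) (hb : 0 < b) (haτ : a ≤ τ)
    (hbτ : b ≤ τ) (hτ : τ ≤ a + b) {f : Sp N → ℝ≥0∞} (hf : AEMeasurable f) (x : Sp N) :
    pot a (pot b f) x ≤ ENNReal.ofReal (2 ^ (N + 2) * majMass N) * pot τ f x := by
  have ca := continuous_majKer (N := N) ha
  have cb := continuous_majKer (N := N) hb
  have cτ := continuous_majKer (N := N) (ha.trans_le haτ)
  unfold pot
  calc ∫⁻ y, ENNReal.ofReal (majKer a (x - y)) *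
        ∫⁻ z, ENNReal.ofReal (majKer b (y - z)) * f z
      = ∫⁻ y, ∫⁻ z, ENNReal.ofReal (majKer a (x - y)) *
          (ENNReal.ofReal (majKer b (y - z)) * f z) := by
        congr 1; ext y
        rw [lintegral_const_mul' _ _ ENNReal.ofReal_ne_top]
    _ = ∫⁻ z, ∫⁻ y, ENNReal.ofReal (majKer a (x - y)) *
          (ENNReal.ofReal (majKer b (y - z)) * f z) := by
        refine lintegral_lintegral_swap ?_
        refine AEMeasurable.mul (by fun_prop) (AEMeasurable.mul (by fun_prop) ?_)
        exact hf.comp_snd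
    _ = ∫⁻ z, (∫⁻ y, ENNReal.ofReal (majKer a (x - y)) * ENNReal.ofReal (majKer b (y - z)))
          * f z := by
        congr 1; ext z
        rw [← lintegral_mul_const]
        · congr 1; ext y; ring
        · fun_prop
    _ ≤ ∫⁻ z, (ENNReal.ofReal (2 ^ (N + 2) * majMass N) * ENNReal.ofReal (majKer τ (x - z)))
          * f z := by
        refine lintegral_mono fun z => ?_
        gcongr
        exact lintegral_majKer_mul_majKer_le ha hb haτ hbτ hτ x z
    _ = _ := by
        rw [← lintegral_const_mul' _ _ ENNReal.ofReal_ne_top]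
        congr 1; ext z; ring

/-- A potential is controlled by the masses of balls of any radius not exceeding `τ`. -/
lemma pot_le_of_ball {τ r : ℝ} (hr : 0 < r) (hrτ : r ≤ τ) {f : Sp N → ℝ≥0∞}
    (hf : AEMeasurable f) {S : ℝ≥0∞} (hS : ∀ z, ∫⁻ y in ball z r, f y ≤ S) (x : Sp N) :
    pot τ f x ≤ ENNReal.ofReal (2 ^ (N + 1) * majMass N) * (S / volume (ball (0 : Sp N) r)) := by
  have hτ := hr.trans_le hrτ
  have cτ := continuous_majKer (N := N) hτ
  set v := volume (ball (0 : Sp N) r) with hv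
  have hv0 : v ≠ 0 := (measure_ball_pos _ _ hr).ne'
  have hvt : v ≠ ⊤ := measure_ball_lt_top.ne
  have hvol : ∀ y : Sp N, volume (ball y r) = v := fun y => by
    rw [hv, Measure.addHaar_ball_center]
  -- Since r ≤ τ, moving z within a ball of radius r changes the kernel by at most the factor
  -- 2^(N+1). The kernel is thus bounded by its own ball averages, and Fubini transfers the
  -- averaging to f.
  have key : ∀ y : Sp N, v * ENNReal.ofReal (majKer τ (x - y)) ≤
      ∫⁻ z in ball y r, ENNReal.ofReal (2 ^ (N + 1) * majKer τ (x - z)) := by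
    intro y
    rw [← hvol y, mul_comm, ← setLIntegral_const]
    refine setLIntegral_mono (by fun_prop) fun z hz => ENNReal.ofReal_le_ofReal ?_
    have hz' : ‖z - y‖ < r := by simpa [dist_eq_norm] using hz
    have := majKer_le (τ := τ) (τ' := τ) (A := 2) (B := 1) (x := x - y) (x' := x - z) hτ hτ
      (by linarith) (by
        have : ‖x - z‖ ≤ ‖x - y‖ + ‖z - y‖ := by
          calc ‖x - z‖ = ‖(x - y) - (z - y)‖ := by congr 1; abel
            _ ≤ _ := norm_sub_le _ _
        have := norm_nonneg (x - y)
        linarith)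
    simpa using this
  have hmeas : MeasurableSet {q : Sp N × Sp N | q.2 ∈ ball q.1 r} := by
    have : {q : Sp N × Sp N | q.2 ∈ ball q.1 r} = {q | dist q.2 q.1 < r} := by ext; simp
    rw [this]
    exact measurableSet_lt (by fun_prop) (by fun_prop)
  have main : v * pot τ f x ≤ ENNReal.ofReal (2 ^ (N + 1) * majMass N) * S := by
    calc v * pot τ f x = ∫⁻ y, v * (ENNReal.ofReal (majKer τ (x - y)) * f y) := by
          rw [pot, lintegral_const_mul' _ _ hvt]
      _ ≤ ∫⁻ y, (∫⁻ z, (ball y r).indicator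
            (fun z => ENNReal.ofReal (2 ^ (N + 1) * majKer τ (x - z))) z) * f y := by
          refine lintegral_mono fun y => ?_
          rw [← mul_assoc]
          gcongr
          rw [lintegral_indicator measurableSet_ball]
          exact key y
      _ = ∫⁻ y, ∫⁻ z, (ball y r).indicator
            (fun z => ENNReal.ofReal (2 ^ (N + 1) * majKer τ (x - z))) z * f y := by
          congr 1; ext y
          rw [lintegral_mul_const]
          exact Measurable.indicator (by fun_prop) measurableSet_ball
      _ = ∫⁻ z, ∫⁻ y, (ball y r).indicator
            (fun z => ENNReal.ofReal (2 ^ (N + 1) * majKer τ (x - z))) z * f y := by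
          refine lintegral_lintegral_swap ?_
          refine AEMeasurable.mul (Measurable.aemeasurable ?_) hf.comp_fst
          have : (fun q : Sp N × Sp N => (ball q.1 r).indicator
            (fun z => ENNReal.ofReal (2 ^ (N + 1) * majKer τ (x - z))) q.2) =
            {q : Sp N × Sp N | q.2 ∈ ball q.1 r}.indicator
            (fun q => ENNReal.ofReal (2 ^ (N + 1) * majKer τ (x - q.2))) := by
            ext ⟨y, z⟩
            simp [indicator]
          rw [this]
          exact Measurable.indicator (by fun_prop) hmeas
      _ = ∫⁻ z, ENNReal.ofReal (2 ^ (N + 1) * majKer τ (x - z)) * ∫⁻ y in ball z r, f y := by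
          congr 1; ext z
          rw [← lintegral_indicator measurableSet_ball,
            ← lintegral_const_mul' _ _ ENNReal.ofReal_ne_top]
          congr 1; ext y
          by_cases h : z ∈ ball y r
          · rw [indicator_of_mem h, indicator_of_mem (mem_ball_comm.1 h)]
          · rw [indicator_of_notMem h, indicator_of_notMem (fun h' => h (mem_ball_comm.1 h'))]
            simp
      _ ≤ ∫⁻ z, ENNReal.ofReal (2 ^ (N + 1) * majKer τ (x - z)) * S := by
          refine lintegral_mono fun z => ?_
          gcongr
          exact hS z
      _ = _ := by
          rw [lintegral_mul_const _ (by fun_prop)]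
          simp_rw [ENNReal.ofReal_mul (show (0 : ℝ) ≤ 2 ^ (N + 1) by positivity)]
          rw [lintegral_const_mul' _ _ ENNReal.ofReal_ne_top, lintegral_majKer_sub hτ]
  rw [← mul_div_assoc, ENNReal.le_div_iff_mul_le (Or.inl hv0) (Or.inl hvt), mul_comm]
  exact main

/-! ### Decay of Fourier integrals by finite differences -/

/-- Cauchy estimates in difference form: by the Schwarz lemma each difference gains a factor 2|h|/δ
and costs a margin δ of the disc. -/
lemma norm_fwdDiff_iter_le_of_differentiableOn {h : ℂ} {δ : ℝ} (hδ : ‖h‖ < δ) (n : ℕ) :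
    ∀ (g : ℂ → ℂ) (M R : ℝ), DifferentiableOn ℂ g (ball 0 (R + n * δ)) →
      (∀ z ∈ ball (0 : ℂ) (R + n * δ), ‖g z‖ ≤ M) →
      ∀ z ∈ ball (0 : ℂ) R, ‖(fwdDiff h)^[n] g z‖ ≤ (2 * ‖h‖ / δ) ^ n * M := by
  have hδ0 : 0 < δ := (norm_nonneg h).trans_lt hδ
  induction n with
  | zero => intro g M R _ hM z hz; simpa using hM z (by simpa using hz)
  | succ n ih =>
    intro g M R hg hM z hz
    rw [Function.iterate_succ_apply]
    have hsub : ∀ w ∈ ball (0 : ℂ) (R + n * δ), ball w δ ⊆ ball 0 (R + (n + 1 : ℕ) * δ) := by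
      intro w hw
      refine ball_subset_ball' ?_
      push_cast
      have := mem_ball.1 hw
      linarith
    have hmemh : ∀ w : ℂ, w + h ∈ ball w δ := fun w => by simpa [dist_eq_norm] using hδ
    have hsub0 : ball (0 : ℂ) (R + n * δ) ⊆ ball 0 (R + (n + 1 : ℕ) * δ) := fun w hw =>
      hsub w hw (mem_ball_self hδ0)
    have h1 := ih (fwdDiff h g) (2 * ‖h‖ / δ * M) R ?_ ?_ z hz
    · rw [pow_succ, mul_assoc]
      exact h1
    · refine DifferentiableOn.sub (f := fun w => g (w + h)) ?_ (hg.mono hsub0)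
      exact hg.comp (by fun_prop) fun w hw => hsub w hw (hmemh w)
    · intro w hw
      -- The target radius is 2M because the values of g, all bounded by M, are compared with g w.
      have := Complex.dist_le_div_mul_dist_of_mapsTo_ball (f := g) (c := w) (R₁ := δ)
        (R₂ := 2 * M) (z := w + h) (hg.mono (hsub w hw)) (fun v hv => ?_) (hmemh w)
      · rw [fwdDiff, ← dist_eq_norm]
        refine this.trans (le_of_eq ?_)
        rw [dist_eq_norm, add_sub_cancel_left]
        ring
      · rw [mem_closedBall, dist_eq_norm]
        refine (norm_sub_le _ _).trans ?_
        have e1 := hM v (hsub w hw hv)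
        have e2 := hM w (hsub0 hw)
        linarith

/-- The bound without any smoothness, for points whose distance to the singularity is comparable
with the step. -/
lemma norm_fwdDiff_iter_le {E : Type*} [NormedAddCommGroup E] {h : E} (n : ℕ) :
    ∀ (F : E → ℂ) (M R : ℝ), (∀ ξ, ‖ξ‖ ≤ R + n * ‖h‖ → ‖F ξ‖ ≤ M) →
      ∀ ξ, ‖ξ‖ ≤ R → ‖(fwdDiff h)^[n] F ξ‖ ≤ 2 ^ n * M := by
  induction n with
  | zero => intro F M R hM ξ hξ; simpa using hM ξ (by simpa using hξ)
  | succ n ih =>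
    intro F M R hM ξ hξ
    rw [Function.iterate_succ_apply, pow_succ, mul_assoc]
    refine ih (fwdDiff h F) (2 * M) R (fun η hη => ?_) ξ hξ
    refine (norm_sub_le _ _).trans ?_
    have e1 := hM (η + h) (by
      push_cast
      have := norm_add_le η h
      linarith)
    have e2 := hM η (by
      push_cast
      have := norm_nonneg h
      linarith)
    linarith

/-- An iterated difference sees only the points ξ + jh, so it is a unit-step difference of a
function of one complex variable. -/
lemma fwdDiff_iter_line {E : Type*} [NormedAddCommGroup E] [NormedSpace ℝ E] (h : E) (n : ℕ)
    (F : E → ℂ) (ξ : E) (g : ℂ → ℂ) :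
    (∀ j : ℕ, j ≤ n → g j = F (ξ + (j : ℝ) • h)) →
    (fwdDiff h)^[n] F ξ = (fwdDiff 1)^[n] g 0 := by
  intro hg
  rw [fwdDiff_iter_eq_sum_shift, fwdDiff_iter_eq_sum_shift]
  refine Finset.sum_congr rfl fun j hj => ?_
  rw [zero_add, nsmul_one, hg j (by simpa [Nat.lt_succ_iff] using hj), Nat.cast_smul_eq_nsmul]

/-- The Fourier integral `∫ e^{i x·ξ} F(ξ) dξ`. -/
def fint (F : Sp N → ℂ) (x : Sp N) : ℂ :=
  ∫ ξ, Complex.exp (Complex.I * ((inner ℝ x ξ : ℝ) : ℂ)) * F ξ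

lemma norm_exp_I_inner (x ξ : Sp N) :
    ‖Complex.exp (Complex.I * ((inner ℝ x ξ : ℝ) : ℂ))‖ = 1 := by
  rw [mul_comm, Complex.norm_exp_ofReal_mul_I]

lemma continuous_exp_I_inner (x : Sp N) :
    Continuous fun ξ : Sp N => Complex.exp (Complex.I * ((inner ℝ x ξ : ℝ) : ℂ)) := by
  fun_prop

lemma integrable_fint {F : Sp N → ℂ} (hF : Integrable F) (x : Sp N) :
    Integrable fun ξ => Complex.exp (Complex.I * ((inner ℝ x ξ : ℝ) : ℂ)) * F ξ := by
  refine hF.bdd_mul (c := 1) (continuous_exp_I_inner x).aestronglyMeasurable ?_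
  exact Filter.Eventually.of_forall fun ξ => (norm_exp_I_inner x ξ).le

lemma norm_fint_le (F : Sp N → ℂ) (x : Sp N) : ‖fint F x‖ ≤ ∫ ξ, ‖F ξ‖ := by
  refine (norm_integral_le_integral_norm _).trans (le_of_eq ?_)
  simp

lemma integrable_fwdDiff {F : Sp N → ℂ} (hF : Integrable F) (h : Sp N) :
    Integrable (fwdDiff h F) :=
  (hF.comp_add_right h).sub hF

/-- A translation of F by h multiplies the Fourier integral by e^{-ix·h} = -1. Differences therefore
multiply it by -2 and never lose size. -/
lemma fint_fwdDiff {F : Sp N → ℂ} (hF : Integrable F) {x h : Sp N}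
    (hx : (inner ℝ x h : ℝ) = Real.pi) : fint (fwdDiff h F) x = -2 * fint F x := by
  unfold fint fwdDiff
  simp_rw [mul_sub]
  rw [integral_sub]
  · have h1 : ∀ ξ : Sp N, Complex.exp (Complex.I * ((inner ℝ x ξ : ℝ) : ℂ)) * F (ξ + h) =
        -(Complex.exp (Complex.I * ((inner ℝ x (ξ + h) : ℝ) : ℂ)) * F (ξ + h)) := by
      intro ξ
      rw [inner_add_right, hx]
      push_cast
      rw [mul_add, Complex.exp_add, mul_comm Complex.I (Real.pi : ℂ), Complex.exp_pi_mul_I]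
      ring
    simp_rw [h1]
    rw [integral_neg, integral_add_right_eq_self
      (fun ξ => Complex.exp (Complex.I * ((inner ℝ x ξ : ℝ) : ℂ)) * F ξ) h]
    ring
  · exact integrable_fint (hF.comp_add_right h) x
  · exact integrable_fint hF x

lemma fint_fwdDiff_iter {x h : Sp N} (hx : (inner ℝ x h : ℝ) = Real.pi) (n : ℕ) :
    ∀ {F : Sp N → ℂ}, Integrable F → Integrable ((fwdDiff h)^[n] F) ∧
      fint ((fwdDiff h)^[n] F) x = (-2) ^ n * fint F x := by
  induction n with
  | zero => intro F hF; simpa using hF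
  | succ n ih =>
    intro F hF
    rw [Function.iterate_succ_apply]
    obtain ⟨h1, h2⟩ := ih (integrable_fwdDiff hF h)
    refine ⟨h1, ?_⟩
    rw [h2, fint_fwdDiff hF hx, pow_succ]
    ring

/-- `F - c` vanishes to first order at the origin and extends holomorphically along lines, to a
complex disc of size comparable with the distance to the origin. -/
def LineHolo (κ M : ℝ) (c : ℂ) (F : Sp N → ℂ) : Prop :=
  (∀ ξ, ‖F ξ - c‖ ≤ M * ‖ξ‖) ∧ ∀ ξ h : Sp N, ξ ≠ 0 → h ≠ 0 → ∃ g : ℂ → ℂ,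
    DifferentiableOn ℂ g (ball 0 (κ * ‖ξ‖ / ‖h‖)) ∧
    (∀ z ∈ ball (0 : ℂ) (κ * ‖ξ‖ / ‖h‖), ‖g z - c‖ ≤ M * ‖ξ‖) ∧
    ∀ s : ℝ, |s| < κ * ‖ξ‖ / ‖h‖ → g s = F (ξ + s • h)

lemma fwdDiff_iter_sub_const {A : Type*} [AddCommMonoid A] (h : A) (F : A → ℂ) (c : ℂ) (n : ℕ) :
    (fwdDiff h)^[n + 1] (fun ξ => F ξ - c) = (fwdDiff h)^[n + 1] F := by
  rw [Function.iterate_succ_apply, Function.iterate_succ_apply]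
  congr 1
  ext ξ
  simp [fwdDiff]

/-- Where |ξ| > A|h|, analyticity gives M|ξ|(|h|/|ξ|)^(N+2); nearer the origin the crude bound gives
M|h|. Both are comparable with the right-hand side. Order N + 2 is the first whose gain, after
paying the factor |ξ|, leaves the power |ξ|^(-N-1), integrable at infinity. -/
lemma exists_norm_fwdDiff_iter_le_majKer (N : ℕ) {κ : ℝ} (hκ : 0 < κ) :
    ∃ C : ℝ, 0 < C ∧ ∀ (M : ℝ), 0 ≤ M → ∀ (c : ℂ) (F : Sp N → ℂ), LineHolo κ M c F →
      ∀ h : Sp N, h ≠ 0 → ∀ ξ : Sp N,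
      ‖(fwdDiff h)^[N + 2] F ξ‖ ≤ C * M * ‖h‖ ^ (N + 1) * majKer ‖h‖ ξ := by
  -- The disc of radius κ|ξ|/|h| is divided into N + 3 margins δ, one for the base disc and N + 2
  -- for the differences. The unit step is shorter than δ exactly when |ξ| > A|h|.
  set A : ℝ := (N + 3) / κ with hA
  have hA0 : 0 < A := by positivity
  refine ⟨(2 * A) ^ (N + 2) * (1 + 1 / A) ^ (N + 1) + 2 ^ (N + 2) * (A + (N + 2)) *
    (1 + A) ^ (N + 1), by positivity, fun M hM c F hF h hh ξ => ?_⟩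
  have hh0 : 0 < ‖h‖ := norm_pos_iff.2 hh
  have hk := majKer_pos hh0 ξ
  rw [← fwdDiff_iter_sub_const h F c (N + 1)]
  rcases le_or_gt ‖ξ‖ (A * ‖h‖) with hξ | hξ
  · have h1 := norm_fwdDiff_iter_le (h := h) (N + 1 + 1) (fun ξ => F ξ - c)
      (M * ((A + (N + 2)) * ‖h‖)) (A * ‖h‖) (fun η hη => (hF.1 η).trans (by
        gcongr
        refine hη.trans (le_of_eq ?_)
        push_cast; ring)) ξ hξ
    refine h1.trans ?_
    have h2 : ‖h‖ ≤ (1 + A) ^ (N + 1) * (‖h‖ ^ (N + 1) * majKer ‖h‖ ξ) := by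
      unfold majKer
      have h3 : (‖h‖ + ‖ξ‖) ^ (N + 1) ≤ ((1 + A) * ‖h‖) ^ (N + 1) := by
        gcongr; linarith
      rw [← mul_div_assoc, ← mul_div_assoc, le_div_iff₀ (by positivity)]
      calc ‖h‖ * (‖h‖ + ‖ξ‖) ^ (N + 1) ≤ ‖h‖ * ((1 + A) * ‖h‖) ^ (N + 1) := by gcongr
        _ = _ := by rw [mul_pow]; ring
    calc 2 ^ (N + 1 + 1) * (M * ((A + (N + 2)) * ‖h‖))
        ≤ 2 ^ (N + 1 + 1) * (M * ((A + (N + 2)) * ((1 + A) ^ (N + 1) *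
          (‖h‖ ^ (N + 1) * majKer ‖h‖ ξ)))) := by gcongr
      _ = (0 + 2 ^ (N + 2) * (A + (N + 2)) * (1 + A) ^ (N + 1)) * M * ‖h‖ ^ (N + 1) *
          majKer ‖h‖ ξ := by ring
      _ ≤ _ := by gcongr; positivity
  · have hξ0 : 0 < ‖ξ‖ := lt_trans (by positivity) hξ
    obtain ⟨g, hg1, hg2, hg3⟩ := hF.2 ξ h (norm_pos_iff.1 hξ0) hh
    set δ : ℝ := ‖ξ‖ / (A * ‖h‖) with hδ
    have hδ1 : 1 < δ := by rw [hδ, lt_div_iff₀ (by positivity)]; linarith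
    have hrad : κ * ‖ξ‖ / ‖h‖ = δ + (N + 1 + 1 : ℕ) * δ := by
      rw [hδ, hA]; push_cast; field_simp; ring
    rw [hrad] at hg1 hg2 hg3
    rw [fwdDiff_iter_line h (N + 1 + 1) _ ξ (fun z => g z - c)]
    · have h1 := norm_fwdDiff_iter_le_of_differentiableOn (h := 1) (δ := δ) (by simpa using hδ1)
        (N + 1 + 1) (fun z => g z - c) (M * ‖ξ‖) δ (hg1.sub_const c) hg2 0
        (mem_ball_self (by linarith))
      refine h1.trans ?_
      have h3 : (2 * ‖(1 : ℂ)‖ / δ) ^ (N + 1 + 1) * (M * ‖ξ‖) =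
          (2 * A) ^ (N + 2) * M * (‖h‖ ^ (N + 2) / ‖ξ‖ ^ (N + 1)) := by
        have h6 : 2 * ‖(1 : ℂ)‖ / δ = 2 * A * ‖h‖ / ‖ξ‖ := by
          rw [hδ, norm_one]; field_simp
        rw [h6, div_pow, mul_pow _ ‖h‖, pow_succ ‖ξ‖ (N + 1)]
        field_simp
      have h4 : ‖h‖ ^ (N + 2) / ‖ξ‖ ^ (N + 1) ≤
          (1 + 1 / A) ^ (N + 1) * (‖h‖ ^ (N + 1) * majKer ‖h‖ ξ) := by
        unfold majKer
        have h5 : (‖h‖ + ‖ξ‖) ^ (N + 1) ≤ ((1 + 1 / A) * ‖ξ‖) ^ (N + 1) := by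
          gcongr
          have : ‖h‖ ≤ 1 / A * ‖ξ‖ := by
            rw [one_div, inv_mul_eq_div, le_div_iff₀ hA0]; linarith
          linarith
        rw [← mul_div_assoc, ← mul_div_assoc, div_le_div_iff₀ (by positivity) (by positivity)]
        calc ‖h‖ ^ (N + 2) * (‖h‖ + ‖ξ‖) ^ (N + 1)
            ≤ ‖h‖ ^ (N + 2) * ((1 + 1 / A) * ‖ξ‖) ^ (N + 1) := by gcongr
          _ = _ := by rw [mul_pow]; ring
      rw [h3]
      calc (2 * A) ^ (N + 2) * M * (‖h‖ ^ (N + 2) / ‖ξ‖ ^ (N + 1))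
          ≤ (2 * A) ^ (N + 2) * M * ((1 + 1 / A) ^ (N + 1) *
            (‖h‖ ^ (N + 1) * majKer ‖h‖ ξ)) := by gcongr
        _ = ((2 * A) ^ (N + 2) * (1 + 1 / A) ^ (N + 1) + 0) * M * ‖h‖ ^ (N + 1) *
            majKer ‖h‖ ξ := by ring
        _ ≤ _ := by gcongr; positivity
    · intro j hj
      have hj' : (j : ℝ) ≤ (N + 1 + 1 : ℕ) := by exact_mod_cast hj
      have := hg3 j (by
        rw [abs_of_nonneg (by positivity)]
        have : (N + 1 + 1 : ℕ) * (1 : ℝ) ≤ (N + 1 + 1 : ℕ) * δ := by gcongr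
        linarith)
      simp only [← this, Complex.ofReal_natCast]

/-- Decay of Fourier integrals of functions with a conical singularity at the origin. -/
lemma exists_norm_fint_le (N : ℕ) {κ : ℝ} (hκ : 0 < κ) :
    ∃ C : ℝ, 0 < C ∧ ∀ (M : ℝ), 0 ≤ M → ∀ (c : ℂ) (F : Sp N → ℂ), LineHolo κ M c F →
      Integrable F → (∫ ξ, ‖F ξ‖) ≤ M → ∀ x : Sp N, ‖fint F x‖ ≤ C * M * majKer 1 x := by
  obtain ⟨C, hC, hC'⟩ := exists_norm_fwdDiff_iter_le_majKer N hκ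
  have hm := majMass_pos (N := N)
  refine ⟨2 ^ (N + 1) * (1 + C * majMass N * Real.pi ^ (N + 1)),
    by have := Real.pi_pos; positivity, fun M hM c F hF hFi hFM x => ?_⟩
  have hk := majKer_pos one_pos x
  have hpi := Real.pi_pos
  have hone : (1 + ‖x‖) ^ (N + 1) * majKer 1 x = 1 := by
    unfold majKer
    field_simp
  rcases le_or_gt ‖x‖ 1 with hx | hx
  · have h1 : (1 : ℝ) ≤ 2 ^ (N + 1) * majKer 1 x := by
      calc (1 : ℝ) = (1 + ‖x‖) ^ (N + 1) * majKer 1 x := hone.symm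
        _ ≤ 2 ^ (N + 1) * majKer 1 x := by
          gcongr
          linarith
    calc ‖fint F x‖ ≤ M * 1 := by simpa using (norm_fint_le F x).trans hFM
      _ ≤ M * (2 ^ (N + 1) * majKer 1 x) := by gcongr
      _ = (2 ^ (N + 1) * (1 + 0)) * M * majKer 1 x := by ring
      _ ≤ _ := by gcongr; positivity
  · have hx0 : 0 < ‖x‖ := by linarith
    -- This step satisfies x·h = π and |h| = π/|x|, so a difference bound of order |h|^(N+1) becomes
    -- decay of order |x|^(-N-1).
    set h : Sp N := (Real.pi / ‖x‖ ^ 2) • x with hh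
    have hnorm : ‖h‖ = Real.pi / ‖x‖ := by
      rw [hh, norm_smul, Real.norm_of_nonneg (by positivity)]
      field_simp
    have hh0 : 0 < ‖h‖ := by rw [hnorm]; positivity
    have hin : (inner ℝ x h : ℝ) = Real.pi := by
      rw [hh, inner_smul_right, real_inner_self_eq_norm_sq]
      field_simp
    obtain ⟨-, h2⟩ := fint_fwdDiff_iter hin (N + 2) hFi
    have h3 : ‖fint F x‖ ≤ ‖fint ((fwdDiff h)^[N + 2] F) x‖ := by
      rw [h2, norm_mul, norm_pow, norm_neg, Complex.norm_ofNat]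
      refine le_mul_of_one_le_left (norm_nonneg _) ?_
      exact one_le_pow₀ (by norm_num)
    have h4 : ∫ ξ, ‖(fwdDiff h)^[N + 2] F ξ‖ ≤ C * M * ‖h‖ ^ (N + 1) * majMass N := by
      rw [← integral_majKer hh0, ← integral_const_mul]
      exact integral_mono_of_nonneg (Filter.Eventually.of_forall fun _ => norm_nonneg _)
        ((integrable_majKer hh0).const_mul _)
        (Filter.Eventually.of_forall fun ξ => hC' M hM c F hF h (norm_pos_iff.1 hh0) ξ)
    have h5 : ‖h‖ ^ (N + 1) ≤ 2 ^ (N + 1) * Real.pi ^ (N + 1) * majKer 1 x := by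
      calc ‖h‖ ^ (N + 1) = ‖h‖ ^ (N + 1) * ((1 + ‖x‖) ^ (N + 1) * majKer 1 x) := by
            rw [hone, mul_one]
        _ = (‖h‖ * (1 + ‖x‖)) ^ (N + 1) * majKer 1 x := by rw [mul_pow]; ring
        _ ≤ (2 * Real.pi) ^ (N + 1) * majKer 1 x := by
            refine mul_le_mul_of_nonneg_right (pow_le_pow_left₀ (by positivity) ?_ _) hk.le
            rw [hnorm, div_mul_eq_mul_div, div_le_iff₀ hx0]
            nlinarith
        _ = _ := by rw [mul_pow]
    calc ‖fint F x‖ ≤ C * M * ‖h‖ ^ (N + 1) * majMass N :=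
          h3.trans ((norm_fint_le _ x).trans h4)
      _ ≤ C * M * (2 ^ (N + 1) * Real.pi ^ (N + 1) * majKer 1 x) * majMass N := by gcongr
      _ = (2 ^ (N + 1) * (0 + C * majMass N * Real.pi ^ (N + 1))) * M * majKer 1 x := by ring
      _ ≤ _ := by gcongr; positivity

/-! ### The symbol `e^{-|ξ|^d}` -/

/-- The symbol `e^{-|ξ|^d}` of the fundamental solution at time one. -/
def symb (d : ℝ) (ξ : Sp N) : ℂ := ((Real.exp (-‖ξ‖ ^ d) : ℝ) : ℂ)

lemma norm_exp_neg_mul_le {a : ℝ} (ha : 0 ≤ a) {w : ℂ} (hw : ‖w - 1‖ ≤ 1 / 2) :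
    ‖Complex.exp (-((a : ℂ) * w))‖ ≤ 1 := by
  rw [Complex.norm_exp, Real.exp_le_one_iff]
  have h1 : |(w - 1).re| ≤ 1 / 2 := (Complex.abs_re_le_norm _).trans hw
  have h2 := (abs_le.1 h1).1
  simp only [Complex.sub_re, Complex.one_re] at h2
  simp only [Complex.neg_re, Complex.re_ofReal_mul]
  have : 0 ≤ a * w.re := mul_nonneg ha (by linarith)
  linarith

/-- For a ≤ 1/2 use |e^z - 1| ≤ 2|z| and a^d ≤ a, which is where d > 1 enters. For a > 1/2 the
trivial bound 2 is below 4a. -/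
lemma norm_exp_neg_rpow_mul_sub_one_le {d : ℝ} (hd : 1 < d) {a : ℝ} (ha : 0 ≤ a) {w : ℂ}
    (hw : ‖w - 1‖ ≤ 1 / 2) :
    ‖Complex.exp (-(((a ^ d : ℝ) : ℂ) * w)) - 1‖ ≤ 4 * a := by
  have hw2 : ‖w‖ ≤ 2 := by
    calc ‖w‖ = ‖(w - 1) + 1‖ := by ring_nf
      _ ≤ ‖w - 1‖ + ‖(1 : ℂ)‖ := norm_add_le _ _
      _ ≤ 2 := by rw [norm_one]; linarith
  have had : 0 ≤ a ^ d := by positivity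
  rcases le_or_gt a (1 / 2) with h | h
  · have h1 : a ^ d ≤ a := by
      rcases ha.eq_or_lt with rfl | ha'
      · rw [Real.zero_rpow (by linarith)]
      · calc a ^ d ≤ a ^ (1 : ℝ) := Real.rpow_le_rpow_of_exponent_ge ha' (by linarith) hd.le
          _ = a := Real.rpow_one a
    have h2 : ‖-(((a ^ d : ℝ) : ℂ) * w)‖ ≤ a * 2 := by
      rw [norm_neg, norm_mul, Complex.norm_real, Real.norm_of_nonneg had]
      gcongr
    refine (Complex.norm_exp_sub_one_le (h2.trans (by linarith))).trans ?_
    linarith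
  · refine (norm_sub_le _ _).trans ?_
    have := norm_exp_neg_mul_le had hw
    rw [norm_one]
    linarith

/-- On the line, |ξ+sh|² = |ξ|²(1+ζ(s)) with ζ a quadratic polynomial, so |ξ+sh|^d = |ξ|^d
(1+ζ(s))^(d/2) extends holomorphically as long as |ζ| < 1. With y = |z||h|/|ξ| < κ ≤ 1 one has |ζ| ≤
2y + y² < 3κ. The choice of κ also keeps the power within 1/2 of 1, so that the exponential stays
bounded by 1. -/
lemma exists_symb_extension {d : ℝ} (hd : 1 < d) :
    ∃ κ : ℝ, 0 < κ ∧ κ ≤ 1 ∧ ∀ ξ h : Sp N, ξ ≠ 0 → h ≠ 0 → ∃ g : ℂ → ℂ,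
      DifferentiableOn ℂ g (ball 0 (κ * ‖ξ‖ / ‖h‖)) ∧
      (∀ z ∈ ball (0 : ℂ) (κ * ‖ξ‖ / ‖h‖), ‖g z - 1‖ ≤ 4 * ‖ξ‖ ∧ ‖g z‖ ≤ 1) ∧
      ∀ s : ℝ, g s = symb d (ξ + s • h) := by
  have hcont : ContinuousAt (fun ζ : ℂ => (1 + ζ) ^ ((d / 2 : ℝ) : ℂ)) 0 := by
    refine ContinuousAt.cpow (by fun_prop) (by fun_prop) ?_
    simp
  obtain ⟨ε, hε, hε'⟩ := Metric.continuousAt_iff.1 hcont (1 / 2) (by norm_num)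
  set κ : ℝ := min ε 1 / 3 with hκ
  have hm : 0 < min ε 1 := lt_min hε one_pos
  have hm1 : min ε 1 ≤ 1 := min_le_right _ _
  refine ⟨κ, by positivity, by linarith, fun ξ h hξ hh => ?_⟩
  have hξ0 : 0 < ‖ξ‖ := norm_pos_iff.2 hξ
  have hh0 : 0 < ‖h‖ := norm_pos_iff.2 hh
  set ζ : ℂ → ℂ := fun z =>
    (2 * z * ((inner ℝ ξ h : ℝ) : ℂ) + z ^ 2 * ((‖h‖ ^ 2 : ℝ) : ℂ)) / ((‖ξ‖ ^ 2 : ℝ) : ℂ) with hζ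
  have hζb : ∀ z ∈ ball (0 : ℂ) (κ * ‖ξ‖ / ‖h‖), ‖ζ z‖ < min ε 1 := by
    intro z hz
    rw [mem_ball_zero_iff] at hz
    set y : ℝ := ‖z‖ * ‖h‖ / ‖ξ‖ with hy
    have hy0 : 0 ≤ y := by positivity
    have hyκ : y < κ := by
      rw [hy, div_lt_iff₀ hξ0]
      rwa [lt_div_iff₀ hh0] at hz
    have h1 : ‖ζ z‖ ≤ 2 * y + y ^ 2 := by
      simp only [hζ]
      rw [norm_div, Complex.norm_real, Real.norm_of_nonneg (by positivity : (0 : ℝ) ≤ ‖ξ‖ ^ 2),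
        div_le_iff₀ (by positivity)]
      refine (norm_add_le _ _).trans ?_
      rw [norm_mul, norm_mul, norm_mul, norm_pow, Complex.norm_real, Complex.norm_real,
        Real.norm_of_nonneg (by positivity : (0 : ℝ) ≤ ‖h‖ ^ 2), Complex.norm_ofNat]
      have h2 : ‖(inner ℝ ξ h : ℝ)‖ ≤ ‖ξ‖ * ‖h‖ := norm_inner_le_norm _ _
      calc 2 * ‖z‖ * ‖(inner ℝ ξ h : ℝ)‖ + ‖z‖ ^ 2 * ‖h‖ ^ 2
          ≤ 2 * ‖z‖ * (‖ξ‖ * ‖h‖) + ‖z‖ ^ 2 * ‖h‖ ^ 2 := by gcongr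
        _ = _ := by rw [hy]; field_simp
    nlinarith
  have hslit : ∀ z ∈ ball (0 : ℂ) (κ * ‖ξ‖ / ‖h‖), 1 + ζ z ∈ Complex.slitPlane := by
    intro z hz
    refine Complex.mem_slitPlane_of_norm_lt_one ((hζb z hz).trans_le hm1)
  have hw : ∀ z ∈ ball (0 : ℂ) (κ * ‖ξ‖ / ‖h‖), ‖(1 + ζ z) ^ ((d / 2 : ℝ) : ℂ) - 1‖ ≤ 1 / 2 := by
    intro z hz
    have := hε' (x := ζ z) (by simpa using (hζb z hz).trans_le (min_le_left _ _))
    simp only [add_zero, Complex.one_cpow, dist_eq_norm] at this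
    exact this.le
  refine ⟨fun z => Complex.exp (-(((‖ξ‖ ^ d : ℝ) : ℂ) * (1 + ζ z) ^ ((d / 2 : ℝ) : ℂ))),
    ?_, fun z hz => ⟨norm_exp_neg_rpow_mul_sub_one_le hd hξ0.le (hw z hz),
      norm_exp_neg_mul_le (by positivity) (hw z hz)⟩, fun s => ?_⟩
  · refine DifferentiableOn.cexp (DifferentiableOn.neg (DifferentiableOn.const_mul ?_ _))
    refine DifferentiableOn.cpow ?_ (by fun_prop) hslit
    simp only [hζ]
    fun_prop
  · have h1 : 1 + ζ s = ((‖ξ + s • h‖ ^ 2 / ‖ξ‖ ^ 2 : ℝ) : ℂ) := by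
      rw [norm_add_sq_real, inner_smul_right, norm_smul, mul_pow, Real.norm_eq_abs, sq_abs]
      simp only [hζ]
      have : ((‖ξ‖ : ℝ) : ℂ) ≠ 0 := by exact_mod_cast hξ0.ne'
      push_cast
      field_simp
      ring
    simp only [symb]
    rw [h1, ← Complex.ofReal_cpow (by positivity)]
    have h2 : (‖ξ + s • h‖ ^ 2 / ‖ξ‖ ^ 2) ^ (d / 2) = ‖ξ + s • h‖ ^ d / ‖ξ‖ ^ d := by
      rw [Real.div_rpow (by positivity) (by positivity), ← Real.rpow_natCast,
        ← Real.rpow_natCast, ← Real.rpow_mul (by positivity), ← Real.rpow_mul (by positivity)]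
      congr 2 <;> push_cast <;> ring
    rw [h2]
    have h3 : ‖ξ‖ ^ d ≠ 0 := by positivity
    rw [← Complex.ofReal_mul, mul_div_cancel₀ _ h3]
    push_cast
    rfl

lemma norm_symb_sub_one_le {d : ℝ} (hd : 1 < d) (ξ : Sp N) : ‖symb d ξ - 1‖ ≤ 4 * ‖ξ‖ := by
  have := norm_exp_neg_rpow_mul_sub_one_le hd (norm_nonneg ξ) (w := 1) (by simp)
  rw [symb]
  push_cast
  simpa using this

lemma norm_symb_le (d : ℝ) (ξ : Sp N) : ‖symb d ξ‖ ≤ 1 := by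
  rw [symb, Complex.norm_real, Real.norm_of_nonneg (Real.exp_pos _).le, Real.exp_le_one_iff]
  have : 0 ≤ ‖ξ‖ ^ d := by positivity
  linarith

/-- The first symbol yields the kernel and the second its derivative in direction v. Since κ ≤ 1,
the factor v·(ξ+zh) is at most 2|v||ξ| on the disc. -/
lemma exists_lineHolo_symb (N : ℕ) {d : ℝ} (hd : 1 < d) :
    ∃ κ : ℝ, 0 < κ ∧ LineHolo κ 4 1 (symb d : Sp N → ℂ) ∧
      ∀ v : Sp N, LineHolo κ (2 * ‖v‖) 0 (fun ξ => ((inner ℝ v ξ : ℝ) : ℂ) * symb d ξ) := by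
  obtain ⟨κ, hκ, hκ1, h⟩ := exists_symb_extension (N := N) hd
  refine ⟨κ, hκ, ⟨norm_symb_sub_one_le hd, fun ξ η hξ hη => ?_⟩, fun v => ⟨fun ξ => ?_,
    fun ξ η hξ hη => ?_⟩⟩
  · obtain ⟨g, h1, h2, h3⟩ := h ξ η hξ hη
    exact ⟨g, h1, fun z hz => (h2 z hz).1, fun s _ => h3 s⟩
  · rw [sub_zero, norm_mul, Complex.norm_real]
    have e1 := norm_inner_le_norm (𝕜 := ℝ) v ξ
    have e2 := norm_symb_le d ξ
    calc ‖(inner ℝ v ξ : ℝ)‖ * ‖symb d ξ‖ ≤ (‖v‖ * ‖ξ‖) * 1 := by gcongr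
      _ ≤ 2 * ‖v‖ * ‖ξ‖ := by nlinarith [mul_nonneg (norm_nonneg v) (norm_nonneg ξ)]
  · obtain ⟨g, h1, h2, h3⟩ := h ξ η hξ hη
    have hη0 : 0 < ‖η‖ := norm_pos_iff.2 hη
    refine ⟨fun z => (((inner ℝ v ξ : ℝ) : ℂ) + z * ((inner ℝ v η : ℝ) : ℂ)) * g z, ?_,
      fun z hz => ?_, fun s _ => ?_⟩
    · exact DifferentiableOn.mul (by fun_prop) h1
    · rw [sub_zero, norm_mul]
      have e1 := norm_inner_le_norm (𝕜 := ℝ) v ξ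
      have e2 := norm_inner_le_norm (𝕜 := ℝ) v η
      have e3 := (h2 z hz).2
      have e4 : ‖z‖ * ‖η‖ ≤ ‖ξ‖ := by
        have := mem_ball_zero_iff.1 hz
        rw [lt_div_iff₀ hη0] at this
        refine this.le.trans ?_
        nlinarith [norm_nonneg ξ]
      have e5 : ‖((inner ℝ v ξ : ℝ) : ℂ) + z * ((inner ℝ v η : ℝ) : ℂ)‖ ≤ 2 * ‖v‖ * ‖ξ‖ := by
        refine (norm_add_le _ _).trans ?_
        rw [norm_mul, Complex.norm_real, Complex.norm_real]
        calc ‖(inner ℝ v ξ : ℝ)‖ + ‖z‖ * ‖(inner ℝ v η : ℝ)‖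
            ≤ ‖v‖ * ‖ξ‖ + ‖z‖ * (‖v‖ * ‖η‖) := by gcongr
          _ = ‖v‖ * ‖ξ‖ + ‖v‖ * (‖z‖ * ‖η‖) := by ring
          _ ≤ ‖v‖ * ‖ξ‖ + ‖v‖ * ‖ξ‖ := by gcongr
          _ = _ := by ring
      calc _ ≤ 2 * ‖v‖ * ‖ξ‖ * 1 := by gcongr
        _ = _ := mul_one _
    · simp only [h3 s, inner_add_right, inner_smul_right]
      push_cast
      ring

lemma continuous_symb {d : ℝ} (hd : 0 ≤ d) : Continuous (symb d : Sp N → ℂ) := by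
  unfold symb
  have : Continuous fun ξ : Sp N => ‖ξ‖ ^ d := continuous_norm.rpow_const fun _ => Or.inr hd
  fun_prop

lemma integrable_pow_mul_symb (hN : 1 ≤ N) {d : ℝ} (hd : 1 < d) (n : ℕ) :
    Integrable (fun ξ : Sp N => ‖ξ‖ ^ n * ‖symb d ξ‖) := by
  have : Nonempty (Fin N) := ⟨⟨0, hN⟩⟩
  have : Nontrivial (Sp N) := inferInstance
  have := (integrable_fun_norm_addHaar (volume : Measure (Sp N))
    (f := fun r : ℝ => r ^ n * Real.exp (-r ^ d))).2 (by
      have h := integrableOn_rpow_mul_exp_neg_rpow (s := ((N - 1 + n : ℕ) : ℝ)) (p := d)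
        (lt_of_lt_of_le (by norm_num) (Nat.cast_nonneg _)) (by linarith)
      refine h.congr_fun (fun r hr => ?_) measurableSet_Ioi
      simp only [Real.rpow_natCast, smul_eq_mul, finrank_euclideanSpace, Fintype.card_fin]
      rw [pow_add]; ring)
  refine this.congr (Filter.Eventually.of_forall fun ξ => ?_)
  simp only [symb, Complex.norm_real, Real.norm_of_nonneg (Real.exp_pos _).le]

lemma integrable_symb (hN : 1 ≤ N) {d : ℝ} (hd : 1 < d) : Integrable (symb d : Sp N → ℂ) := by
  have := integrable_pow_mul_symb hN hd 0
  simp only [pow_zero, one_mul] at this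
  exact (integrable_norm_iff (continuous_symb (by linarith)).aestronglyMeasurable).1 this

lemma integrable_inner_mul_symb (hN : 1 ≤ N) {d : ℝ} (hd : 1 < d) (v : Sp N) :
    Integrable (fun ξ : Sp N => ((inner ℝ v ξ : ℝ) : ℂ) * symb d ξ) := by
  have h := (integrable_pow_mul_symb hN hd 1).const_mul ‖v‖
  refine h.mono' ?_ (Filter.Eventually.of_forall fun ξ => ?_)
  · have := continuous_symb (N := N) (d := d) (by linarith)
    exact (by fun_prop : Continuous _).aestronglyMeasurable
  · rw [norm_mul, Complex.norm_real, pow_one, ← mul_assoc]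
    gcongr
    exact norm_inner_le_norm v ξ

/-! ### The profile of the fundamental solution -/

open FourierTransform in
-- A change of normalisation, through which smoothness and the derivative of `fint` are inherited
-- from the Fourier transform.
lemma fint_eq_fourier (F : Sp N → ℂ) (x : Sp N) :
    fint F x = 𝓕 F ((-(2 * Real.pi)⁻¹) • x) := by
  rw [Real.fourier_eq', fint]
  congr 1; ext ξ
  rw [smul_eq_mul, inner_smul_right, real_inner_comm ξ x]
  congr 2
  have : (Real.pi : ℂ) ≠ 0 := by exact_mod_cast Real.pi_ne_zero
  push_cast
  field_simp

lemma contDiff_fint_symb (hN : 1 ≤ N) {d : ℝ} (hd : 1 < d) :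
    ContDiff ℝ ∞ (fint (symb d : Sp N → ℂ)) := by
  rw [funext (fint_eq_fourier (symb d : Sp N → ℂ))]
  exact (Real.contDiff_fourier fun n _ => integrable_pow_mul_symb hN hd n).comp (by fun_prop)

lemma fderiv_fint_symb (hN : 1 ≤ N) {d : ℝ} (hd : 1 < d) (x v : Sp N) :
    fderiv ℝ (fint (symb d : Sp N → ℂ)) x v =
      Complex.I * fint (fun ξ => ((inner ℝ v ξ : ℝ) : ℂ) * symb d ξ) x := by
  have hi := integrable_symb hN hd
  have hi1 : Integrable (fun ξ : Sp N => ‖ξ‖ * ‖symb d ξ‖) := by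
    simpa using integrable_pow_mul_symb hN hd 1
  have h1 := Real.hasFDerivAt_fourier hi hi1 ((-(2 * Real.pi)⁻¹) • x)
  have h2 : HasFDerivAt (fun x : Sp N => (-(2 * Real.pi)⁻¹) • x)
      ((-(2 * Real.pi)⁻¹) • ContinuousLinearMap.id ℝ (Sp N)) x :=
    ((-(2 * Real.pi)⁻¹) • ContinuousLinearMap.id ℝ (Sp N)).hasFDerivAt
  have h3 := h1.comp x h2
  rw [show fint (symb d : Sp N → ℂ) = _ from funext (fint_eq_fourier (symb d : Sp N → ℂ))]
  refine (congrArg (fun L : Sp N →L[ℝ] ℂ => L v) h3.fderiv).trans ?_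
  rw [fint, Real.fourier_eq', ContinuousLinearMap.comp_apply, ContinuousLinearMap.integral_apply]
  · rw [← integral_const_mul]
    congr 1; ext ξ
    have hpi : (Real.pi : ℂ) ≠ 0 := by exact_mod_cast Real.pi_ne_zero
    simp only [smul_apply, VectorFourier.fourierSMulRight_apply,
      innerSL_apply_apply ℝ, ContinuousLinearMap.id_apply, inner_smul_right, smul_eq_mul,
      Complex.real_smul]
    rw [real_inner_comm ξ x, real_inner_comm ξ v]
    have : Complex.exp (((-2 * Real.pi * (-(2 * Real.pi)⁻¹ * inner ℝ ξ x) : ℝ) : ℂ) * Complex.I) =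
        Complex.exp (Complex.I * ((inner ℝ ξ x : ℝ) : ℂ)) := by
      congr 1; push_cast; field_simp
    rw [this]
    push_cast
    field_simp
  · have : Integrable (VectorFourier.fourierSMulRight (innerSL ℝ) (symb d : Sp N → ℂ)) := by
      refine (hi1.const_mul (2 * Real.pi * ‖innerSL (E := Sp N) ℝ‖)).mono'
        (AEStronglyMeasurable.fourierSMulRight
          (continuous_symb (N := N) (d := d) (by linarith)).aestronglyMeasurable)
        (Filter.Eventually.of_forall fun ξ => ?_)
      refine (VectorFourier.norm_fourierSMulRight_le _ _ _).trans (le_of_eq ?_)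
      ring
    refine this.bdd_smul (𝕜 := ℂ) 1 ?_ ?_
    · exact (by fun_prop : Continuous _).aestronglyMeasurable
    · exact Filter.Eventually.of_forall fun ξ => by rw [Complex.norm_exp_ofReal_mul_I]

lemma heatKernel_one (d : ℝ) (x : Sp N) :
    heatKernel d x 1 = (2 * Real.pi) ^ (-(N : ℝ)) * (fint (symb d) x).re := by
  simp [heatKernel, fint, symb]

lemma contDiff_heatKernel_one (hN : 1 ≤ N) {d : ℝ} (hd : 1 < d) :
    ContDiff ℝ ∞ (fun x : Sp N => heatKernel d x 1) := by
  simp_rw [heatKernel_one]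
  exact contDiff_const.mul (Complex.reCLM.contDiff.comp (contDiff_fint_symb hN hd))

lemma fderiv_heatKernel_one (hN : 1 ≤ N) {d : ℝ} (hd : 1 < d) (x v : Sp N) :
    fderiv ℝ (fun x : Sp N => heatKernel d x 1) x v = (2 * Real.pi) ^ (-(N : ℝ)) *
      (Complex.I * fint (fun ξ => ((inner ℝ v ξ : ℝ) : ℂ) * symb d ξ) x).re := by
  have h1 : HasFDerivAt (fint (symb d : Sp N → ℂ)) (fderiv ℝ (fint (symb d)) x) x :=
    ((contDiff_fint_symb hN hd).differentiable (by simp)).differentiableAt.hasFDerivAt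
  have h2 := (Complex.reCLM.hasFDerivAt.comp x h1).const_mul ((2 * Real.pi) ^ (-(N : ℝ)))
  have h3 : (fun x : Sp N => heatKernel d x 1) = fun x => (2 * Real.pi) ^ (-(N : ℝ)) *
      (Complex.reCLM ∘ fint (symb d)) x := by
    ext x; simp [heatKernel_one]
  rw [h3, h2.fderiv]
  simp [← fderiv_fint_symb hN hd]

lemma exists_profile_bound (hN : 1 ≤ N) {d : ℝ} (hd : 1 < d) :
    ∃ C : ℝ, 0 < C ∧ ∀ x : Sp N, |heatKernel d x 1| ≤ C * majKer 1 x ∧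
      ‖fderiv ℝ (fun x : Sp N => heatKernel d x 1) x‖ ≤ C * majKer 1 x := by
  obtain ⟨κ, hκ, h0, h1⟩ := exists_lineHolo_symb N hd
  obtain ⟨C, hC, hC'⟩ := exists_norm_fint_le N hκ
  set c : ℝ := (2 * Real.pi) ^ (-(N : ℝ)) with hc
  have hc0 : 0 < c := by have := Real.pi_pos; positivity
  set I0 : ℝ := ∫ ξ : Sp N, ‖symb d ξ‖ with hI0
  set I1 : ℝ := ∫ ξ : Sp N, ‖ξ‖ * ‖symb d ξ‖ with hI1
  have hI00 : 0 ≤ I0 := integral_nonneg fun _ => norm_nonneg _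
  have hI10 : 0 ≤ I1 := integral_nonneg fun _ => by positivity
  have mono : ∀ {κ M M' : ℝ} {a : ℂ} {F : Sp N → ℂ}, M ≤ M' → LineHolo κ M a F →
      LineHolo κ M' a F := by
    intro κ M M' a F hM hF
    refine ⟨fun ξ => (hF.1 ξ).trans (by gcongr), fun ξ h hξ hh => ?_⟩
    obtain ⟨g, e1, e2, e3⟩ := hF.2 ξ h hξ hh
    exact ⟨g, e1, fun z hz => (e2 z hz).trans (by gcongr), e3⟩
  -- In `exists_norm_fint_le` the number M must dominate both the conical constant (4, or 2|v|) and
  -- the L¹ norm (I0, or at most I1|v|).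
  refine ⟨c * C * (4 + I0 + I1), by positivity, fun x => ⟨?_, ?_⟩⟩
  · have hk := majKer_pos one_pos x
    have h2 := hC' (4 + I0) (by positivity) 1 (symb d) (mono (by linarith) h0)
      (integrable_symb hN hd) (by linarith) x
    rw [heatKernel_one, abs_mul, abs_of_pos hc0]
    calc c * |(fint (symb d) x).re| ≤ c * (C * (4 + I0) * majKer 1 x) := by
          gcongr
          exact (Complex.abs_re_le_norm _).trans h2
      _ ≤ c * (C * (4 + I0 + I1) * majKer 1 x) := by
          have : C * (4 + I0) ≤ C * (4 + I0 + I1) := by nlinarith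
          gcongr
      _ = _ := by ring
  · have hk := majKer_pos one_pos x
    refine ContinuousLinearMap.opNorm_le_bound _ (by positivity) fun v => ?_
    rw [fderiv_heatKernel_one hN hd, norm_mul, Real.norm_of_nonneg hc0.le]
    have h2 := hC' ((2 + I1) * ‖v‖) (by positivity) 0 _ (mono (by nlinarith [norm_nonneg v]) (h1 v))
      (integrable_inner_mul_symb hN hd v) (by
        calc ∫ ξ, ‖((inner ℝ v ξ : ℝ) : ℂ) * symb d ξ‖ ≤ ∫ ξ, ‖v‖ * (‖ξ‖ * ‖symb d ξ‖) := by
              refine integral_mono (integrable_inner_mul_symb hN hd v).norm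
                (by simpa using (integrable_pow_mul_symb hN hd 1).const_mul ‖v‖) fun ξ => ?_
              simp only [norm_mul, Complex.norm_real]
              rw [← mul_assoc]
              gcongr
              exact norm_inner_le_norm v ξ
          _ = I1 * ‖v‖ := by rw [integral_const_mul, hI1, mul_comm]
          _ ≤ _ := by gcongr; linarith) x
    calc c * ‖(Complex.I * fint (fun ξ => ((inner ℝ v ξ : ℝ) : ℂ) * symb d ξ) x).re‖
        ≤ c * (C * ((2 + I1) * ‖v‖) * majKer 1 x) := by
          gcongr
          refine (Complex.abs_re_le_norm _).trans ?_
          simpa using h2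
      _ ≤ c * (C * ((4 + I0 + I1) * ‖v‖) * majKer 1 x) := by gcongr; linarith
      _ = _ := by ring

/-! ### The fundamental solution at time `t` -/

/-- Self-similarity, by the substitution ξ ↦ t^(1/d) ξ; it reduces the estimates and the regularity
to t = 1. -/
lemma heatKernel_scale {d : ℝ} (hd : 1 < d) {t : ℝ} (ht : 0 < t) (x : Sp N) :
    heatKernel d x t = ((t ^ (1 / d)) ^ N)⁻¹ * heatKernel d ((t ^ (1 / d))⁻¹ • x) 1 := by
  set τ : ℝ := t ^ (1 / d) with hτ
  have hτ0 : 0 < τ := by positivity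
  have hτd : τ ^ d = t := by
    rw [hτ, ← Real.rpow_mul ht.le, one_div_mul_cancel (by linarith), Real.rpow_one]
  rw [heatKernel_one, heatKernel, fint]
  have h := Measure.integral_comp_smul (volume : Measure (Sp N))
    (fun ξ => Complex.exp (Complex.I * ((inner ℝ (τ⁻¹ • x) ξ : ℝ) : ℂ)) * symb d ξ) τ
  have h2 : ∀ ξ : Sp N, Complex.exp (Complex.I * ((inner ℝ (τ⁻¹ • x) (τ • ξ) : ℝ) : ℂ)) *
      symb d (τ • ξ) = Complex.exp (Complex.I * ((inner ℝ x ξ : ℝ) : ℂ)) *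
      ((Real.exp (-t * ‖ξ‖ ^ d) : ℝ) : ℂ) := by
    intro ξ
    rw [inner_smul_left, inner_smul_right, symb, norm_smul, Real.norm_of_nonneg hτ0.le,
      Real.mul_rpow hτ0.le (norm_nonneg _), hτd]
    simp only [conj_trivial]
    rw [inv_mul_cancel_left₀ hτ0.ne', neg_mul]
  simp_rw [h2] at h
  rw [h, Complex.smul_re, abs_of_pos (by positivity)]
  simp only [finrank_euclideanSpace, Fintype.card_fin, smul_eq_mul]
  ring

/-- The `x`-derivative of the fundamental solution. -/
def heatDer (d : ℝ) (x : Sp N) (t : ℝ) : Sp N →L[ℝ] ℝ := fderiv ℝ (fun y => heatKernel d y t) x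

lemma contDiff_heatKernel (hN : 1 ≤ N) {d : ℝ} (hd : 1 < d) {t : ℝ} (ht : 0 < t) :
    ContDiff ℝ ∞ (fun x : Sp N => heatKernel d x t) := by
  simp_rw [heatKernel_scale hd ht]
  exact contDiff_const.mul ((contDiff_heatKernel_one hN hd).comp (by fun_prop))

lemma hasFDerivAt_heatKernel (hN : 1 ≤ N) {d : ℝ} (hd : 1 < d) {t : ℝ} (ht : 0 < t) (x : Sp N) :
    HasFDerivAt (fun y : Sp N => heatKernel d y t) (heatDer d x t) x :=
  ((contDiff_heatKernel hN hd ht).differentiable (by simp)).differentiableAt.hasFDerivAt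

lemma heatDer_scale (hN : 1 ≤ N) {d : ℝ} (hd : 1 < d) {t : ℝ} (ht : 0 < t) (x : Sp N) :
    heatDer d x t = (((t ^ (1 / d)) ^ N)⁻¹ * (t ^ (1 / d))⁻¹) •
      heatDer d ((t ^ (1 / d))⁻¹ • x) 1 := by
  have h1 := hasFDerivAt_heatKernel hN hd one_pos ((t ^ (1 / d))⁻¹ • x)
  have h2 : HasFDerivAt (fun y : Sp N => (t ^ (1 / d))⁻¹ • y)
      ((t ^ (1 / d))⁻¹ • ContinuousLinearMap.id ℝ (Sp N)) x :=
    ((t ^ (1 / d))⁻¹ • ContinuousLinearMap.id ℝ (Sp N)).hasFDerivAt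
  have h3 := (h1.comp x h2).const_mul (((t ^ (1 / d)) ^ N)⁻¹)
  have h4 : (fun y : Sp N => heatKernel d y t) = fun y => ((t ^ (1 / d)) ^ N)⁻¹ *
      ((fun y : Sp N => heatKernel d y 1) ∘ fun y => (t ^ (1 / d))⁻¹ • y) y :=
    funext fun y => heatKernel_scale hd ht y
  rw [heatDer, h4, h3.fderiv]
  ext v
  simp
  ring

lemma exists_heatKernel_bound (hN : 1 ≤ N) {d : ℝ} (hd : 1 < d) :
    ∃ C : ℝ, 0 < C ∧ ∀ (x : Sp N) (t : ℝ), 0 < t →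
      |heatKernel d x t| ≤ C * majKer (t ^ (1 / d)) x ∧
      ‖heatDer d x t‖ ≤ C * ((t ^ (1 / d))⁻¹ * majKer (t ^ (1 / d)) x) := by
  obtain ⟨C, hC, h⟩ := exists_profile_bound hN hd
  refine ⟨C, hC, fun x t ht => ?_⟩
  have hτ : 0 < t ^ (1 / d) := by positivity
  obtain ⟨h1, h2⟩ := h ((t ^ (1 / d))⁻¹ • x)
  constructor
  · rw [heatKernel_scale hd ht, majKer_scale hτ, abs_mul, abs_of_pos (by positivity)]
    calc _ ≤ ((t ^ (1 / d)) ^ N)⁻¹ * (C * majKer 1 ((t ^ (1 / d))⁻¹ • x)) := by gcongr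
      _ = _ := by ring
  · rw [heatDer_scale hN hd ht, majKer_scale hτ, norm_smul, Real.norm_of_nonneg (by positivity)]
    calc _ ≤ ((t ^ (1 / d)) ^ N)⁻¹ * (t ^ (1 / d))⁻¹ *
          (C * majKer 1 ((t ^ (1 / d))⁻¹ • x)) := by gcongr; exact h2
      _ = _ := by ring

lemma continuousOn_rpow_inv_smul {d : ℝ} :
    ContinuousOn (fun z : Sp N × ℝ => (z.2 ^ (1 / d))⁻¹ • z.1) {z | 0 < z.2} := by
  have h : ContinuousOn (fun z : Sp N × ℝ => z.2 ^ (1 / d)) {z | 0 < z.2} :=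
    continuousOn_snd.rpow_const fun _ hz => Or.inl (ne_of_gt hz)
  refine (h.inv₀ fun z hz => ?_).smul continuousOn_fst
  have : 0 < z.2 := hz
  positivity

lemma continuousOn_rpow_snd {d : ℝ} :
    ContinuousOn (fun z : Sp N × ℝ => z.2 ^ (1 / d)) {z | 0 < z.2} :=
  continuousOn_snd.rpow_const fun _ hz => Or.inl (ne_of_gt hz)

lemma continuousOn_heatKernel (hN : 1 ≤ N) {d : ℝ} (hd : 1 < d) :
    ContinuousOn (fun z : Sp N × ℝ => heatKernel d z.1 z.2) {z | 0 < z.2} := by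
  have h1 : ContinuousOn (fun z : Sp N × ℝ => ((z.2 ^ (1 / d)) ^ N)⁻¹ *
      heatKernel d ((z.2 ^ (1 / d))⁻¹ • z.1) 1) {z | 0 < z.2} := by
    refine ContinuousOn.mul ((continuousOn_rpow_snd.pow N).inv₀ fun z hz => ?_) ?_
    · exact pow_ne_zero _ (Real.rpow_pos_of_pos hz _).ne'
    · exact (contDiff_heatKernel_one hN hd).continuous.comp_continuousOn continuousOn_rpow_inv_smul
  exact h1.congr fun z hz => heatKernel_scale hd hz z.1

lemma continuousOn_heatDer (hN : 1 ≤ N) {d : ℝ} (hd : 1 < d) :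
    ContinuousOn (fun z : Sp N × ℝ => heatDer d z.1 z.2) {z | 0 < z.2} := by
  have h1 : ContinuousOn (fun z : Sp N × ℝ => (((z.2 ^ (1 / d)) ^ N)⁻¹ * (z.2 ^ (1 / d))⁻¹) •
      heatDer d ((z.2 ^ (1 / d))⁻¹ • z.1) 1) {z | 0 < z.2} := by
    refine ContinuousOn.smul (ContinuousOn.mul
      ((continuousOn_rpow_snd.pow N).inv₀ fun z hz => ?_)
      (continuousOn_rpow_snd.inv₀ fun z hz => ?_)) ?_
    · exact pow_ne_zero _ (Real.rpow_pos_of_pos hz _).ne'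
    · exact (Real.rpow_pos_of_pos hz _).ne'
    · exact ((contDiff_heatKernel_one hN hd).continuous_fderiv (by simp)).comp_continuousOn
        continuousOn_rpow_inv_smul
  exact h1.congr fun z hz => heatDer_scale hN hd hz z.1

/-! ### Integral operators with a dominated kernel -/

/-- The majorant `t^{-κ} majKer(t^{1/d}, x)` with a time singularity. -/
def wker (d κ t : ℝ) (x : Sp N) : ℝ := t ^ (-κ) * majKer (t ^ (1 / d)) x

lemma wker_pos {d κ t : ℝ} (ht : 0 < t) (x : Sp N) : 0 < wker d κ t x :=
  mul_pos (Real.rpow_pos_of_pos ht _) (majKer_pos (Real.rpow_pos_of_pos ht _) x)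

/-- A Harnack-type comparison between nearby space-time points. It makes the majorant at one point
dominate the kernel in a whole neighbourhood, as dominated convergence requires. -/
lemma wker_le {d κ : ℝ} (hd : 1 < d) (hκ0 : 0 ≤ κ) (hκ1 : κ < 1) {r r₀ : ℝ} (hr₀ : 0 < r₀)
    (h1 : r₀ ≤ 2 * r) (h2 : r ≤ 2 * r₀) {x x₀ : Sp N} (hx : ‖x - x₀‖ ≤ r₀ ^ (1 / d) / 2) :
    wker d κ r x ≤ 4 * 3 ^ (N + 1) * wker d κ r₀ x₀ := by
  have hr : 0 < r := by linarith
  have h1d : 1 / d ≤ 1 := by rw [div_le_one (by linarith)]; exact hd.le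
  have h1d0 : 0 < 1 / d := by positivity
  have h2d : (2 : ℝ) ^ (1 / d) ≤ 2 := by
    calc (2 : ℝ) ^ (1 / d) ≤ 2 ^ (1 : ℝ) := Real.rpow_le_rpow_of_exponent_le (by norm_num) h1d
      _ = 2 := Real.rpow_one 2
  have h2κ : (2 : ℝ) ^ κ ≤ 2 := by
    calc (2 : ℝ) ^ κ ≤ 2 ^ (1 : ℝ) := Real.rpow_le_rpow_of_exponent_le (by norm_num) hκ1.le
      _ = 2 := Real.rpow_one 2
  have e1 : r ^ (1 / d) ≤ 2 * r₀ ^ (1 / d) := by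
    calc r ^ (1 / d) ≤ (2 * r₀) ^ (1 / d) := by gcongr
      _ = 2 ^ (1 / d) * r₀ ^ (1 / d) := Real.mul_rpow (by norm_num) hr₀.le
      _ ≤ _ := by gcongr
  have e2 : r₀ ^ (1 / d) ≤ 2 * r ^ (1 / d) := by
    calc r₀ ^ (1 / d) ≤ (2 * r) ^ (1 / d) := by gcongr
      _ = 2 ^ (1 / d) * r ^ (1 / d) := Real.mul_rpow (by norm_num) hr.le
      _ ≤ _ := by gcongr
  have e3 : r ^ (-κ) ≤ 2 * r₀ ^ (-κ) := by
    rw [Real.rpow_neg hr.le, Real.rpow_neg hr₀.le, ← div_eq_mul_inv,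
      inv_le_comm₀ (by positivity) (by positivity), inv_div]
    have : r₀ ^ κ ≤ 2 * r ^ κ := by
      calc r₀ ^ κ ≤ (2 * r) ^ κ := by gcongr
        _ = 2 ^ κ * r ^ κ := Real.mul_rpow (by norm_num) hr.le
        _ ≤ _ := by gcongr
    linarith
  have hτ : 0 < r ^ (1 / d) := by positivity
  have hτ₀ : 0 < r₀ ^ (1 / d) := by positivity
  have e4 := majKer_le (x := x) (x' := x₀) (A := 3) hτ hτ₀ e1 (by
    have : ‖x₀‖ ≤ ‖x‖ + ‖x - x₀‖ := by
      rw [norm_sub_rev]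
      calc ‖x₀‖ = ‖x + (x₀ - x)‖ := by congr 1; abel
        _ ≤ _ := norm_add_le _ _
    have := norm_nonneg x
    linarith)
  have := majKer_pos hτ₀ x₀
  have := majKer_pos hτ x
  unfold wker
  calc r ^ (-κ) * majKer (r ^ (1 / d)) x
      ≤ (2 * r₀ ^ (-κ)) * (2 * 3 ^ (N + 1) * majKer (r₀ ^ (1 / d)) x₀) := by gcongr
    _ = _ := by ring

/-- `H` is continuous for positive times and dominated by `C * wker d κ`. -/
structure KerBound {E : Type*} [NormedAddCommGroup E] [NormedSpace ℝ E] (d κ C : ℝ)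
    (H : Sp N → ℝ → E) : Prop where
  cont : ContinuousOn (fun z : Sp N × ℝ => H z.1 z.2) {z | 0 < z.2}
  bound : ∀ (x : Sp N) (t : ℝ), 0 < t → ‖H x t‖ ≤ C * wker d κ t x

lemma exists_kerBound_heatKernel (hN : 1 ≤ N) {d : ℝ} (hd : 1 < d) :
    ∃ C : ℝ, 0 < C ∧ KerBound d 0 C (heatKernel d : Sp N → ℝ → ℝ) ∧
      KerBound d (1 / d) C (heatDer d : Sp N → ℝ → (Sp N →L[ℝ] ℝ)) := by
  obtain ⟨C, hC, h⟩ := exists_heatKernel_bound hN hd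
  refine ⟨C, hC, ⟨continuousOn_heatKernel hN hd, fun x t ht => ?_⟩,
    ⟨continuousOn_heatDer hN hd, fun x t ht => ?_⟩⟩
  · simpa [wker] using (h x t ht).1
  · have := (h x t ht).2
    rwa [← Real.rpow_neg ht.le] at this

section Operators

variable {E : Type*} [NormedAddCommGroup E] [NormedSpace ℝ E] {d κ C : ℝ} {H : Sp N → ℝ → E}

/-- The kernel is controlled only for positive times; extended by zero it is measurable on all of
space-time. -/
lemma KerBound.exists_stronglyMeasurable (hH : KerBound d κ C H) :
    ∃ H' : Sp N × ℝ → E, StronglyMeasurable H' ∧ ∀ z, 0 < z.2 → H' z = H z.1 z.2 := by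
  have hopen : IsOpen {z : Sp N × ℝ | 0 < z.2} := isOpen_lt continuous_const continuous_snd
  refine ⟨{z : Sp N × ℝ | 0 < z.2}.indicator fun z => H z.1 z.2, ?_, fun z hz =>
    indicator_of_mem (s := {z : Sp N × ℝ | 0 < z.2}) hz _⟩
  refine stronglyMeasurable_of_restrict_of_restrict_compl hopen.measurableSet ?_ ?_
  · have : ({z : Sp N × ℝ | 0 < z.2}.domRestrict
        ({z : Sp N × ℝ | 0 < z.2}.indicator fun z => H z.1 z.2)) =
        {z : Sp N × ℝ | 0 < z.2}.domRestrict fun z => H z.1 z.2 := by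
      ext ⟨z, hz⟩
      exact indicator_of_mem (s := {z : Sp N × ℝ | 0 < z.2}) hz _
    rw [this]
    exact (continuousOn_iff_continuous_domRestrict.1 hH.cont).stronglyMeasurable
  · have : ({z : Sp N × ℝ | 0 < z.2}ᶜ.domRestrict
        ({z : Sp N × ℝ | 0 < z.2}.indicator fun z => H z.1 z.2)) = fun _ => 0 := by
      ext ⟨z, hz⟩
      exact indicator_of_notMem (s := {z : Sp N × ℝ | 0 < z.2}) hz _
    rw [this]
    exact stronglyMeasurable_const

variable {α : Type*} [MeasurableSpace α] {μ : Measure α} {Y : α → Sp N} {S : α → ℝ} {F : α → ℝ}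

lemma KerBound.aestronglyMeasurable (hH : KerBound d κ C H) (hY : Measurable Y)
    (hS : Measurable S) {t : ℝ} (hSt : ∀ᵐ a ∂μ, S a < t) (x : Sp N) :
    AEStronglyMeasurable (fun a => H (x - Y a) (t - S a)) μ := by
  obtain ⟨H', hm, he⟩ := hH.exists_stronglyMeasurable
  refine ⟨fun a => H' (x - Y a, t - S a), hm.comp_measurable (by fun_prop), ?_⟩
  filter_upwards [hSt] with a ha
  exact (he (x - Y a, t - S a) (by simpa using ha)).symm

/-- The weight against which the data are integrated. -/
def wInt (d κ : ℝ) (μ : Measure α) (Y : α → Sp N) (S : α → ℝ) (F : α → ℝ) (x : Sp N) (t : ℝ) :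
    ℝ≥0∞ := ∫⁻ a, ENNReal.ofReal (wker d κ (t - S a) (x - Y a)) * ‖F a‖ₑ ∂μ

lemma measurable_wker : Measurable (fun z : Sp N × ℝ => wker d κ z.2 z.1) := by
  have : (fun z : Sp N × ℝ => wker d κ z.2 z.1) = fun z => z.2 ^ (-κ) *
    (fun z : Sp N × ℝ => majKer z.2 z.1) (z.1, z.2 ^ (1 / d)) := rfl
  rw [this]
  exact Measurable.mul (by fun_prop) (measurable_majKer.comp (by fun_prop))

lemma integrable_wker (hY : Measurable Y) (hS : Measurable S)
    (hF : AEStronglyMeasurable F μ) {t : ℝ} (hSt : ∀ᵐ a ∂μ, S a < t) (x : Sp N)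
    (h : wInt d κ μ Y S F x t ≠ ⊤) :
    Integrable (fun a => wker d κ (t - S a) (x - Y a) * ‖F a‖) μ := by
  refine ⟨?_, ?_⟩
  · refine AEStronglyMeasurable.mul ?_ hF.norm
    exact ((measurable_wker (N := N) (d := d) (κ := κ)).comp
      (by fun_prop : Measurable fun a => (x - Y a, t - S a))).aestronglyMeasurable
  · rw [hasFiniteIntegral_iff_enorm]
    refine lt_of_le_of_lt (le_of_eq ?_) (lt_top_iff_ne_top.2 h)
    refine lintegral_congr_ae ?_
    filter_upwards [hSt] with a ha
    rw [enorm_mul, enorm_norm, Real.enorm_of_nonneg (wker_pos (by linarith) _).le]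

lemma KerBound.integrable (hH : KerBound d κ C H) (hY : Measurable Y) (hS : Measurable S)
    (hF : AEStronglyMeasurable F μ) {t : ℝ} (hSt : ∀ᵐ a ∂μ, S a < t) (x : Sp N)
    (h : wInt d κ μ Y S F x t ≠ ⊤) :
    Integrable (fun a => F a • H (x - Y a) (t - S a)) μ := by
  refine ((integrable_wker hY hS hF hSt x h).const_mul C).mono'
    (hF.smul (hH.aestronglyMeasurable hY hS hSt x)) ?_
  filter_upwards [hSt] with a ha
  rw [norm_smul]
  calc ‖F a‖ * ‖H (x - Y a) (t - S a)‖ ≤ ‖F a‖ * (C * wker d κ (t - S a) (x - Y a)) := by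
        gcongr; exact hH.bound _ _ (by linarith)
    _ = _ := by ring

lemma KerBound.enorm_integral_le (hH : KerBound d κ C H) {t : ℝ} (hSt : ∀ᵐ a ∂μ, S a < t)
    (x : Sp N) : ‖∫ a, F a • H (x - Y a) (t - S a) ∂μ‖ₑ ≤
      ENNReal.ofReal C * wInt d κ μ Y S F x t := by
  refine (enorm_integral_le_lintegral_enorm _).trans ?_
  rw [wInt, ← lintegral_const_mul' _ _ ENNReal.ofReal_ne_top]
  refine lintegral_mono_ae ?_
  filter_upwards [hSt] with a ha
  have hw := wker_pos (d := d) (κ := κ) (sub_pos.2 ha) (x - Y a)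
  have hb := hH.bound (x - Y a) (t - S a) (by linarith)
  rw [enorm_smul, ← mul_assoc, mul_comm, ← ENNReal.ofReal_mul' hw.le]
  gcongr
  rw [← ofReal_norm]
  exact ENNReal.ofReal_le_ofReal hb

/-- The sources stay at time distance ε from t₀, away from the singularity of the kernel, so near
(x₀, t₀) the integrand is dominated by a multiple of the majorant at (x₀, t₀). -/
lemma KerBound.continuousAt_integral (hH : KerBound d κ C H) (hC : 0 ≤ C) (hd : 1 < d)
    (hκ0 : 0 ≤ κ) (hκ1 : κ < 1) (hY : Measurable Y) (hS : Measurable S)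
    (hF : AEStronglyMeasurable F μ) {t₀ ε : ℝ} (hε : 0 < ε) (hSt : ∀ᵐ a ∂μ, S a + ε ≤ t₀)
    (x₀ : Sp N) (h : wInt d κ μ Y S F x₀ t₀ ≠ ⊤) :
    ContinuousAt (fun z : Sp N × ℝ => ∫ a, F a • H (z.1 - Y a) (z.2 - S a) ∂μ) (x₀, t₀) := by
  have hSt0 : ∀ᵐ a ∂μ, S a < t₀ := hSt.mono fun a ha => by linarith
  have hεd : 0 < ε ^ (1 / d) / 2 := by positivity
  have ev1 : ∀ᶠ z : Sp N × ℝ in nhds (x₀, t₀), ‖z.1 - x₀‖ ≤ ε ^ (1 / d) / 2 := by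
    have : Filter.Tendsto (fun z : Sp N × ℝ => ‖z.1 - x₀‖) (nhds (x₀, t₀)) (nhds 0) := by
      have : ContinuousAt (fun z : Sp N × ℝ => ‖z.1 - x₀‖) (x₀, t₀) := by fun_prop
      simpa [ContinuousAt] using this
    filter_upwards [this (Iio_mem_nhds hεd)] with z hz using le_of_lt hz
  have ev2 : ∀ᶠ z : Sp N × ℝ in nhds (x₀, t₀), |z.2 - t₀| < ε / 2 := by
    have : Filter.Tendsto (fun z : Sp N × ℝ => |z.2 - t₀|) (nhds (x₀, t₀)) (nhds 0) := by
      have : ContinuousAt (fun z : Sp N × ℝ => |z.2 - t₀|) (x₀, t₀) := by fun_prop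
      simpa [ContinuousAt] using this
    filter_upwards [this (Iio_mem_nhds (half_pos hε))] with z hz using hz
  refine continuousAt_of_dominated (bound := fun a => C * (4 * 3 ^ (N + 1)) *
    (wker d κ (t₀ - S a) (x₀ - Y a) * ‖F a‖)) ?_ ?_
    ((integrable_wker hY hS hF hSt0 x₀ h).const_mul _) ?_
  · filter_upwards [ev2] with z hz
    refine hF.smul (hH.aestronglyMeasurable hY hS ?_ z.1)
    filter_upwards [hSt] with a ha
    have := (abs_lt.1 hz).1
    linarith
  · filter_upwards [ev1, ev2] with z hz1 hz2
    filter_upwards [hSt] with a ha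
    obtain ⟨q1, q2⟩ := abs_lt.1 hz2
    rw [norm_smul]
    have b1 := hH.bound (z.1 - Y a) (z.2 - S a) (by linarith)
    have b2 := wker_le (κ := κ) hd hκ0 hκ1 (r := z.2 - S a) (r₀ := t₀ - S a) (by linarith)
      (by linarith) (by linarith) (x := z.1 - Y a) (x₀ := x₀ - Y a) (by
        rw [sub_sub_sub_cancel_right]
        refine hz1.trans ?_
        have : ε ^ (1 / d) ≤ (t₀ - S a) ^ (1 / d) := by
          gcongr; linarith
        linarith)
    calc ‖F a‖ * ‖H (z.1 - Y a) (z.2 - S a)‖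
        ≤ ‖F a‖ * (C * (4 * 3 ^ (N + 1) * wker d κ (t₀ - S a) (x₀ - Y a))) := by
          gcongr; exact b1.trans (by gcongr)
      _ = _ := by ring
  · filter_upwards [hSt0] with a ha
    refine continuousAt_const.smul ?_
    have h1 : ContinuousAt (fun z : Sp N × ℝ => H z.1 z.2) (x₀ - Y a, t₀ - S a) := by
      refine hH.cont.continuousAt (IsOpen.mem_nhds
        (isOpen_lt continuous_const continuous_snd) ?_)
      simpa using ha
    exact ContinuousAt.comp (f := fun z : Sp N × ℝ => (z.1 - Y a, z.2 - S a)) (x := (x₀, t₀))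
      h1 (by fun_prop)

lemma hasFDerivAt_integral_kernel {κ₀ C₀ : ℝ} {H₀ : Sp N → ℝ → ℝ}
    {H₁ : Sp N → ℝ → (Sp N →L[ℝ] ℝ)} (hH₀ : KerBound d κ₀ C₀ H₀) (hH₁ : KerBound d κ C H₁)
    (hder : ∀ (x : Sp N) (t : ℝ), 0 < t → HasFDerivAt (fun y => H₀ y t) (H₁ x t) x)
    (hC : 0 ≤ C) (hd : 1 < d)
    (hκ0 : 0 ≤ κ) (hκ1 : κ < 1) (hY : Measurable Y) (hS : Measurable S)
    (hF : AEStronglyMeasurable F μ) {t₀ ε : ℝ} (hε : 0 < ε) (hSt : ∀ᵐ a ∂μ, S a + ε ≤ t₀)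
    (x₀ : Sp N) (h₀ : wInt d κ₀ μ Y S F x₀ t₀ ≠ ⊤) (h : wInt d κ μ Y S F x₀ t₀ ≠ ⊤) :
    HasFDerivAt (fun x : Sp N => ∫ a, F a * H₀ (x - Y a) (t₀ - S a) ∂μ)
      (∫ a, F a • H₁ (x₀ - Y a) (t₀ - S a) ∂μ) x₀ := by
  have hSt0 : ∀ᵐ a ∂μ, S a < t₀ := hSt.mono fun a ha => by linarith
  have hεd : 0 < ε ^ (1 / d) / 2 := by positivity
  refine hasFDerivAt_integral_of_dominated_of_fderiv_le (s := ball x₀ (ε ^ (1 / d) / 2))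
    (bound := fun a => C * (4 * 3 ^ (N + 1)) *
      (wker d κ (t₀ - S a) (x₀ - Y a) * ‖F a‖)) (F' := fun x a => F a • H₁ (x - Y a) (t₀ - S a))
    (ball_mem_nhds _ hεd)
    (Filter.Eventually.of_forall fun x => hF.mul (hH₀.aestronglyMeasurable hY hS hSt0 x))
    (hH₀.integrable hY hS hF hSt0 x₀ h₀)
    (hF.smul (hH₁.aestronglyMeasurable hY hS hSt0 x₀)) ?_
    ((integrable_wker hY hS hF hSt0 x₀ h).const_mul _) ?_
  · filter_upwards [hSt] with a ha x hx
    rw [norm_smul]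
    have b1 := hH₁.bound (x - Y a) (t₀ - S a) (by linarith)
    have b2 := wker_le (κ := κ) hd hκ0 hκ1 (r := t₀ - S a) (r₀ := t₀ - S a) (by linarith)
      (by linarith) (by linarith) (x := x - Y a) (x₀ := x₀ - Y a) (by
        rw [sub_sub_sub_cancel_right]
        have hx' : ‖x - x₀‖ < ε ^ (1 / d) / 2 := by simpa [dist_eq_norm] using hx
        refine hx'.le.trans ?_
        have : ε ^ (1 / d) ≤ (t₀ - S a) ^ (1 / d) := by
          gcongr; linarith
        linarith)
    calc ‖F a‖ * ‖H₁ (x - Y a) (t₀ - S a)‖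
        ≤ ‖F a‖ * (C * (4 * 3 ^ (N + 1) * wker d κ (t₀ - S a) (x₀ - Y a))) := by
          gcongr; exact b1.trans (by gcongr)
      _ = _ := by ring
  · filter_upwards [hSt0] with a ha x _
    have := hder (x - Y a) (t₀ - S a) (by linarith)
    have h2 := this.comp x ((hasFDerivAt_id x).sub_const (Y a))
    exact h2.const_mul (F a)

end Operators

/-! ### Power integrals in time -/

lemma lintegral_rpow_Ioo {κ b : ℝ} (hκ : κ < 1) (hb : 0 ≤ b) :
    ∫⁻ s in Ioo 0 b, ENNReal.ofReal (s ^ (-κ)) = ENNReal.ofReal (b ^ (1 - κ) / (1 - κ)) := by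
  have hi : IntegrableOn (fun s : ℝ => s ^ (-κ)) (Ioo 0 b) := by
    have := intervalIntegral.intervalIntegrable_rpow' (a := 0) (b := b) (r := -κ) (by linarith)
    rw [intervalIntegrable_iff_integrableOn_Ioo_of_le hb] at this
    exact this
  rw [← ofReal_integral_eq_lintegral_ofReal hi]
  · congr 1
    rw [← integral_Ioc_eq_integral_Ioo, ← intervalIntegral.integral_of_le hb,
      integral_rpow (Or.inl (by linarith)), Real.zero_rpow (by linarith), sub_zero]
    rw [show -κ + 1 = 1 - κ by ring]
  · filter_upwards [ae_restrict_mem measurableSet_Ioo] with s hs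
    exact Real.rpow_nonneg hs.1.le _

lemma lintegral_sub_rpow_Ioo {κ a t : ℝ} (hκ : κ < 1) (hat : a ≤ t) :
    ∫⁻ s in Ioo a t, ENNReal.ofReal ((t - s) ^ (-κ)) =
      ENNReal.ofReal ((t - a) ^ (1 - κ) / (1 - κ)) := by
  rw [← lintegral_rpow_Ioo hκ (sub_nonneg.2 hat), ← lintegral_indicator measurableSet_Ioo,
    ← lintegral_indicator measurableSet_Ioo,
    ← lintegral_sub_left_eq_self (μ := volume) _ t]
  congr 1; ext s
  by_cases hs : s ∈ Ioo 0 (t - a)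
  · rw [indicator_of_mem hs, indicator_of_mem (by constructor <;> linarith [hs.1, hs.2])]
    congr 2; ring
  · rw [indicator_of_notMem hs, indicator_of_notMem]
    exact fun h => hs ⟨by linarith [h.2], by linarith [h.1]⟩

/-! ### The Duhamel operator -/

/-- The space-time domain `ℝ^N × (0,T)`. -/
def dom (N : ℕ) (T : ℝ≥0∞) : Set (Sp N × ℝ) := {z | 0 < z.2 ∧ ENNReal.ofReal z.2 < T}

lemma isOpen_dom (N : ℕ) (T : ℝ≥0∞) : IsOpen (dom N T) :=
  (isOpen_lt continuous_const continuous_snd).inter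
    (isOpen_lt (ENNReal.continuous_ofReal.comp continuous_snd) continuous_const)

lemma prod_Ioo_subset_dom {T : ℝ≥0∞} {t a : ℝ} (ht : ENNReal.ofReal t < T) (ha : 0 ≤ a) :
    (univ : Set (Sp N)) ×ˢ Ioo a t ⊆ dom N T := fun _ hz =>
  ⟨ha.trans_lt hz.2.1, (ENNReal.ofReal_le_ofReal hz.2.2.le).trans_lt ht⟩

/-- The weighted integral of `F` over `ℝ^N × (0,t)`. -/
def duhW (d κ : ℝ) (F : Sp N × ℝ → ℝ) (x : Sp N) (t : ℝ) : ℝ≥0∞ :=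
  wInt d κ (volume.restrict ((univ : Set (Sp N)) ×ˢ Ioo 0 t)) Prod.fst Prod.snd F x t

/-- The Duhamel integral with kernel `H`. -/
def duh {E : Type*} [NormedAddCommGroup E] [NormedSpace ℝ E] (H : Sp N → ℝ → E)
    (F : Sp N × ℝ → ℝ) (x : Sp N) (t : ℝ) : E :=
  ∫ z in (univ : Set (Sp N)) ×ˢ Ioo 0 t, F z • H (x - z.1) (t - z.2)

lemma restrict_univ_prod (s : Set ℝ) :
    (volume : Measure (Sp N × ℝ)).restrict (univ ×ˢ s) =
      (volume : Measure (Sp N)).prod (volume.restrict s) := by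
  rw [Measure.volume_eq_prod, ← Measure.prod_restrict, Measure.restrict_univ]

lemma wInt_prod_eq {d κ : ℝ} {F : Sp N × ℝ → ℝ} {s : Set ℝ}
    (hF : AEStronglyMeasurable F (volume.restrict ((univ : Set (Sp N)) ×ˢ s)))
    (x : Sp N) (t : ℝ) :
    wInt d κ (volume.restrict ((univ : Set (Sp N)) ×ˢ s)) Prod.fst Prod.snd F x t =
      ∫⁻ r in s, ∫⁻ y, ENNReal.ofReal (wker d κ (t - r) (x - y)) * ‖F (y, r)‖ₑ := by
  rw [restrict_univ_prod] at hF ⊢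
  rw [wInt, lintegral_prod_symm]
  refine AEMeasurable.mul (Measurable.aemeasurable ?_) hF.enorm
  exact ((measurable_wker (N := N) (d := d) (κ := κ)).comp
    (by fun_prop : Measurable fun z : Sp N × ℝ => (x - z.1, t - z.2))).ennreal_ofReal

lemma lintegral_wker {d κ r : ℝ} (hr : 0 < r) (x : Sp N) :
    ∫⁻ y, ENNReal.ofReal (wker d κ r (x - y)) =
      ENNReal.ofReal (r ^ (-κ)) * ENNReal.ofReal (majMass N) := by
  unfold wker
  simp_rw [ENNReal.ofReal_mul (Real.rpow_nonneg hr.le _)]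
  rw [lintegral_const_mul' _ _ ENNReal.ofReal_ne_top,
    lintegral_majKer_sub (Real.rpow_pos_of_pos hr _)]

lemma wInt_tail_le {d κ : ℝ} (hκ : κ < 1) {F : Sp N × ℝ → ℝ} {a t M : ℝ} (hat : a ≤ t)
    (hF : AEStronglyMeasurable F (volume.restrict ((univ : Set (Sp N)) ×ˢ Ioo a t)))
    (hM : ∀ y r, r ∈ Ioo a t → |F (y, r)| ≤ M) (x : Sp N) :
    wInt d κ (volume.restrict ((univ : Set (Sp N)) ×ˢ Ioo a t)) Prod.fst Prod.snd F x t ≤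
      ENNReal.ofReal ((t - a) ^ (1 - κ) / (1 - κ)) * (ENNReal.ofReal (majMass N) *
        ENNReal.ofReal M) := by
  rw [wInt_prod_eq hF, ← lintegral_sub_rpow_Ioo hκ hat, ← lintegral_mul_const]
  · refine setLIntegral_mono' measurableSet_Ioo fun r hr => ?_
    rw [← mul_assoc, ← lintegral_wker (d := d) (sub_pos.2 hr.2) x,
      ← lintegral_mul_const' _ _ ENNReal.ofReal_ne_top]
    refine lintegral_mono fun y => ?_
    gcongr
    rw [← ofReal_norm]
    exact ENNReal.ofReal_le_ofReal (hM y r hr)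
  · fun_prop

section Duhamel

variable {E : Type*} [NormedAddCommGroup E] [NormedSpace ℝ E] {d κ C : ℝ} {H : Sp N → ℝ → E}
  {T : ℝ≥0∞} {F : Sp N × ℝ → ℝ}

lemma ae_snd_lt {a t : ℝ} :
    ∀ᵐ z ∂(volume.restrict ((univ : Set (Sp N)) ×ˢ Ioo a t)), z.2 < t := by
  filter_upwards [ae_restrict_mem (MeasurableSet.univ.prod measurableSet_Ioo)] with z hz
  exact hz.2.2

lemma enorm_duh_le (hH : KerBound d κ C H) (x : Sp N) (t : ℝ) :
    ‖duh H F x t‖ₑ ≤ ENNReal.ofReal C * duhW d κ F x t :=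
  hH.enorm_integral_le ae_snd_lt x

lemma integrable_duh (hH : KerBound d κ C H)
    (hF : AEStronglyMeasurable F (volume.restrict (dom N T))) {x : Sp N} {t : ℝ}
    (ht : ENNReal.ofReal t < T) (hfin : duhW d κ F x t ≠ ⊤) :
    IntegrableOn (fun z => F z • H (x - z.1) (t - z.2)) ((univ : Set (Sp N)) ×ˢ Ioo 0 t) :=
  hH.integrable measurable_fst measurable_snd
    (hF.mono_measure (Measure.restrict_mono (prod_Ioo_subset_dom ht le_rfl) le_rfl)) ae_snd_lt x hfin

lemma wInt_mono_measure {α : Type*} [MeasurableSpace α] {μ ν : Measure α} (h : μ ≤ ν)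
    {Y : α → Sp N} {S : α → ℝ} {F : α → ℝ} {x : Sp N} {t : ℝ} :
    wInt d κ μ Y S F x t ≤ wInt d κ ν Y S F x t := lintegral_mono' h le_rfl

/-- The Duhamel integral differs little from the one cut off before the final time. -/
lemma enorm_duh_sub_le (hH : KerBound d κ C H) (hκ : κ < 1)
    (hF : AEStronglyMeasurable F (volume.restrict (dom N T))) {x : Sp N} {a t M : ℝ}
    (ha : 0 ≤ a) (hat : a < t) (ht : ENNReal.ofReal t < T)
    (hM : ∀ y r, r ∈ Ioo a t → |F (y, r)| ≤ M)
    (hfin : duhW d κ F x t ≠ ⊤) :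
    ‖duh H F x t - ∫ z in (univ : Set (Sp N)) ×ˢ Ioc 0 a, F z • H (x - z.1) (t - z.2)‖ₑ ≤
      ENNReal.ofReal C * (ENNReal.ofReal ((t - a) ^ (1 - κ) / (1 - κ)) *
        (ENNReal.ofReal (majMass N) * ENNReal.ofReal M)) := by
  have hint := integrable_duh hH hF ht hfin
  have hu : (univ : Set (Sp N)) ×ˢ Ioo 0 t = univ ×ˢ Ioc 0 a ∪ univ ×ˢ Ioo a t := by
    rw [← prod_union, Ioc_union_Ioo_eq_Ioo ha hat]
  have hdisj : Disjoint ((univ : Set (Sp N)) ×ˢ Ioc 0 a) (univ ×ˢ Ioo a t) := by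
    rw [Set.disjoint_prod]
    right
    rw [Set.disjoint_left]
    exact fun r hr hr' => absurd hr'.1 (not_lt.2 hr.2)
  have hint1 := hint.mono_set (hu ▸ subset_union_left)
  have hint2 := hint.mono_set (hu ▸ subset_union_right)
  have heq : duh H F x t = (∫ z in (univ : Set (Sp N)) ×ˢ Ioc 0 a,
      F z • H (x - z.1) (t - z.2)) + ∫ z in (univ : Set (Sp N)) ×ˢ Ioo a t,
      F z • H (x - z.1) (t - z.2) := by
    rw [duh, hu]
    exact setIntegral_union hdisj (MeasurableSet.univ.prod measurableSet_Ioo) hint1 hint2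
  rw [heq, add_sub_cancel_left]
  refine (hH.enorm_integral_le ae_snd_lt x).trans ?_
  gcongr
  exact wInt_tail_le hκ hat.le
    (hF.mono_measure (Measure.restrict_mono (prod_Ioo_subset_dom ht ha) le_rfl)) hM x

lemma tendsto_tail_bound (hκ : κ < 1) (A B : ℝ≥0∞) (hA : A ≠ ⊤) (hB : B ≠ ⊤) :
    Filter.Tendsto (fun ε : ℝ => A * (ENNReal.ofReal (ε ^ (1 - κ) / (1 - κ)) * B))
      (nhds 0) (nhds 0) := by
  have h1 : ContinuousAt (fun ε : ℝ => ε ^ (1 - κ) / (1 - κ)) 0 :=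
    (Real.continuousAt_rpow_const _ _ (Or.inr (by linarith))).div_const _
  have h2 : Filter.Tendsto (fun ε : ℝ => ENNReal.ofReal (ε ^ (1 - κ) / (1 - κ)))
      (nhds 0) (nhds 0) := by
    have := (ENNReal.continuous_ofReal.continuousAt).comp h1
    unfold ContinuousAt at this
    simpa [Real.zero_rpow (show (1 - κ) ≠ 0 by linarith), Function.comp_def] using this
  have h3 := ENNReal.Tendsto.mul_const h2 (b := B) (Or.inr hB)
  have h4 := ENNReal.Tendsto.const_mul h3 (a := A) (Or.inr hA)
  simpa using h4

/-- Duhamel integrals cut off at time t₀ - ε are continuous at (x₀, t₀). The discarded tail is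
uniformly small nearby, because F is bounded away from time zero and κ < 1. -/
lemma continuousOn_duh (hH : KerBound d κ C H) (hC : 0 ≤ C) (hd : 1 < d)
    (hκ0 : 0 ≤ κ) (hκ : κ < 1)
    (hF : AEStronglyMeasurable F (volume.restrict (dom N T)))
    (hM : ∀ τ : ℝ, 0 < τ → ∃ M : ℝ, ∀ y r, τ < r → ENNReal.ofReal r < T → |F (y, r)| ≤ M)
    (hfin : ∀ x t, 0 < t → ENNReal.ofReal t < T → duhW d κ F x t ≠ ⊤) :
    ContinuousOn (fun z : Sp N × ℝ => duh H F z.1 z.2) (dom N T) := by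
  rintro ⟨x₀, t₀⟩ ⟨ht₀, htT⟩
  refine ContinuousAt.continuousWithinAt ?_
  simp only at ht₀ htT
  refine continuousAt_of_locally_uniform_approx_of_continuousAt fun u hu => ?_
  obtain ⟨δ, hδ, hδu⟩ := mem_uniformity_edist.1 hu
  obtain ⟨M, hM⟩ := hM (t₀ / 2) (by linarith)
  have htail := tendsto_tail_bound hκ (ENNReal.ofReal C)
    (ENNReal.ofReal (majMass N) * ENNReal.ofReal M) ENNReal.ofReal_ne_top
    (ENNReal.mul_ne_top ENNReal.ofReal_ne_top ENNReal.ofReal_ne_top)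
  obtain ⟨η, hη, hηδ⟩ := Metric.eventually_nhds_iff.1 (htail (Iio_mem_nhds hδ))
  -- For |t - t₀| < ε/2 the tail has length at most 3ε/2 < η, and it lies at times beyond t₀/2,
  -- where the bound M holds.
  set ε : ℝ := min (η / 4) (t₀ / 4) with hε
  have hε0 : 0 < ε := lt_min (by linarith) (by linarith)
  have hε1 : ε ≤ η / 4 := min_le_left _ _
  have hε2 : ε ≤ t₀ / 4 := min_le_right _ _
  have hsub : Ioc 0 (t₀ - ε) ⊆ Ioo 0 t₀ := fun r hr => ⟨hr.1, by linarith [hr.2]⟩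
  have hmono : volume.restrict ((univ : Set (Sp N)) ×ˢ Ioc 0 (t₀ - ε)) ≤
      volume.restrict (univ ×ˢ Ioo 0 t₀) :=
    Measure.restrict_mono (Set.prod_mono le_rfl hsub) le_rfl
  refine ⟨dom N T ∩ {z | |z.2 - t₀| < ε / 2}, Filter.inter_mem
    ((isOpen_dom N T).mem_nhds ⟨ht₀, htT⟩) ?_,
    fun z => ∫ w in (univ : Set (Sp N)) ×ˢ Ioc 0 (t₀ - ε), F w • H (z.1 - w.1) (z.2 - w.2),
    ?_, ?_⟩
  · refine IsOpen.mem_nhds (isOpen_lt (by fun_prop) continuous_const) ?_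
    simpa using hε0
  · refine hH.continuousAt_integral hC hd hκ0 hκ measurable_fst measurable_snd
      (hF.mono_measure ((hmono.trans
        (Measure.restrict_mono (prod_Ioo_subset_dom htT le_rfl) le_rfl)))) hε0 ?_ x₀ ?_
    · filter_upwards [ae_restrict_mem (MeasurableSet.univ.prod measurableSet_Ioc)] with z hz
      linarith [hz.2.2]
    · exact ne_top_of_le_ne_top (hfin x₀ t₀ ht₀ htT) (wInt_mono_measure hmono)
  · rintro ⟨x, t⟩ ⟨⟨ht, htT'⟩, hzt⟩
    have hzt' : |t - t₀| < ε / 2 := hzt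
    obtain ⟨q1, q2⟩ := abs_lt.1 hzt'
    simp only at ht htT'
    refine hδu ?_
    rw [edist_eq_enorm_sub]
    refine lt_of_le_of_lt (enorm_duh_sub_le hH hκ hF (M := M) (by linarith) (by linarith) htT'
      (fun y r hr => hM y r (by linarith [hr.1])
        ((ENNReal.ofReal_le_ofReal hr.2.le).trans_lt htT')) (hfin x t ht htT')) ?_
    refine hηδ (y := t - (t₀ - ε)) ?_
    rw [Real.dist_eq, sub_zero, abs_of_pos (by linarith)]
    linarith

/-- The cut-off integrals can be differentiated under the integral sign; they converge pointwise and
their derivatives uniformly, so the limit may be differentiated. -/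
lemma hasFDerivAt_duh {κ₀ C₀ : ℝ} {H₀ : Sp N → ℝ → ℝ}
    {H₁ : Sp N → ℝ → (Sp N →L[ℝ] ℝ)} (hH₀ : KerBound d κ₀ C₀ H₀) (hH₁ : KerBound d κ C H₁)
    (hder : ∀ (x : Sp N) (t : ℝ), 0 < t → HasFDerivAt (fun y => H₀ y t) (H₁ x t) x)
    (hC : 0 ≤ C) (hd : 1 < d) (hκ₀ : κ₀ < 1) (hκ0 : 0 ≤ κ) (hκ : κ < 1)
    (hF : AEStronglyMeasurable F (volume.restrict (dom N T)))
    (hM : ∀ τ : ℝ, 0 < τ → ∃ M : ℝ, ∀ y r, τ < r → ENNReal.ofReal r < T → |F (y, r)| ≤ M)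
    {t : ℝ} (ht : 0 < t) (htT : ENNReal.ofReal t < T)
    (hfin₀ : ∀ x, duhW d κ₀ F x t ≠ ⊤) (hfin : ∀ x, duhW d κ F x t ≠ ⊤) (x : Sp N) :
    HasFDerivAt (fun y => duh H₀ F y t) (duh H₁ F x t) x := by
  obtain ⟨M, hM⟩ := hM (t / 4) (by linarith)
  -- The shift by 2 gives ε n ≤ t/2, which keeps every tail at times where M bounds F.
  set ε : ℕ → ℝ := fun n => t / (n + 2) with hεdef
  have hε0 : ∀ n, 0 < ε n := fun n => by simp only [hεdef]; positivity
  have hε2 : ∀ n, ε n ≤ t / 2 := fun n => by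
    simp only [hεdef]; gcongr; linarith [(Nat.cast_nonneg n : (0 : ℝ) ≤ n)]
  have hεlim : Filter.Tendsto ε Filter.atTop (nhds 0) := by
    refine Filter.Tendsto.const_div_atTop ?_ t
    exact Filter.tendsto_atTop_add_const_right _ _ tendsto_natCast_atTop_atTop
  have hmono : ∀ n, volume.restrict ((univ : Set (Sp N)) ×ˢ Ioc 0 (t - ε n)) ≤
      volume.restrict (univ ×ˢ Ioo 0 t) := fun n =>
    Measure.restrict_mono (Set.prod_mono le_rfl
      (Ioc_subset_Ioo_right (by linarith [hε0 n]))) le_rfl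
  have htailε : ∀ n, ∀ y : Sp N, ∀ r, r ∈ Ioo (t - ε n) t → |F (y, r)| ≤ M := fun n y r hr =>
    hM y r (by linarith [hr.1, hε2 n]) ((ENNReal.ofReal_le_ofReal hr.2.le).trans_lt htT)
  refine hasFDerivAt_of_tendstoUniformlyOn (l := Filter.atTop) isOpen_univ (x := x)
    (f := fun n y => ∫ w in (univ : Set (Sp N)) ×ˢ Ioc 0 (t - ε n), F w * H₀ (y - w.1) (t - w.2))
    (f' := fun n y => ∫ w in (univ : Set (Sp N)) ×ˢ Ioc 0 (t - ε n), F w • H₁ (y - w.1) (t - w.2))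
    (g' := fun y => duh H₁ F y t) ?_ ?_ ?_ (mem_univ x)
  · rw [EMetric.tendstoUniformlyOn_iff]
    intro δ hδ
    have htail := (tendsto_tail_bound hκ (ENNReal.ofReal C)
      (ENNReal.ofReal (majMass N) * ENNReal.ofReal M) ENNReal.ofReal_ne_top
      (ENNReal.mul_ne_top ENNReal.ofReal_ne_top ENNReal.ofReal_ne_top)).comp hεlim
    filter_upwards [htail (Iio_mem_nhds hδ)] with n hn y _
    rw [edist_eq_enorm_sub]
    refine lt_of_le_of_lt (enorm_duh_sub_le hH₁ hκ hF (M := M) (by linarith [hε2 n])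
      (by linarith [hε0 n]) htT (htailε n) (hfin y)) ?_
    rw [sub_sub_cancel]
    exact hn
  · intro n y _
    refine hasFDerivAt_integral_kernel hH₀ hH₁ hder hC hd hκ0 hκ measurable_fst measurable_snd
      (hF.mono_measure (((hmono n).trans
        (Measure.restrict_mono (prod_Ioo_subset_dom htT le_rfl) le_rfl)))) (hε0 n) ?_ y ?_ ?_
    · filter_upwards [ae_restrict_mem (MeasurableSet.univ.prod measurableSet_Ioc)] with z hz
      linarith [hz.2.2]
    · exact ne_top_of_le_ne_top (hfin₀ y) (wInt_mono_measure (hmono n))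
    · exact ne_top_of_le_ne_top (hfin y) (wInt_mono_measure (hmono n))
  · intro y _
    rw [tendsto_iff_edist_tendsto_0]
    have htail := (tendsto_tail_bound hκ₀ (ENNReal.ofReal C₀)
      (ENNReal.ofReal (majMass N) * ENNReal.ofReal M) ENNReal.ofReal_ne_top
      (ENNReal.mul_ne_top ENNReal.ofReal_ne_top ENNReal.ofReal_ne_top)).comp hεlim
    refine tendsto_of_tendsto_of_tendsto_of_le_of_le tendsto_const_nhds htail
      (fun _ => zero_le) fun n => ?_
    simp only [Function.comp]
    rw [edist_comm, edist_eq_enorm_sub]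
    have := enorm_duh_sub_le (x := y) hH₀ hκ₀ hF (M := M) (by linarith [hε2 n] : 0 ≤ t - ε n)
      (by linarith [hε0 n]) htT (htailε n) (hfin₀ y)
    rwa [sub_sub_cancel] at this

end Duhamel

/-! ### Existence of a solution below a majorant of the gradient -/

/-- The Duhamel integral of `W^p` with kernel `wker d κ`. -/
def duhMaj (d κ p : ℝ) (W : Sp N → ℝ → ℝ≥0∞) (x : Sp N) (t : ℝ) : ℝ≥0∞ :=
  ∫⁻ s in Ioo 0 t, ∫⁻ y, ENNReal.ofReal (wker d κ (t - s) (x - y)) * W y s ^ p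

/-- `W` is a majorant for the gradient in the Duhamel fixed point equation. -/
structure IsMajorant (d p η : ℝ) (φ : Sp N → ℝ) (T : ℝ≥0∞) (W : Sp N → ℝ → ℝ≥0∞) : Prop where
  meas : AEStronglyMeasurable φ volume
  pot_bdd : ∀ τ : ℝ, 0 < τ → ∃ M : ℝ≥0∞, M ≠ ⊤ ∧ ∀ (x : Sp N) (t : ℝ), τ < t →
    ENNReal.ofReal t < T → pot (t ^ (1 / d)) (fun y => ‖φ y‖ₑ) x ≤ M
  initial : ∀ (x : Sp N) (t : ℝ), 0 < t → ENNReal.ofReal t < T →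
    ‖∫ y, φ y • heatDer d (x - y) t‖ₑ ≤ W x t
  bdd : ∀ τ : ℝ, 0 < τ → ∃ M : ℝ≥0∞, M ≠ ⊤ ∧ ∀ (x : Sp N) (t : ℝ), τ < t →
    ENNReal.ofReal t < T → W x t ≤ M
  small : ∀ (x : Sp N) (t : ℝ), 0 < t → ENNReal.ofReal t < T →
    duhMaj d (1 / d) p W x t ≤ ENNReal.ofReal η * W x t
  duh_bdd : ∀ τ : ℝ, 0 < τ → ∃ M : ℝ≥0∞, M ≠ ⊤ ∧ ∀ (x : Sp N) (t : ℝ), τ < t →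
    ENNReal.ofReal t < T → duhMaj d 0 p W x t ≤ M

lemma IsMajorant.ne_top {d p η : ℝ} {φ : Sp N → ℝ} {T : ℝ≥0∞} {W : Sp N → ℝ → ℝ≥0∞}
    (h : IsMajorant d p η φ T W) {x : Sp N} {t : ℝ} (ht : 0 < t) (htT : ENNReal.ofReal t < T) :
    W x t ≠ ⊤ := by
  obtain ⟨M, hM, hb⟩ := h.bdd (t / 2) (by linarith)
  exact ne_top_of_le_ne_top hM (hb x t (by linarith) htT)

lemma abs_rpow_sub_rpow_le {p : ℝ} (hp : 1 < p) {a b M : ℝ} (ha : 0 ≤ a) (hb : 0 ≤ b)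
    (haM : a ≤ M) (hbM : b ≤ M) : |a ^ p - b ^ p| ≤ p * M ^ (p - 1) * |a - b| := by
  have hM : 0 ≤ M := ha.trans haM
  have := (convex_Icc (0 : ℝ) M).norm_image_sub_le_of_norm_hasDerivWithin_le
    (f := fun x : ℝ => x ^ p) (f' := fun x => p * x ^ (p - 1)) (C := p * M ^ (p - 1))
    (x := b) (y := a) (fun x hx =>
      (Real.hasDerivAt_rpow_const (Or.inr hp.le)).hasDerivWithinAt) (fun x hx => by
      rw [Real.norm_of_nonneg (mul_nonneg (by linarith) (Real.rpow_nonneg hx.1 _))]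
      have := Real.rpow_le_rpow hx.1 hx.2 (show 0 ≤ p - 1 by linarith)
      gcongr) ⟨hb, hbM⟩ ⟨ha, haM⟩
  simpa [Real.norm_eq_abs] using this

/-- The mean value theorem on [0, 2W]: the Lipschitz constant p(2W)^(p-1) times cW is a multiple of
W^p, which the majorant controls. -/
lemma enorm_rpow_sub_rpow_le {E : Type*} [NormedAddCommGroup E] {p : ℝ} (hp : 1 < p) {v w : E}
    {W c : ℝ≥0∞} (hW : W ≠ ⊤) (hv : ‖v‖ₑ ≤ 2 * W) (hw : ‖w‖ₑ ≤ 2 * W) (hvw : ‖v - w‖ₑ ≤ c * W) :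
    ‖‖v‖ ^ p - ‖w‖ ^ p‖ₑ ≤ ENNReal.ofReal (p * 2 ^ (p - 1)) * c * W ^ p := by
  have h2W : 2 * W ≠ ⊤ := ENNReal.mul_ne_top (by simp) hW
  have e : ∀ {u : E}, ‖u‖ₑ ≤ 2 * W → ‖u‖ ≤ (2 * W).toReal := fun {u} hu => by
    rw [← toReal_enorm]; exact ENNReal.toReal_mono h2W hu
  have h1 := abs_rpow_sub_rpow_le hp (norm_nonneg v) (norm_nonneg w) (e hv) (e hw)
  have h2 : |‖v‖ - ‖w‖| ≤ ‖v - w‖ := abs_norm_sub_norm_le v w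
  have hp0 : (0 : ℝ) ≤ p * (2 * W).toReal ^ (p - 1) := by positivity
  calc ‖‖v‖ ^ p - ‖w‖ ^ p‖ₑ = ENNReal.ofReal |‖v‖ ^ p - ‖w‖ ^ p| := by
        rw [← ofReal_norm, Real.norm_eq_abs]
    _ ≤ ENNReal.ofReal (p * (2 * W).toReal ^ (p - 1) * ‖v - w‖) := by
        refine ENNReal.ofReal_le_ofReal (h1.trans ?_)
        gcongr
    _ = ENNReal.ofReal p * (2 * W) ^ (p - 1) * ‖v - w‖ₑ := by
        rw [ENNReal.ofReal_mul hp0, ENNReal.ofReal_mul (by linarith), ofReal_norm,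
          ← ENNReal.ofReal_rpow_of_nonneg ENNReal.toReal_nonneg (by linarith),
          ENNReal.ofReal_toReal h2W]
    _ ≤ ENNReal.ofReal p * (2 * W) ^ (p - 1) * (c * W) := by gcongr
    _ = _ := by
        rw [ENNReal.mul_rpow_of_nonneg _ _ (by linarith : (0 : ℝ) ≤ p - 1),
          ENNReal.ofReal_mul (by linarith), ← ENNReal.ofReal_rpow_of_pos (by norm_num),
          ENNReal.ofReal_ofNat]
        have : W ^ p = W ^ (p - 1) * W := by
          conv_rhs => rw [← ENNReal.rpow_one W, ← ENNReal.rpow_mul, one_mul,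
            ← ENNReal.rpow_add_of_nonneg _ _ (by linarith) (by norm_num), sub_add_cancel]
        rw [this]
        ring

/-! ### The Picard iteration for the gradient -/

section Fixed

variable {d p η : ℝ} {φ : Sp N → ℝ} {T : ℝ≥0∞} {W : Sp N → ℝ → ℝ≥0∞}

lemma aestronglyMeasurable_norm_rpow {E : Type*} [NormedAddCommGroup E]
    {V : Sp N × ℝ → E} (hV : ContinuousOn V (dom N T)) (hp : 0 ≤ p) :
    AEStronglyMeasurable (fun z => ‖V z‖ ^ p) (volume.restrict (dom N T)) := by
  have h : ContinuousOn (fun z => ‖V z‖ ^ p) (dom N T) :=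
    hV.norm.rpow_const fun z _ => Or.inr hp
  exact h.aestronglyMeasurable (isOpen_dom N T).measurableSet

lemma duhW_le_of_enorm_le {F : Sp N × ℝ → ℝ} {κ : ℝ} {c : ℝ≥0∞} (hc : c ≠ ⊤)
    (hF : AEStronglyMeasurable F (volume.restrict (dom N T)))
    (hFW : ∀ z ∈ dom N T, ‖F z‖ₑ ≤ c * W z.1 z.2 ^ p) {x : Sp N} {t : ℝ}
    (htT : ENNReal.ofReal t < T) :
    duhW d κ F x t ≤ c * duhMaj d κ p W x t := by
  rw [duhW, wInt_prod_eq (hF.mono_measure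
    (Measure.restrict_mono (prod_Ioo_subset_dom htT le_rfl) le_rfl)), duhMaj,
    ← lintegral_const_mul' _ _ hc]
  refine setLIntegral_mono' measurableSet_Ioo fun s hs => ?_
  rw [← lintegral_const_mul' _ _ hc]
  refine lintegral_mono fun y => ?_
  calc ENNReal.ofReal (wker d κ (t - s) (x - y)) * ‖F (y, s)‖ₑ
      ≤ ENNReal.ofReal (wker d κ (t - s) (x - y)) * (c * W y s ^ p) := by
        gcongr
        exact hFW (y, s) ⟨hs.1, (ENNReal.ofReal_le_ofReal hs.2.le).trans_lt htT⟩
    _ = _ := by ring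

lemma enorm_norm_rpow_le {E : Type*} [NormedAddCommGroup E] (hp : 0 ≤ p) {v : E} {w : ℝ≥0∞}
    (hv : ‖v‖ₑ ≤ 2 * w) : ‖‖v‖ ^ p‖ₑ ≤ 2 ^ p * w ^ p := by
  rw [Real.enorm_rpow_of_nonneg (norm_nonneg _) hp, enorm_norm,
    ← ENNReal.mul_rpow_of_nonneg _ _ hp]
  gcongr

lemma IsMajorant.norm_rpow_bdd {E : Type*} [NormedAddCommGroup E] (hW : IsMajorant d p η φ T W)
    (hp : 0 ≤ p) {V : Sp N × ℝ → E} (hV : ∀ z ∈ dom N T, ‖V z‖ₑ ≤ 2 * W z.1 z.2) :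
    ∀ τ : ℝ, 0 < τ → ∃ M : ℝ, ∀ y r, τ < r → ENNReal.ofReal r < T → |‖V (y, r)‖ ^ p| ≤ M := by
  intro τ hτ
  obtain ⟨M, hM, hb⟩ := hW.bdd τ hτ
  refine ⟨(2 * M).toReal ^ p, fun y r hr hrT => ?_⟩
  rw [abs_of_nonneg (by positivity)]
  refine Real.rpow_le_rpow (norm_nonneg _) ?_ hp
  rw [← toReal_enorm]
  refine ENNReal.toReal_mono (ENNReal.mul_ne_top (by simp) hM) ?_
  exact (hV (y, r) ⟨hτ.trans hr, hrT⟩).trans (by gcongr; exact hb y r hr hrT)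

variable {C : ℝ}

lemma IsMajorant.duhW_ne_top {E : Type*} [NormedAddCommGroup E] (hW : IsMajorant d p η φ T W)
    (hp : 0 ≤ p) {V : Sp N × ℝ → E} (hVc : ContinuousOn V (dom N T))
    (hV : ∀ z ∈ dom N T, ‖V z‖ₑ ≤ 2 * W z.1 z.2) (x : Sp N) (t : ℝ) (ht : 0 < t)
    (htT : ENNReal.ofReal t < T) :
    duhW d (1 / d) (fun z => ‖V z‖ ^ p) x t ≠ ⊤ ∧ duhW d 0 (fun z => ‖V z‖ ^ p) x t ≠ ⊤ := by
  have h2p : (2 : ℝ≥0∞) ^ p ≠ ⊤ := ENNReal.rpow_ne_top_of_nonneg hp (by simp)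
  have h := fun κ => duhW_le_of_enorm_le (d := d) (κ := κ) (p := p) (W := W) h2p
    (aestronglyMeasurable_norm_rpow hVc hp)
    (fun z hz => enorm_norm_rpow_le hp (hV z hz)) (x := x) htT
  constructor
  · refine ne_top_of_le_ne_top (ENNReal.mul_ne_top h2p ?_) (h (1 / d))
    exact ne_top_of_le_ne_top (ENNReal.mul_ne_top ENNReal.ofReal_ne_top (hW.ne_top ht htT))
      (hW.small x t ht htT)
  · obtain ⟨M, hM, hb⟩ := hW.duh_bdd (t / 2) (by linarith)
    exact ne_top_of_le_ne_top (ENNReal.mul_ne_top h2p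
      (ne_top_of_le_ne_top hM (hb x t (by linarith) htT))) (h 0)

/-- One step of the Picard iteration for the gradient. -/
def picard (d p : ℝ) (φ : Sp N → ℝ) (V : Sp N × ℝ → (Sp N →L[ℝ] ℝ)) (z : Sp N × ℝ) :
    Sp N →L[ℝ] ℝ :=
  (∫ y, φ y • heatDer d (z.1 - y) z.2) + duh (heatDer d) (fun w => ‖V w‖ ^ p) z.1 z.2

lemma wInt_initial {κ : ℝ} {x : Sp N} {t : ℝ} (ht : 0 < t) :
    wInt d κ volume id (fun _ : Sp N => (0 : ℝ)) φ x t =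
      ENNReal.ofReal (t ^ (-κ)) * pot (t ^ (1 / d)) (fun y => ‖φ y‖ₑ) x := by
  unfold wInt wker pot
  simp_rw [sub_zero, ENNReal.ofReal_mul (Real.rpow_nonneg ht.le _)]
  rw [← lintegral_const_mul' _ _ ENNReal.ofReal_ne_top]
  congr 1; ext y
  simp only [id]
  ring

lemma IsMajorant.wInt_initial_ne_top (hW : IsMajorant d p η φ T W) {κ : ℝ} {x : Sp N} {t : ℝ}
    (ht : 0 < t) (htT : ENNReal.ofReal t < T) :
    wInt d κ volume id (fun _ : Sp N => (0 : ℝ)) φ x t ≠ ⊤ := by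
  rw [wInt_initial ht]
  obtain ⟨M, hM, hb⟩ := hW.pot_bdd (t / 2) (by linarith)
  exact ENNReal.mul_ne_top ENNReal.ofReal_ne_top
    (ne_top_of_le_ne_top hM (hb x t (by linarith) htT))

lemma IsMajorant.continuousOn_initial {E : Type*} [NormedAddCommGroup E] [NormedSpace ℝ E]
    (hW : IsMajorant d p η φ T W) {κ : ℝ}
    {H : Sp N → ℝ → E} (hH : KerBound d κ C H) (hC : 0 ≤ C) (hd : 1 < d)
    (hκ0 : 0 ≤ κ) (hκ : κ < 1) :
    ContinuousOn (fun z : Sp N × ℝ => ∫ y, φ y • H (z.1 - y) z.2) (dom N T) := by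
  rintro ⟨x, t⟩ ⟨ht, htT⟩
  have := hH.continuousAt_integral (μ := volume) (Y := id) (S := fun _ : Sp N => (0 : ℝ))
    hC hd hκ0 hκ measurable_id
    measurable_const hW.meas (ε := t) ht (Filter.Eventually.of_forall fun a => by simp) x
    (hW.wInt_initial_ne_top ht htT)
  simp only [sub_zero, id] at this
  exact this.continuousWithinAt

/-- The linear term contributes at most W, and the Duhamel term at most C·2^p·η·W ≤ W. -/
lemma picard_props (hW : IsMajorant d p η φ T W) (hd : 1 < d) (hp : 1 < p) (hC : 0 ≤ C)
    (hH : KerBound d (1 / d) C (heatDer d : Sp N → ℝ → (Sp N →L[ℝ] ℝ)))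
    (hη : C * (2 ^ p * η) ≤ 1)
    {V : Sp N × ℝ → (Sp N →L[ℝ] ℝ)} (hVc : ContinuousOn V (dom N T))
    (hV : ∀ z ∈ dom N T, ‖V z‖ₑ ≤ 2 * W z.1 z.2) :
    ContinuousOn (picard d p φ V) (dom N T) ∧
      ∀ z ∈ dom N T, ‖picard d p φ V z‖ₑ ≤ 2 * W z.1 z.2 := by
  have hp0 : 0 ≤ p := by linarith
  have hd1 : 1 / d < 1 := by rw [div_lt_one (by linarith)]; exact hd
  have hd0 : 0 ≤ 1 / d := by positivity
  have hm := aestronglyMeasurable_norm_rpow hVc hp0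
  refine ⟨(hW.continuousOn_initial hH hC hd hd0 hd1).add
    (continuousOn_duh hH hC hd hd0 hd1 hm (hW.norm_rpow_bdd hp0 hV)
      fun x t ht htT => (hW.duhW_ne_top hp0 hVc hV x t ht htT).1), ?_⟩
  rintro ⟨x, t⟩ ⟨ht, htT⟩
  have h0 := enorm_add_le (∫ y, φ y • heatDer d (x - y) t)
    (duh (heatDer d) (fun w => ‖V w‖ ^ p) x t)
  have h2p : (2 : ℝ≥0∞) ^ p ≠ ⊤ := ENNReal.rpow_ne_top_of_nonneg hp0 (by simp)
  have h1 := hW.initial x t ht htT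
  have h2 := (enorm_duh_le (F := fun w => ‖V w‖ ^ p) hH x t).trans
    (mul_le_mul_right (duhW_le_of_enorm_le (p := p) (W := W) h2p hm
      (fun z hz => enorm_norm_rpow_le hp0 (hV z hz)) htT) (ENNReal.ofReal C))
  have h3 : ENNReal.ofReal C * (2 ^ p * duhMaj d (1 / d) p W x t) ≤ 1 * W x t := by
    calc ENNReal.ofReal C * (2 ^ p * duhMaj d (1 / d) p W x t)
        ≤ ENNReal.ofReal C * (2 ^ p * (ENNReal.ofReal η * W x t)) := by
          gcongr; exact hW.small x t ht htT
      _ = ENNReal.ofReal (C * (2 ^ p * η)) * W x t := by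
          rw [ENNReal.ofReal_mul hC, ENNReal.ofReal_mul (by positivity),
            ← ENNReal.ofReal_rpow_of_pos (by norm_num), ENNReal.ofReal_ofNat]
          ring
      _ ≤ 1 * W x t := by
          gcongr
          exact ENNReal.ofReal_le_one.2 hη
  calc _ ≤ W x t + 1 * W x t := h0.trans (add_le_add h1 (h2.trans h3))
    _ = 2 * W x t := by ring

/-- The distance of V and V' is the best c with |V - V'| ≤ cW. The first-order term cancels, and the
Lipschitz bound for the power leaves the factor C·p·2^(p-1)·η ≤ 1/2. -/
lemma picard_contract (hW : IsMajorant d p η φ T W) (hp : 1 < p) (hC : 0 ≤ C)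
    (hH : KerBound d (1 / d) C (heatDer d : Sp N → ℝ → (Sp N →L[ℝ] ℝ)))
    (hη : C * (p * 2 ^ (p - 1) * η) ≤ 1 / 2)
    {V V' : Sp N × ℝ → (Sp N →L[ℝ] ℝ)} (hVc : ContinuousOn V (dom N T))
    (hV : ∀ z ∈ dom N T, ‖V z‖ₑ ≤ 2 * W z.1 z.2) (hVc' : ContinuousOn V' (dom N T))
    (hV' : ∀ z ∈ dom N T, ‖V' z‖ₑ ≤ 2 * W z.1 z.2) {c : ℝ≥0∞} (hc : c ≠ ⊤)
    (hVV' : ∀ z ∈ dom N T, ‖V z - V' z‖ₑ ≤ c * W z.1 z.2) :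
    ∀ z ∈ dom N T, ‖picard d p φ V z - picard d p φ V' z‖ₑ ≤ c / 2 * W z.1 z.2 := by
  have hp0 : 0 ≤ p := by linarith
  rintro ⟨x, t⟩ ⟨ht, htT⟩
  simp only at ht htT
  have hm := aestronglyMeasurable_norm_rpow hVc hp0
  have hm' := aestronglyMeasurable_norm_rpow hVc' hp0
  have heq : picard d p φ V (x, t) - picard d p φ V' (x, t) =
      duh (heatDer d) (fun w => ‖V w‖ ^ p - ‖V' w‖ ^ p) x t := by
    simp only [picard, add_sub_add_left_eq_sub, duh, sub_smul]
    rw [integral_sub]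
    · exact integrable_duh hH hm htT (hW.duhW_ne_top hp0 hVc hV x t ht htT).1
    · exact integrable_duh hH hm' htT (hW.duhW_ne_top hp0 hVc' hV' x t ht htT).1
  rw [heq]
  have hcc : ENNReal.ofReal (p * 2 ^ (p - 1)) * c ≠ ⊤ :=
    ENNReal.mul_ne_top ENNReal.ofReal_ne_top hc
  refine (enorm_duh_le hH x t).trans ((mul_le_mul_right (duhW_le_of_enorm_le (p := p) (W := W)
    hcc (hm.sub hm') (fun z hz => enorm_rpow_sub_rpow_le hp (hW.ne_top hz.1 hz.2)
      (hV z hz) (hV' z hz) (hVV' z hz)) htT) _).trans ?_)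
  calc ENNReal.ofReal C * (ENNReal.ofReal (p * 2 ^ (p - 1)) * c * duhMaj d (1 / d) p W x t)
      ≤ ENNReal.ofReal C * (ENNReal.ofReal (p * 2 ^ (p - 1)) * c *
          (ENNReal.ofReal η * W x t)) := by gcongr; exact hW.small x t ht htT
    _ = ENNReal.ofReal (C * (p * 2 ^ (p - 1) * η)) * c * W x t := by
        rw [ENNReal.ofReal_mul hC, ENNReal.ofReal_mul (p := p * 2 ^ (p - 1)) (by positivity)]
        ring
    _ ≤ 2⁻¹ * c * W x t := by
        gcongr
        refine (ENNReal.ofReal_le_ofReal hη).trans (le_of_eq ?_)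
        rw [one_div, ENNReal.ofReal_inv_of_pos (by norm_num), ENNReal.ofReal_ofNat]
    _ = c / 2 * W x t := by rw [div_eq_mul_inv, mul_comm c]

/-- Starting from 0, consecutive iterates differ by at most 2^(-n) W. Finiteness of W gives
pointwise limits; boundedness of W away from time zero makes the convergence locally uniform, hence
the limit continuous. -/
lemma exists_picard_fixed (hW : IsMajorant d p η φ T W) (hd : 1 < d) (hp : 1 < p) (hC : 0 ≤ C)
    (hH : KerBound d (1 / d) C (heatDer d : Sp N → ℝ → (Sp N →L[ℝ] ℝ)))
    (hη1 : C * (2 ^ p * η) ≤ 1) (hη2 : C * (p * 2 ^ (p - 1) * η) ≤ 1 / 2) :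
    ∃ V : Sp N × ℝ → (Sp N →L[ℝ] ℝ), ContinuousOn V (dom N T) ∧
      (∀ z ∈ dom N T, ‖V z‖ₑ ≤ 2 * W z.1 z.2) ∧ ∀ z ∈ dom N T, V z = picard d p φ V z := by
  have hp0 : 0 ≤ p := by linarith
  set V : ℕ → Sp N × ℝ → (Sp N →L[ℝ] ℝ) := fun n => (picard d p φ)^[n] 0 with hVdef
  have hsucc : ∀ n, V (n + 1) = picard d p φ (V n) := fun n => by
    simp only [hVdef, Function.iterate_succ_apply']
  have hprop : ∀ n, ContinuousOn (V n) (dom N T) ∧ ∀ z ∈ dom N T, ‖V n z‖ₑ ≤ 2 * W z.1 z.2 := by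
    intro n
    induction n with
    | zero => exact ⟨continuousOn_const, fun z _ => by
        rw [show V 0 z = 0 from rfl, ← ofReal_norm, norm_zero]; simp⟩
    | succ n ih =>
      rw [hsucc]
      exact picard_props hW hd hp hC hH hη1 ih.1 ih.2
  have hdiff : ∀ n, ∀ z ∈ dom N T, ‖V n z - V (n + 1) z‖ₑ ≤ 1 / 2 ^ n * W z.1 z.2 := by
    intro n
    induction n with
    | zero =>
      rintro ⟨x, t⟩ ⟨ht, htT⟩
      have : V 0 (x, t) - V 1 (x, t) = -∫ y, φ y • heatDer d (x - y) t := by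
        rw [hsucc 0]
        simp [hVdef, picard, duh, Real.zero_rpow (show p ≠ 0 by linarith)]
      rw [this, enorm_neg]
      simpa using hW.initial x t ht htT
    | succ n ih =>
      intro z hz
      rw [hsucc (n + 1)]
      have h := picard_contract hW hp hC hH hη2 (hprop n).1 (hprop n).2 (hprop (n + 1)).1
        (hprop (n + 1)).2 (c := 1 / 2 ^ n) (by simp) ih z hz
      rw [← hsucc n] at h
      refine h.trans (le_of_eq ?_)
      rw [pow_succ, div_eq_mul_inv, div_eq_mul_inv, div_eq_mul_inv,
        ENNReal.mul_inv (by simp) (by simp), mul_assoc 1]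
  have hedist : ∀ z ∈ dom N T, ∀ n, edist (V n z) (V (n + 1) z) ≤ W z.1 z.2 / 2 ^ n := by
    intro z hz n
    rw [edist_eq_enorm_sub]
    refine (hdiff n z hz).trans (le_of_eq ?_)
    rw [one_div, mul_comm, ← div_eq_mul_inv]
  have hex : ∀ z, ∃ a, z ∈ dom N T → Filter.Tendsto (fun n => V n z) Filter.atTop (nhds a) := by
    intro z
    by_cases hz : z ∈ dom N T
    · obtain ⟨a, ha⟩ := cauchySeq_tendsto_of_complete
        (cauchySeq_of_edist_le_geometric_two _ (hW.ne_top hz.1 hz.2) (hedist z hz))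
      exact ⟨a, fun _ => ha⟩
    · exact ⟨0, fun h => absurd h hz⟩
  choose U hlim using hex
  have hVU : ∀ z ∈ dom N T, ∀ n, edist (V n z) (U z) ≤ 2 * W z.1 z.2 / 2 ^ n := fun z hz n =>
    edist_le_of_edist_le_geometric_two_of_tendsto _ (hedist z hz) (hlim z hz) n
  have hpow : Filter.Tendsto (fun n : ℕ => ((2 : ℝ≥0∞) ^ n)⁻¹) Filter.atTop (nhds 0) := by
    simp_rw [ENNReal.inv_pow]
    exact ENNReal.tendsto_pow_atTop_nhds_zero_of_lt_one (by simp)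
  have hUc : ContinuousOn U (dom N T) := by
    rintro ⟨x₀, t₀⟩ hz₀
    refine ContinuousAt.continuousWithinAt ?_
    refine continuousAt_of_locally_uniform_approx_of_continuousAt fun u hu => ?_
    obtain ⟨δ, hδ, hδu⟩ := mem_uniformity_edist.1 hu
    obtain ⟨M, hM, hb⟩ := hW.bdd (t₀ / 2) (by have : 0 < t₀ := hz₀.1; linarith)
    have h1 : Filter.Tendsto (fun n : ℕ => 2 * M * ((2 : ℝ≥0∞) ^ n)⁻¹) Filter.atTop (nhds 0) := by
      have := ENNReal.Tendsto.const_mul hpow (a := 2 * M)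
        (Or.inr (ENNReal.mul_ne_top (by simp) hM))
      simpa using this
    obtain ⟨n, hn⟩ := (h1.eventually (Iio_mem_nhds hδ)).exists
    refine ⟨dom N T ∩ {z | t₀ / 2 < z.2}, Filter.inter_mem ((isOpen_dom N T).mem_nhds hz₀)
      ((isOpen_lt continuous_const continuous_snd).mem_nhds ?_), V n,
      (hprop n).1.continuousAt ((isOpen_dom N T).mem_nhds hz₀), ?_⟩
    · have : 0 < t₀ := hz₀.1
      simp only [mem_ofPred_eq]; linarith
    · rintro ⟨x, t⟩ ⟨hz, hzt⟩
      refine hδu ?_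
      rw [edist_comm]
      refine ((hVU _ hz n).trans ?_).trans_lt hn
      rw [div_eq_mul_inv]
      gcongr
      exact hb x t hzt hz.2
  have hUW : ∀ z ∈ dom N T, ‖U z‖ₑ ≤ 2 * W z.1 z.2 := fun z hz =>
    le_of_tendsto (hlim z hz).enorm (Filter.Eventually.of_forall fun n => (hprop n).2 z hz)
  refine ⟨U, hUc, hUW, fun z hz => ?_⟩
  refine tendsto_nhds_unique ((hlim z hz).comp (Filter.tendsto_add_atTop_nat 1)) ?_
  rw [tendsto_iff_edist_tendsto_0]
  have h1 : Filter.Tendsto (fun n : ℕ => ((2 : ℝ≥0∞) ^ n)⁻¹ * W z.1 z.2) Filter.atTop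
      (nhds 0) := by
    have := ENNReal.Tendsto.mul_const hpow (b := W z.1 z.2) (Or.inr (hW.ne_top hz.1 hz.2))
    simpa using this
  refine tendsto_of_tendsto_of_tendsto_of_le_of_le tendsto_const_nhds h1
      (fun _ => zero_le) fun n => ?_
  simp only [Function.comp, hsucc n]
  rw [edist_eq_enorm_sub]
  refine (picard_contract hW hp hC hH hη2 (hprop n).1 (hprop n).2 hUc hUW (c := 2 * (2 ^ n)⁻¹)
    (ENNReal.mul_ne_top (by simp) (by simp)) (fun w hw => ?_) z hz).trans (le_of_eq ?_)
  · rw [← edist_eq_enorm_sub]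
    refine (hVU w hw n).trans (le_of_eq ?_)
    rw [div_eq_mul_inv]; ring
  · congr 1
    rw [div_eq_mul_inv, mul_comm (2 : ℝ≥0∞), mul_assoc, ENNReal.mul_inv_cancel (by simp) (by simp),
      mul_one]

end Fixed

section Existence

variable {d p η : ℝ} {φ : Sp N → ℝ} {T : ℝ≥0∞} {W : Sp N → ℝ → ℝ≥0∞} {C : ℝ}

lemma IsMajorant.hasFDerivAt_initial (hN : 1 ≤ N) (hW : IsMajorant d p η φ T W) (hd : 1 < d)
    (hC : 0 ≤ C) (hH₀ : KerBound d 0 C (heatKernel d : Sp N → ℝ → ℝ))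
    (hH : KerBound d (1 / d) C (heatDer d : Sp N → ℝ → (Sp N →L[ℝ] ℝ)))
    {t : ℝ} (ht : 0 < t) (htT : ENNReal.ofReal t < T) (x : Sp N) :
    HasFDerivAt (fun x => ∫ y, φ y * heatKernel d (x - y) t)
      (∫ y, φ y • heatDer d (x - y) t) x := by
  have hd1 : 1 / d < 1 := by rw [div_lt_one (by linarith)]; exact hd
  have hd0 : 0 ≤ 1 / d := by positivity
  have := hasFDerivAt_integral_kernel (μ := volume) (Y := id) (S := fun _ : Sp N => (0 : ℝ))
    (F := φ) hH₀ hH (fun x t ht => hasFDerivAt_heatKernel hN hd ht x) hC hd hd0 hd1 measurable_id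
    measurable_const hW.meas (ε := t) ht (Filter.Eventually.of_forall fun a => by simp) x
    (hW.wInt_initial_ne_top ht htT) (hW.wInt_initial_ne_top ht htT)
  simpa only [sub_zero, id] using this

lemma gradient_eq_of_hasFDerivAt {f : Sp N → ℝ} {L : Sp N →L[ℝ] ℝ} {x : Sp N}
    (h : HasFDerivAt f L x) : gradient f x = (InnerProductSpace.toDual ℝ (Sp N)).symm L := by
  rw [gradient, h.fderiv]

/-- Below a majorant there is a solution. -/
theorem exists_isSolution_of_isMajorant (hN : 1 ≤ N) (hd : 1 < d) (hp : 1 < p) :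
    ∃ η : ℝ, 0 < η ∧ ∃ C : ℝ, 0 < C ∧ ∀ (T : ℝ≥0∞) (φ : Sp N → ℝ) (W : Sp N → ℝ → ℝ≥0∞),
      IsMajorant d p η φ T W → ∃ u : Sp N → ℝ → ℝ, IsSolution d p φ T u ∧
        ∀ (x : Sp N) (t : ℝ), 0 < t → ENNReal.ofReal t < T →
          ‖u x t‖ₑ ≤ ENNReal.ofReal C *
            (pot (t ^ (1 / d)) (fun y => ‖φ y‖ₑ) x + duhMaj d 0 p W x t) ∧
          ‖gradient (fun y => u y t) x‖ₑ ≤ 2 * W x t := by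
  obtain ⟨C, hC, hH₀, hH⟩ := exists_kerBound_heatKernel hN hd
  have hp0 : 0 ≤ p := by linarith
  have hd1 : 1 / d < 1 := by rw [div_lt_one (by linarith)]; exact hd
  have hd0 : 0 ≤ 1 / d := by positivity
  have h2p : (2 : ℝ≥0∞) ^ p ≠ ⊤ := ENNReal.rpow_ne_top_of_nonneg hp0 (by simp)
  -- With η = 1/A each summand of A accounts for one of the two smallness conditions of the
  -- iteration.
  set A : ℝ := C * 2 ^ p + C * (p * 2 ^ (p - 1)) * 2 with hA
  have hA0 : 0 < A := by positivity
  refine ⟨1 / A, by positivity, C * (1 + 2 ^ p), by positivity, fun T φ W hW => ?_⟩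
  obtain ⟨V, hVc, hVW, hVfix⟩ := exists_picard_fixed hW hd hp hC.le hH
    (by
      rw [← mul_assoc, ← div_eq_mul_one_div, div_le_one hA0, hA]
      have : 0 ≤ C * (p * 2 ^ (p - 1)) * 2 := by positivity
      linarith)
    (by
      rw [← mul_assoc, ← div_eq_mul_one_div, div_le_iff₀ hA0, hA]
      have : 0 ≤ C * 2 ^ p := by positivity
      linarith)
  have hm := aestronglyMeasurable_norm_rpow hVc hp0
  have hbd := hW.norm_rpow_bdd hp0 hVW
  have hfin := hW.duhW_ne_top hp0 hVc hVW
  set F : Sp N × ℝ → ℝ := fun z => ‖V z‖ ^ p with hF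
  set u : Sp N → ℝ → ℝ := fun x t =>
    (∫ y, φ y * heatKernel d (x - y) t) + duh (heatKernel d) F x t with hu
  have hder : ∀ x t, 0 < t → ENNReal.ofReal t < T →
      HasFDerivAt (fun y => u y t) (V (x, t)) x := by
    intro x t ht htT
    rw [hVfix (x, t) ⟨ht, htT⟩]
    exact (hW.hasFDerivAt_initial hN hd hC.le hH₀ hH ht htT x).add
      (hasFDerivAt_duh hH₀ hH (fun x t ht => hasFDerivAt_heatKernel hN hd ht x) hC.le hd
        zero_lt_one hd0 hd1 hm hbd ht htT (fun x => (hfin x t ht htT).2)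
        (fun x => (hfin x t ht htT).1) x)
  have hgrad : ∀ x t, 0 < t → ENNReal.ofReal t < T →
      gradient (fun y => u y t) x = (InnerProductSpace.toDual ℝ (Sp N)).symm (V (x, t)) :=
    fun x t ht htT => gradient_eq_of_hasFDerivAt (hder x t ht htT)
  have hgradn : ∀ x t, 0 < t → ENNReal.ofReal t < T →
      ‖gradient (fun y => u y t) x‖ = ‖V (x, t)‖ := fun x t ht htT => by
    rw [hgrad x t ht htT, LinearIsometryEquiv.norm_map]
  have hinit_int : ∀ x t, 0 < t → ENNReal.ofReal t < T →
      Integrable (fun y => φ y * heatKernel d (x - y) t) := by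
    intro x t ht htT
    have := hH₀.integrable (μ := volume) (Y := id) (S := fun _ : Sp N => (0 : ℝ)) (F := φ)
      measurable_id measurable_const hW.meas (t := t) (Filter.Eventually.of_forall fun _ => ht) x
      (hW.wInt_initial_ne_top ht htT)
    simpa only [sub_zero, id, smul_eq_mul] using this
  have hduh_int : ∀ x t, 0 < t → ENNReal.ofReal t < T → IntegrableOn
      (fun z : Sp N × ℝ => F z • heatKernel d (x - z.1) (t - z.2)) (univ ×ˢ Ioo 0 t) :=
    fun x t ht htT => integrable_duh hH₀ hm htT (hfin x t ht htT).2
  have hFgrad : ∀ x t, 0 < t → ENNReal.ofReal t < T →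
      F (x, t) = ‖gradient (fun y => u y t) x‖ ^ p := fun x t ht htT => by
    rw [hgradn x t ht htT]
  have hubound : ∀ (x : Sp N) (t : ℝ), 0 < t → ENNReal.ofReal t < T →
      ‖u x t‖ₑ ≤ ENNReal.ofReal (C * (1 + 2 ^ p)) *
        (pot (t ^ (1 / d)) (fun y => ‖φ y‖ₑ) x + duhMaj d 0 p W x t) := by
    intro x t ht htT
    have h1 := hH₀.enorm_integral_le (μ := volume) (Y := id) (S := fun _ : Sp N => (0 : ℝ))
      (F := φ) (t := t) (Filter.Eventually.of_forall fun _ => ht) x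
    rw [wInt_initial ht] at h1
    simp only [sub_zero, id, smul_eq_mul, neg_zero, Real.rpow_zero, ENNReal.ofReal_one,
      one_mul] at h1
    have h2 := (enorm_duh_le (F := F) hH₀ x t).trans
      (mul_le_mul_right (duhW_le_of_enorm_le (p := p) (W := W) h2p hm
        (fun z hz => enorm_norm_rpow_le hp0 (hVW z hz)) htT) (ENNReal.ofReal C))
    have h3 : ENNReal.ofReal (C * (1 + 2 ^ p)) = ENNReal.ofReal C * (1 + 2 ^ p) := by
      rw [ENNReal.ofReal_mul hC.le, ENNReal.ofReal_add (by norm_num) (by positivity),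
        ENNReal.ofReal_one, ← ENNReal.ofReal_rpow_of_pos (by norm_num), ENNReal.ofReal_ofNat]
    calc ‖u x t‖ₑ ≤ ENNReal.ofReal C * pot (t ^ (1 / d)) (fun y => ‖φ y‖ₑ) x +
          ENNReal.ofReal C * (2 ^ p * duhMaj d 0 p W x t) :=
          (enorm_add_le _ _).trans (add_le_add h1 h2)
      _ ≤ ENNReal.ofReal C * pot (t ^ (1 / d)) (fun y => ‖φ y‖ₑ) x +
          ENNReal.ofReal C * (2 ^ p * duhMaj d 0 p W x t) +
          (ENNReal.ofReal C * 2 ^ p * pot (t ^ (1 / d)) (fun y => ‖φ y‖ₑ) x +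
          ENNReal.ofReal C * duhMaj d 0 p W x t) := le_self_add
      _ = _ := by rw [h3]; ring
  refine ⟨u, ⟨fun t ht htT x => (hder x t ht htT).differentiableAt, ?_, ?_, ?_, ?_, ?_, ?_⟩,
    fun x t ht htT => ⟨hubound x t ht htT, ?_⟩⟩
  · have h1 := hW.continuousOn_initial hH₀ hC.le hd le_rfl zero_lt_one
    have h2 := continuousOn_duh hH₀ hC.le hd le_rfl zero_lt_one hm hbd
      fun x t ht htT => (hfin x t ht htT).2
    exact h1.add h2
  · refine ContinuousOn.congr (f := fun z => (InnerProductSpace.toDual ℝ (Sp N)).symm (V z)) ?_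
      fun z hz => hgrad z.1 z.2 hz.1 hz.2
    exact (LinearIsometryEquiv.continuous _).comp_continuousOn hVc
  · intro τ hτ
    obtain ⟨M₁, hM₁, hb₁⟩ := hW.bdd τ hτ
    obtain ⟨M₂, hM₂, hb₂⟩ := hW.pot_bdd τ hτ
    obtain ⟨M₃, hM₃, hb₃⟩ := hW.duh_bdd τ hτ
    have t1 : 2 * M₁ ≠ ⊤ := ENNReal.mul_ne_top (by simp) hM₁
    have t2 : ENNReal.ofReal (C * (1 + 2 ^ p)) * (M₂ + M₃) ≠ ⊤ :=
      ENNReal.mul_ne_top ENNReal.ofReal_ne_top (ENNReal.add_ne_top.2 ⟨hM₂, hM₃⟩)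
    refine ⟨(2 * M₁).toReal + (ENNReal.ofReal (C * (1 + 2 ^ p)) * (M₂ + M₃)).toReal,
      fun x t hτt htT => ⟨?_, ?_⟩⟩
    · have h1 : ‖u x t‖ₑ ≤ ENNReal.ofReal (C * (1 + 2 ^ p)) * (M₂ + M₃) :=
        (hubound x t (hτ.trans hτt) htT).trans
          (by gcongr; exacts [hb₂ x t hτt htT, hb₃ x t hτt htT])
      have h2 := ENNReal.toReal_mono t2 h1
      rw [toReal_enorm, Real.norm_eq_abs] at h2
      linarith [ENNReal.toReal_nonneg (a := 2 * M₁)]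
    · rw [hgradn x t (hτ.trans hτt) htT]
      have h1 : ‖V (x, t)‖ₑ ≤ 2 * M₁ := (hVW (x, t) ⟨hτ.trans hτt, htT⟩).trans
        (by gcongr; exact hb₁ x t hτt htT)
      have h2 := ENNReal.toReal_mono t1 h1
      rw [toReal_enorm] at h2
      linarith [ENNReal.toReal_nonneg (a := ENNReal.ofReal (C * (1 + 2 ^ p)) * (M₂ + M₃))]
  · intro x t ht htT
    simpa only [mul_comm] using hinit_int x t ht htT
  · intro x t ht htT
    refine (hduh_int x t ht htT).congr_fun (fun z hz => ?_)
      (MeasurableSet.univ.prod measurableSet_Ioo)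
    have h1 := hFgrad z.1 z.2 hz.2.1 ((ENNReal.ofReal_le_ofReal hz.2.2.le).trans_lt htT)
    simp only [smul_eq_mul]
    rw [← h1, mul_comm]
  · intro x t ht htT
    have h1 := hduh_int x t ht htT
    rw [IntegrableOn, restrict_univ_prod] at h1
    have h2 : duh (heatKernel d) F x t = ∫ s in Ioo 0 t, ∫ y, F (y, s) *
        heatKernel d (x - y) (t - s) := by
      rw [duh, restrict_univ_prod, integral_prod_symm _ h1]
      rfl
    simp only [hu]
    rw [h2]
    congr 1
    · simp only [mul_comm]
    · refine setIntegral_congr_fun measurableSet_Ioo fun s hs => ?_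
      congr 1; ext y
      rw [hFgrad y s hs.1 ((ENNReal.ofReal_le_ofReal hs.2.le).trans_lt htT), mul_comm]
  · rw [← ofReal_norm, hgradn x t ht htT, ofReal_norm]
    exact hVW (x, t) ⟨ht, htT⟩

end Existence

/-! ### Estimates of Duhamel integrals of majorants -/

lemma rpow_sub_le_half_rpow {κ s t : ℝ} (hκ : 0 ≤ κ) (ht : 0 < t) (hs : s ≤ t / 2) :
    (t - s) ^ (-κ) ≤ (t / 2) ^ (-κ) :=
  Real.rpow_le_rpow_of_nonpos (by linarith) (by linarith) (by linarith)

/-- Splitting at t/2 leaves one singular factor at a time: before t/2 the power of t - s is bounded,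
after it h is. -/
lemma lintegral_sub_rpow_mul_le {κ t : ℝ} (hκ0 : 0 ≤ κ) (hκ : κ < 1) (ht : 0 < t)
    {h : ℝ → ℝ≥0∞} (hh : Measurable h) {M : ℝ≥0∞} (hM : ∀ s, t / 2 ≤ s → s < t → h s ≤ M) :
    ∫⁻ s in Ioo 0 t, ENNReal.ofReal ((t - s) ^ (-κ)) * h s ≤
      ENNReal.ofReal ((t / 2) ^ (-κ)) * (∫⁻ s in Ioo 0 t, h s) +
        ENNReal.ofReal (t ^ (1 - κ) / (1 - κ)) * M := by
  calc ∫⁻ s in Ioo 0 t, ENNReal.ofReal ((t - s) ^ (-κ)) * h s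
      ≤ ∫⁻ s in Ioo 0 t, (ENNReal.ofReal ((t / 2) ^ (-κ)) * h s +
          ENNReal.ofReal ((t - s) ^ (-κ)) * M) := by
        refine setLIntegral_mono' measurableSet_Ioo fun s hs => ?_
        rcases le_total s (t / 2) with h1 | h1
        · exact le_add_right (mul_le_mul_left (ENNReal.ofReal_le_ofReal
            (rpow_sub_le_half_rpow hκ0 ht h1)) _)
        · refine le_add_left ?_
          gcongr
          exact hM s h1 hs.2
    _ = _ := by
        have h0 : Measurable fun s : ℝ => ENNReal.ofReal ((t - s) ^ (-κ)) := by fun_prop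
        rw [lintegral_add_left (hh.const_mul _), lintegral_const_mul _ hh,
          lintegral_mul_const _ h0, lintegral_sub_rpow_Ioo hκ ht.le, sub_zero]

/-- The constant in the Beta-type integral `lintegral_beta_le`. -/
def betaC (κ l : ℝ) : ℝ := 2 ^ κ / (1 - l) + 2 ^ l / (1 - κ)

lemma betaC_pos {κ l : ℝ} (hκ : κ < 1) (hl : l < 1) : 0 < betaC κ l := by
  have h1 : 0 < 1 - κ := by linarith
  have h2 : 0 < 1 - l := by linarith
  unfold betaC; positivity

lemma half_rpow_neg {t κ : ℝ} (ht : 0 < t) : (t / 2) ^ (-κ) = 2 ^ κ * t ^ (-κ) := by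
  rw [Real.div_rpow ht.le (by norm_num), Real.rpow_neg (by norm_num : (0 : ℝ) ≤ 2), div_inv_eq_mul,
    mul_comm]

lemma lintegral_beta_le {κ l t : ℝ} (hκ0 : 0 ≤ κ) (hκ : κ < 1) (hl0 : 0 ≤ l) (hl : l < 1)
    (ht : 0 < t) :
    ∫⁻ s in Ioo 0 t, ENNReal.ofReal ((t - s) ^ (-κ)) * ENNReal.ofReal (s ^ (-l)) ≤
      ENNReal.ofReal (betaC κ l * t ^ (1 - κ - l)) := by
  have h1 := lintegral_sub_rpow_mul_le hκ0 hκ ht (h := fun s => ENNReal.ofReal (s ^ (-l)))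
    (by fun_prop) (M := ENNReal.ofReal ((t / 2) ^ (-l))) (fun s hs _ =>
      ENNReal.ofReal_le_ofReal (Real.rpow_le_rpow_of_nonpos (by linarith) hs (by linarith)))
  refine h1.trans (le_of_eq ?_)
  have e1 : 0 < 1 - κ := by linarith
  have e2 : 0 < 1 - l := by linarith
  rw [lintegral_rpow_Ioo hl ht.le, ← ENNReal.ofReal_mul (by positivity),
    ← ENNReal.ofReal_mul (by positivity), ← ENNReal.ofReal_add (by positivity) (by positivity)]
  congr 1
  rw [half_rpow_neg ht, half_rpow_neg ht, betaC]
  have e3 : t ^ (1 - κ - l) = t ^ (-κ) * t ^ (1 - l) := by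
    rw [← Real.rpow_add ht]; congr 1; ring
  have e4 : t ^ (1 - κ - l) = t ^ (1 - κ) * t ^ (-l) := by
    rw [← Real.rpow_add ht]; congr 1
  rw [add_mul]
  nth_rewrite 1 [e3]
  rw [e4]
  ring

/-- The composition estimate for potentials, with radii (t-s)^(1/d) and s^(1/d), removes the space
variable. The result is proportional to the potential at time t, so a majorant built from potentials
can reproduce itself. -/
lemma duhMaj_le_pot {d κ p : ℝ} (hd : 1 < d) {W : Sp N → ℝ → ℝ≥0∞} {f : Sp N → ℝ≥0∞}
    (hf : AEMeasurable f) {c : ℝ → ℝ≥0∞} {t : ℝ} (hc : Measurable c)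
    (hW : ∀ s, 0 < s → s < t → ∀ y, W y s ^ p ≤ c s * pot (s ^ (1 / d)) f y) (x : Sp N) :
    duhMaj d κ p W x t ≤ (∫⁻ s in Ioo 0 t, ENNReal.ofReal ((t - s) ^ (-κ)) * c s) *
      (ENNReal.ofReal (2 ^ (N + 2) * majMass N) * pot (t ^ (1 / d)) f x) := by
  rw [duhMaj, ← lintegral_mul_const]
  swap
  · exact Measurable.mul (by fun_prop) hc
  refine setLIntegral_mono' measurableSet_Ioo fun s hs => ?_
  have hs1 : 0 < t - s := by linarith [hs.2]
  have hs0 : 0 < s := hs.1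
  have ht : 0 < t := hs.1.trans hs.2
  have hd0 : 0 < 1 / d := by positivity
  have hd1 : 1 / d ≤ 1 := by rw [div_le_one (by linarith)]; exact hd.le
  have hpp := pot_pot_le (a := (t - s) ^ (1 / d)) (b := s ^ (1 / d)) (τ := t ^ (1 / d))
    (by positivity) (by positivity)
    (Real.rpow_le_rpow hs1.le (by linarith) hd0.le) (Real.rpow_le_rpow hs0.le hs.2.le hd0.le)
    (by
      have := Real.rpow_add_le_add_rpow hs1.le hs0.le hd0.le hd1
      simpa using this) hf x
  calc ∫⁻ y, ENNReal.ofReal (wker d κ (t - s) (x - y)) * W y s ^ p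
      ≤ ∫⁻ y, ENNReal.ofReal ((t - s) ^ (-κ)) * ENNReal.ofReal (majKer ((t - s) ^ (1 / d)) (x - y))
          * (c s * pot (s ^ (1 / d)) f y) := by
        refine lintegral_mono fun y => ?_
        rw [wker, ENNReal.ofReal_mul (by positivity)]
        gcongr
        exact hW s hs0 hs.2 y
    _ = (ENNReal.ofReal ((t - s) ^ (-κ)) * c s) *
          pot ((t - s) ^ (1 / d)) (pot (s ^ (1 / d)) f) x := by
        rw [pot, ← lintegral_const_mul'']
        · congr 1; ext y; ring
        · refine AEMeasurable.mul ?_ ?_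
          · have := continuous_majKer (N := N) (τ := (t - s) ^ (1 / d)) (by positivity)
            fun_prop
          · have hk := continuous_majKer (N := N) (τ := s ^ (1 / d)) (by positivity)
            have h2 : AEMeasurable (fun q : Sp N × Sp N =>
              ENNReal.ofReal (majKer (s ^ (1 / d)) (q.1 - q.2)) * f q.2) (volume.prod volume) :=
              AEMeasurable.mul (by fun_prop) hf.comp_snd
            exact h2.lintegral_prod_right'
    _ ≤ _ := by gcongr

/-- The case of `duhMaj_le_pot` in which the coefficient is a power of time. -/
lemma duhMaj_le_pot_rpow {d κ p l b : ℝ} (hd : 1 < d) (hκ0 : 0 ≤ κ) (hκ1 : κ < 1) (hl0 : 0 ≤ l)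
    (hl1 : l < 1) (hb : 0 ≤ b) {W : Sp N → ℝ → ℝ≥0∞} {f : Sp N → ℝ≥0∞}
    (hf : AEMeasurable f) {t : ℝ} (ht : 0 < t)
    (hW : ∀ s, 0 < s → s < t → ∀ y, W y s ^ p ≤
      ENNReal.ofReal (b * s ^ (-l)) * pot (s ^ (1 / d)) f y) (x : Sp N) :
    duhMaj d κ p W x t ≤
      ENNReal.ofReal (b * betaC κ l * (2 ^ (N + 2) * majMass N) * t ^ (1 - κ - l)) *
        pot (t ^ (1 / d)) f x := by
  refine (duhMaj_le_pot hd hf (c := fun s => ENNReal.ofReal (b * s ^ (-l))) (by fun_prop)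
    hW x).trans ?_
  have h1 : ∫⁻ s in Ioo 0 t, ENNReal.ofReal ((t - s) ^ (-κ)) * ENNReal.ofReal (b * s ^ (-l)) ≤
      ENNReal.ofReal b * ENNReal.ofReal (betaC κ l * t ^ (1 - κ - l)) := by
    refine le_trans (le_of_eq ?_)
      (mul_le_mul_right (lintegral_beta_le hκ0 hκ1 hl0 hl1 ht) (ENNReal.ofReal b))
    rw [← lintegral_const_mul' _ _ ENNReal.ofReal_ne_top]
    congr 1; ext s
    rw [ENNReal.ofReal_mul hb]
    ring
  refine (mul_le_mul_left h1 _).trans (le_of_eq ?_)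
  have := betaC_pos hκ1 hl1
  have := majMass_pos (N := N)
  rw [← mul_assoc, ← ENNReal.ofReal_mul hb, ← ENNReal.ofReal_mul (by positivity)]
  congr 2
  ring

/-- The version for bounds uniform in space, where only the total mass of the kernel enters. -/
lemma duhMaj_le_const {d κ p : ℝ} {W : Sp N → ℝ → ℝ≥0∞}
    {c : ℝ → ℝ≥0∞} {t : ℝ} (hc : Measurable c)
    (hW : ∀ s, 0 < s → s < t → ∀ y, W y s ^ p ≤ c s) (x : Sp N) :
    duhMaj d κ p W x t ≤ (∫⁻ s in Ioo 0 t, ENNReal.ofReal ((t - s) ^ (-κ)) * c s) *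
      ENNReal.ofReal (majMass N) := by
  rw [duhMaj, ← lintegral_mul_const]
  swap
  · exact Measurable.mul (by fun_prop) hc
  refine setLIntegral_mono' measurableSet_Ioo fun s hs => ?_
  have hs1 : 0 < t - s := by linarith [hs.2]
  calc ∫⁻ y, ENNReal.ofReal (wker d κ (t - s) (x - y)) * W y s ^ p
      ≤ ∫⁻ y, ENNReal.ofReal (wker d κ (t - s) (x - y)) * c s := by
        refine lintegral_mono fun y => ?_
        gcongr
        exact hW s hs.1 hs.2 y
    _ = _ := by
        rw [lintegral_mul_const, lintegral_wker hs1]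
        · ring
        · exact ((measurable_wker (N := N) (d := d) (κ := κ)).comp
            (by fun_prop : Measurable fun y : Sp N => (x - y, t - s))).ennreal_ofReal

/-- The constant in `pot_le_rpow`. -/
def potC (N : ℕ) : ℝ := 2 ^ (N + 1) * majMass N / (volume (ball (0 : Sp N) 1)).toReal

lemma potC_pos : 0 < potC N := by
  have h1 := majMass_pos (N := N)
  have h2 : 0 < (volume (ball (0 : Sp N) 1)).toReal :=
    ENNReal.toReal_pos (measure_ball_pos _ _ one_pos).ne' measure_ball_lt_top.ne
  unfold potC; positivity

lemma volume_ball_eq {r : ℝ} (hr : 0 < r) (x : Sp N) :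
    volume (ball x r) = ENNReal.ofReal (r ^ (N : ℝ)) * volume (ball (0 : Sp N) 1) := by
  rw [Measure.addHaar_ball_of_pos _ _ hr, finrank_euclideanSpace, Fintype.card_fin, Real.rpow_natCast]

lemma pot_le_rpow {τ r : ℝ} (hr : 0 < r) (hrτ : r ≤ τ) {f : Sp N → ℝ≥0∞}
    (hf : AEMeasurable f) {S : ℝ} (hS : ∀ z, ∫⁻ y in ball z r, f y ≤ ENNReal.ofReal S)
    (x : Sp N) : pot τ f x ≤ ENNReal.ofReal (potC N * (S * r ^ (-(N : ℝ)))) := by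
  refine (pot_le_of_ball hr hrτ hf hS x).trans (le_of_eq ?_)
  have h1 := majMass_pos (N := N)
  have hv0 := (measure_ball_pos volume (0 : Sp N) one_pos).ne'
  have hvt := (measure_ball_lt_top (μ := volume) (x := (0 : Sp N)) (r := 1)).ne
  have h2 : 0 < (volume (ball (0 : Sp N) 1)).toReal := ENNReal.toReal_pos hv0 hvt
  have h3 : volume (ball (0 : Sp N) r) =
      ENNReal.ofReal (r ^ (N : ℝ) * (volume (ball (0 : Sp N) 1)).toReal) := by
    rw [volume_ball_eq hr, ENNReal.ofReal_mul (by positivity), ENNReal.ofReal_toReal hvt]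
  rw [h3, ← ENNReal.ofReal_div_of_pos (by positivity), ← ENNReal.ofReal_mul (by positivity), potC,
    Real.rpow_neg hr.le]
  congr 1
  field_simp

/-- Linearisation: all but one power of a potential is replaced by a supremum bound, and the
remaining first power is what `duhMaj_le_pot` accepts. -/
lemma ennreal_rpow_le {P : ℝ≥0∞} {b q : ℝ} (hb : 0 ≤ b) (hP : P ≤ ENNReal.ofReal b)
    (hq : 1 ≤ q) : P ^ q ≤ ENNReal.ofReal (b ^ (q - 1)) * P := by
  have h : P ^ q = P ^ (q - 1) * P := by
    conv_rhs => rw [← ENNReal.rpow_one P, ← ENNReal.rpow_mul, one_mul,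
      ← ENNReal.rpow_add_of_nonneg _ _ (by linarith) (by norm_num), sub_add_cancel]
  rw [h, ← ENNReal.ofReal_rpow_of_nonneg hb (by linarith)]
  gcongr

lemma ofReal_mul_rpow {P : ℝ≥0∞} {a p : ℝ} (ha : 0 ≤ a) (hp : 0 ≤ p) :
    (ENNReal.ofReal a * P) ^ p = ENNReal.ofReal (a ^ p) * P ^ p := by
  rw [ENNReal.mul_rpow_of_nonneg _ _ hp, ENNReal.ofReal_rpow_of_nonneg ha hp]

lemma enorm_initial_le {d C κ : ℝ} {E : Type*} [NormedAddCommGroup E] [NormedSpace ℝ E]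
    {H : Sp N → ℝ → E} (hH : KerBound d κ C H) (φ : Sp N → ℝ) {x : Sp N} {t : ℝ} (ht : 0 < t) :
    ‖∫ y, φ y • H (x - y) t‖ₑ ≤
      ENNReal.ofReal C * (ENNReal.ofReal (t ^ (-κ)) * pot (t ^ (1 / d)) (fun y => ‖φ y‖ₑ) x) := by
  have h1 := hH.enorm_integral_le (μ := volume) (Y := id) (S := fun _ : Sp N => (0 : ℝ))
      (F := φ) (t := t) (Filter.Eventually.of_forall fun _ => ht) x
  rw [wInt_initial ht] at h1
  simpa only [sub_zero, id] using h1

/-- The potentials of a uniformly locally integrable function are bounded away from `t = 0`. -/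
lemma pot_bdd_of_uloc {d : ℝ} (hd : 1 < d) {f : Sp N → ℝ≥0∞} (hf : AEMeasurable f) {r₀ S : ℝ}
    (hr₀ : 0 < r₀) (hS : ∀ z r, 0 < r → r ≤ r₀ → ∫⁻ y in ball z r, f y ≤ ENNReal.ofReal S)
    {τ : ℝ} (hτ : 0 < τ) :
    ∃ M : ℝ≥0∞, M ≠ ⊤ ∧ ∀ (x : Sp N) (t : ℝ), τ < t → pot (t ^ (1 / d)) f x ≤ M := by
  have hτd : 0 < τ ^ (1 / d) := by positivity
  refine ⟨ENNReal.ofReal (potC N * (S * (min r₀ (τ ^ (1 / d))) ^ (-(N : ℝ)))),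
    ENNReal.ofReal_ne_top, fun x t ht => ?_⟩
  refine pot_le_rpow (lt_min hr₀ hτd) ((min_le_right _ _).trans ?_) hf
    (fun z => hS z _ (lt_min hr₀ hτd) (min_le_left _ _)) x
  gcongr

lemma MemLuloc.exists_lintegral_le {φ : Sp N → ℝ} (hφ : MemLuloc 1 φ) :
    ∃ S : ℝ, 0 < S ∧ ∀ (z : Sp N) (r : ℝ), 0 < r → r ≤ 1 →
      ∫⁻ y in ball z r, ‖φ y‖ₑ ≤ ENNReal.ofReal S := by
  obtain ⟨-, h⟩ := hφ
  refine ⟨(⨆ x : Sp N, eLpNorm φ 1 (volume.restrict (ball x 1))).toReal + 1, by positivity,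
    fun z r _ hr => ?_⟩
  rw [ENNReal.ofReal_add ENNReal.toReal_nonneg zero_le_one, ENNReal.ofReal_toReal h.ne]
  refine le_add_right ?_
  refine le_trans ?_ (le_iSup (fun x : Sp N => eLpNorm φ 1 (volume.restrict (ball x 1))) z)
  simp only [eLpNorm_one_eq_lintegral_enorm]
  exact lintegral_mono_set (ball_subset_ball hr)

/-! ### Subcritical exponents -/

lemma lt_pHJ_iff {d p : ℝ} : p < pHJ N d ↔ p + N * (p - 1) < d := by
  rw [pHJ, lt_div_iff₀ (by positivity)]
  constructor <;> intro h <;> linarith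

/-- For times up to 1 the potential of |φ| is at most a multiple of s^(-N/d), so W^p is at most b
s^(-l) times the potential, with l = (p + N(p-1))/d. Subcriticality is l < 1; the Duhamel term then
carries T^(1-l), which is small for small T. -/
theorem hasLocalSolution_of_lt_pHJ (hN : 1 ≤ N) {d p : ℝ} (hd : 1 < d) (hp : 1 < p)
    (hpp : p < pHJ N d) {φ : Sp N → ℝ} (hφ : MemLuloc 1 φ) : HasLocalSolution d p φ := by
  obtain ⟨η, hη, _, _, hsol⟩ := exists_isSolution_of_isMajorant hN hd hp
  obtain ⟨A, hA, -, hH⟩ := exists_kerBound_heatKernel hN hd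
  obtain ⟨S, hS, hSb⟩ := hφ.exists_lintegral_le
  have hd0 : 0 < d := by linarith
  have hp1 : 0 < p - 1 := by linarith
  have hdi : 1 / d < 1 := by rw [div_lt_one hd0]; exact hd
  have hf : AEMeasurable (fun y => ‖φ y‖ₑ) := hφ.1.enorm
  have hm := majMass_pos (N := N)
  have hK := potC_pos (N := N)
  set l : ℝ := (p + N * (p - 1)) / d with hl
  have hl0 : 0 ≤ l := by positivity
  have hl1 : l < 1 := by rw [hl, div_lt_one hd0]; exact lt_pHJ_iff.1 hpp
  set b : ℝ := A ^ p * (potC N * S) ^ (p - 1) with hb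
  have hb0 : 0 < b := by positivity
  set D : ℝ := 2 ^ (N + 2) * majMass N with hD
  have hD0 : 0 < D := by positivity
  have hB := betaC_pos hdi hl1
  have hB0 := betaC_pos zero_lt_one hl1
  -- the length of the time interval
  obtain ⟨T, hT0, hT1, hTη⟩ : ∃ T : ℝ, 0 < T ∧ T ≤ 1 ∧
      b * betaC (1 / d) l * D / A * T ^ (1 - l) ≤ η := by
    have h1 : Filter.Tendsto (fun T : ℝ => b * betaC (1 / d) l * D / A * T ^ (1 - l))
        (nhdsWithin 0 (Ioi 0)) (nhds 0) := by
      have h2 : ContinuousAt (fun T : ℝ => b * betaC (1 / d) l * D / A * T ^ (1 - l)) 0 :=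
        continuousAt_const.mul (Real.continuousAt_rpow_const _ _ (Or.inr (by linarith)))
      have h3 := h2.tendsto
      rw [Real.zero_rpow (by linarith), mul_zero] at h3
      exact h3.mono_left nhdsWithin_le_nhds
    obtain ⟨T, h2, h3⟩ := ((h1.eventually (Iic_mem_nhds hη)).and
      (Ioc_mem_nhdsGT (zero_lt_one' ℝ))).exists
    exact ⟨T, h3.1, h3.2, h2⟩
  set W : Sp N → ℝ → ℝ≥0∞ := fun x t =>
    ENNReal.ofReal (A * t ^ (-(1 / d))) * pot (t ^ (1 / d)) (fun y => ‖φ y‖ₑ) x with hW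
  have hrange : ∀ t, ENNReal.ofReal t < ENNReal.ofReal T → t < T := fun t ht =>
    (ENNReal.ofReal_lt_ofReal_iff hT0).1 ht
  have hpot : ∀ x t, 0 < t → t < T → pot (t ^ (1 / d)) (fun y => ‖φ y‖ₑ) x ≤
      ENNReal.ofReal (potC N * S * t ^ (-(N / d))) := by
    intro x t ht htT
    have h1 : t ^ (1 / d) ≤ 1 := Real.rpow_le_one ht.le (by linarith) (by positivity)
    refine (pot_le_rpow (by positivity) le_rfl hf (fun z => hSb z _ (by positivity) h1) x).trans
      (le_of_eq ?_)
    rw [← Real.rpow_mul ht.le]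
    congr 1
    rw [show 1 / d * -(N : ℝ) = -(N / d) by ring]
    ring
  have hWp : ∀ s, 0 < s → s < T → ∀ y, W y s ^ p ≤ ENNReal.ofReal (b * s ^ (-l)) *
      pot (s ^ (1 / d)) (fun y => ‖φ y‖ₑ) y := by
    intro s hs hsT y
    rw [hW, ofReal_mul_rpow (by positivity) (by linarith)]
    refine (mul_le_mul_right (ennreal_rpow_le (by positivity) (hpot y s hs hsT) hp.le) _).trans
      (le_of_eq ?_)
    rw [← mul_assoc, ← ENNReal.ofReal_mul (by positivity)]
    congr 2
    rw [Real.mul_rpow hA.le (by positivity), Real.mul_rpow (by positivity) (by positivity),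
      ← Real.rpow_mul hs.le, ← Real.rpow_mul hs.le, hb]
    have : s ^ (-l) = s ^ (-(1 / d) * p) * s ^ (-(N / d) * (p - 1)) := by
      rw [← Real.rpow_add hs, hl]
      congr 1
      field_simp
      ring
    rw [this]
    ring
  have hduh : ∀ κ, 0 ≤ κ → κ < 1 → ∀ x t, 0 < t → t < T → duhMaj d κ p W x t ≤
      ENNReal.ofReal (b * betaC κ l * D * t ^ (1 - κ - l)) *
        pot (t ^ (1 / d)) (fun y => ‖φ y‖ₑ) x := by
    intro κ hκ0 hκ1 x t ht htT
    exact duhMaj_le_pot_rpow hd hκ0 hκ1 hl0 hl1 hb0.le hf ht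
      (fun s hs hst y => hWp s hs (hst.trans htT) y) x
  have hbdd : ∀ τ : ℝ, 0 < τ → ∃ M : ℝ≥0∞, M ≠ ⊤ ∧ ∀ (x : Sp N) (t : ℝ), τ < t →
      pot (t ^ (1 / d)) (fun y => ‖φ y‖ₑ) x ≤ M := fun τ hτ =>
    pot_bdd_of_uloc hd hf one_pos hSb hτ
  obtain ⟨u, hu, -⟩ := hsol (ENNReal.ofReal T) φ W
    { meas := hφ.1
      pot_bdd := fun τ hτ => by
        obtain ⟨M, hM, h⟩ := hbdd τ hτ
        exact ⟨M, hM, fun x t ht _ => h x t ht⟩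
      initial := fun x t ht htT => by
        refine (enorm_initial_le hH φ ht).trans (le_of_eq ?_)
        simp only [hW]
        rw [ENNReal.ofReal_mul hA.le, mul_assoc]
      bdd := fun τ hτ => by
        obtain ⟨M, hM, h⟩ := hbdd τ hτ
        refine ⟨ENNReal.ofReal (A * τ ^ (-(1 / d))) * M,
          ENNReal.mul_ne_top ENNReal.ofReal_ne_top hM, fun x t ht _ => ?_⟩
        refine mul_le_mul' (ENNReal.ofReal_le_ofReal ?_) (h x t ht)
        have := Real.rpow_le_rpow_of_nonpos hτ ht.le (z := -(1 / d)) (by simp; positivity)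
        gcongr
      small := fun x t ht htT => by
        have htT' := hrange t htT
        refine (hduh (1 / d) (by positivity) hdi x t ht htT').trans ?_
        refine le_of_le_of_eq ?_ (mul_assoc _ _ _)
        rw [← ENNReal.ofReal_mul hη.le]
        refine mul_le_mul_left (ENNReal.ofReal_le_ofReal ?_) _
        have h1 : t ^ (1 - 1 / d - l) = t ^ (1 - l) * t ^ (-(1 / d)) := by
          rw [← Real.rpow_add ht]; congr 1; ring
        have h2 : t ^ (1 - l) ≤ T ^ (1 - l) :=
          Real.rpow_le_rpow ht.le htT'.le (by linarith)
        calc b * betaC (1 / d) l * D * t ^ (1 - 1 / d - l)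
            = (b * betaC (1 / d) l * D / A * t ^ (1 - l)) * (A * t ^ (-(1 / d))) := by
              rw [h1]; field_simp
          _ ≤ (b * betaC (1 / d) l * D / A * T ^ (1 - l)) * (A * t ^ (-(1 / d))) := by gcongr
          _ ≤ η * (A * t ^ (-(1 / d))) := by gcongr
      duh_bdd := fun τ hτ => by
        obtain ⟨M, hM, h⟩ := hbdd τ hτ
        refine ⟨ENNReal.ofReal (b * betaC 0 l * D * 1) * M,
          ENNReal.mul_ne_top ENNReal.ofReal_ne_top hM, fun x t ht htT => ?_⟩
        have htT' := hrange t htT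
        refine (hduh 0 le_rfl zero_lt_one x t (hτ.trans ht) htT').trans ?_
        refine mul_le_mul' (ENNReal.ofReal_le_ofReal ?_) (h x t ht)
        have := Real.rpow_le_one (hτ.trans ht).le (htT'.le.trans hT1)
          (show 0 ≤ 1 - 0 - l by linarith)
        gcongr }
  exact ⟨T, hT0, u, hu⟩

/-! ### Supercritical exponents: initial data in Morrey spaces -/

lemma ofReal_rpow_lt {T : ℝ≥0∞} {t c : ℝ} (hc : 0 < c) (ht : 0 < t) (htT : ENNReal.ofReal t < T) :
    ENNReal.ofReal (t ^ c) < T ^ c := by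
  rw [← ENNReal.ofReal_rpow_of_pos ht]
  exact ENNReal.rpow_lt_rpow htT hc

/-- Jensen's inequality on each ball lowers the exponent from q to r. -/
lemma lintegral_le_of_localMorrey {F : Type*} [NormedAddCommGroup F] {d a q r ε : ℝ} {T : ℝ≥0∞}
    {f : Sp N → F} (hf : AEStronglyMeasurable f volume) (hr : 0 < r) (hrq : r ≤ q) (hε : 0 ≤ ε)
    (h : localMorrey d a q T f ≤ ENNReal.ofReal ε) {σ : ℝ} (hσ : 0 < σ)
    (hσT : ENNReal.ofReal σ < T ^ (1 / d)) (z : Sp N) :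
    ∫⁻ y in ball z σ, ‖f y‖ₑ ^ r ≤
      ENNReal.ofReal ((volume (ball (0 : Sp N) 1)).toReal * (ε * σ ^ (-a)) ^ r * σ ^ (N : ℝ)) := by
  have h1 : ENNReal.ofReal (σ ^ a) * (⨍⁻ y in ball z σ, ‖f y‖ₑ ^ q ∂volume) ^ (1 / q) ≤
      ENNReal.ofReal ε := by
    refine le_trans (le_iSup_of_le z (le_iSup_of_le σ ?_)) h
    rw [iSup_pos ⟨hσ, hσT⟩]
  have hv0 : volume (ball z σ) ≠ 0 := (measure_ball_pos volume z hσ).ne'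
  have hvt : volume (ball z σ) ≠ ⊤ := measure_ball_lt_top.ne
  set μ := volume.restrict (ball z σ) with hμ
  have hμu : μ univ = volume (ball z σ) := by simp [hμ]
  -- With the normalised measure the comparison of L^r and L^q norms has no volume factor.
  have : IsProbabilityMeasure ((μ univ)⁻¹ • μ) :=
    ⟨by rw [Measure.smul_apply, hμu, smul_eq_mul, ENNReal.inv_mul_cancel hv0 hvt]⟩
  have h2 : (⨍⁻ y in ball z σ, ‖f y‖ₑ ^ r ∂volume) ^ (1 / r) ≤
      (⨍⁻ y in ball z σ, ‖f y‖ₑ ^ q ∂volume) ^ (1 / q) := by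
    have := eLpNorm'_le_eLpNorm'_of_exponent_le (f := f) (μ := (μ univ)⁻¹ • μ) hr hrq
      (hf.restrict.smul_measure _)
    simpa only [eLpNorm', laverage] using this
  have h3 : (⨍⁻ y in ball z σ, ‖f y‖ₑ ^ r ∂volume) ^ (1 / r) ≤ ENNReal.ofReal (ε * σ ^ (-a)) := by
    refine h2.trans ?_
    calc (⨍⁻ y in ball z σ, ‖f y‖ₑ ^ q ∂volume) ^ (1 / q)
        = ENNReal.ofReal (σ ^ (-a)) * (ENNReal.ofReal (σ ^ a) *
          (⨍⁻ y in ball z σ, ‖f y‖ₑ ^ q ∂volume) ^ (1 / q)) := by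
          rw [← mul_assoc, ← ENNReal.ofReal_mul (by positivity), ← Real.rpow_add hσ]
          simp
      _ ≤ ENNReal.ofReal (σ ^ (-a)) * ENNReal.ofReal ε := by gcongr
      _ = _ := by rw [← ENNReal.ofReal_mul (by positivity), mul_comm]
  have h4 : ⨍⁻ y in ball z σ, ‖f y‖ₑ ^ r ∂volume ≤ ENNReal.ofReal ((ε * σ ^ (-a)) ^ r) := by
    rw [← ENNReal.ofReal_rpow_of_nonneg (by positivity) hr.le]
    rwa [one_div, ENNReal.rpow_inv_le_iff hr] at h3
  rw [setLAverage_eq, ENNReal.div_le_iff hv0 hvt] at h4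
  refine h4.trans (le_of_eq ?_)
  rw [volume_ball_eq hσ, ENNReal.ofReal_mul (by positivity), ENNReal.ofReal_mul (by positivity),
    ENNReal.ofReal_toReal measure_ball_lt_top.ne]
  ring

/-- The constant in `pot_le_of_localMorrey`. -/
def morC (N : ℕ) : ℝ := potC N * (volume (ball (0 : Sp N) 1)).toReal

lemma morC_pos : 0 < morC N := by
  have h2 : 0 < (volume (ball (0 : Sp N) 1)).toReal :=
    ENNReal.toReal_pos (measure_ball_pos _ _ one_pos).ne' measure_ball_lt_top.ne
  have := potC_pos (N := N)
  unfold morC; positivity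

lemma pot_le_of_localMorrey {F : Type*} [NormedAddCommGroup F] {d a q r ε : ℝ} {T : ℝ≥0∞}
    {f : Sp N → F} (hd : 0 < d) (hf : AEStronglyMeasurable f volume) (hr : 0 < r) (hrq : r ≤ q)
    (hε : 0 ≤ ε) (h : localMorrey d a q T f ≤ ENNReal.ofReal ε) {t : ℝ} (ht : 0 < t)
    (htT : ENNReal.ofReal t < T) (x : Sp N) :
    pot (t ^ (1 / d)) (fun y => ‖f y‖ₑ ^ r) x ≤
      ENNReal.ofReal (morC N * (ε * t ^ (-(a / d))) ^ r) := by
  refine (pot_le_rpow (by positivity) le_rfl (hf.enorm.pow_const r)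
    (lintegral_le_of_localMorrey hf hr hrq hε h (by positivity)
      (ofReal_rpow_lt (by positivity) ht htT)) x).trans (le_of_eq ?_)
  congr 1
  rw [morC, Real.rpow_neg (by positivity) (N : ℝ), ← Real.rpow_mul ht.le (1 / d) (-a)]
  have : (0 : ℝ) < (t ^ (1 / d)) ^ (N : ℝ) := by positivity
  rw [show 1 / d * -a = -(a / d) by ring]
  field_simp

/-- Jensen's inequality for the kernel `majKer`. -/
lemma pot_le_pot_rpow {τ r : ℝ} (hτ : 0 < τ) (hr : 1 ≤ r) {f : Sp N → ℝ≥0∞} (hf : AEMeasurable f)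
    (x : Sp N) : pot τ f x ≤
      ENNReal.ofReal (majMass N ^ (1 - 1 / r)) * pot τ (fun y => f y ^ r) x ^ (1 / r) := by
  have hr0 : 0 < r := by linarith
  have h1 : 0 ≤ 1 - 1 / r := by
    rw [sub_nonneg, div_le_one hr0]; exact hr
  have hk : Continuous fun y : Sp N => majKer τ (x - y) := by
    have := continuous_majKer (N := N) hτ
    fun_prop
  have hm : AEMeasurable fun y : Sp N => ENNReal.ofReal (majKer τ (x - y)) :=
    hk.measurable.ennreal_ofReal.aemeasurable
  have h2 := ENNReal.lintegral_mul_norm_pow_le (μ := (volume : Measure (Sp N)))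
    (f := fun y => ENNReal.ofReal (majKer τ (x - y)))
    (g := fun y => ENNReal.ofReal (majKer τ (x - y)) * f y ^ r)
    hm (hm.mul (hf.pow_const r)) h1
    (by positivity : 0 ≤ 1 / r) (by ring)
  have h3 : ∫⁻ y : Sp N, ENNReal.ofReal (majKer τ (x - y)) = ENNReal.ofReal (majMass N) :=
    lintegral_majKer_sub hτ x
  rw [h3, ENNReal.ofReal_rpow_of_pos majMass_pos] at h2
  refine le_trans (le_of_eq ?_) h2
  rw [pot]
  congr 1; ext y
  rw [ENNReal.mul_rpow_of_nonneg _ _ (by positivity), ← ENNReal.rpow_mul, mul_one_div_cancel hr0.ne',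
    ENNReal.rpow_one, ← mul_assoc, ← ENNReal.rpow_add_of_nonneg _ _ h1 (by positivity)]
  simp

lemma exists_rpow_le {c η e : ℝ} (hη : 0 < η) (he : 0 < e) (hc : 0 < c) :
    ∃ ε : ℝ, 0 < ε ∧ c * ε ^ e ≤ η := by
  refine ⟨(η / c) ^ (1 / e), by positivity, ?_⟩
  rw [← Real.rpow_mul (by positivity), one_div_mul_cancel he.ne', Real.rpow_one]
  exact (mul_div_cancel₀ _ hc.ne').le

/-- Write f = |φ|^r, b = (d-p)/(p-1). The power p/r of the potential of f is linearised, which costs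
s^(-l) with dl = p + b(p-r) < p + b(p-1) = d, because r > 1. Afterwards the potential is written as
the r-th power of its r-th root and r - 1 of these powers are bounded. In total ε^(p-1) is gained
and the powers of t cancel, so T may be infinite. -/
theorem exists_isSolution_of_localMorrey (hN : 1 ≤ N) {d p : ℝ} (hd : 1 < d) (hp : 1 < p)
    (hpd : p < d) {q : ℝ} (hq : 1 < q) :
    ∃ C₂ : ℝ, 0 < C₂ ∧ ∀ (T : ℝ≥0∞) (φ : Sp N → ℝ), LocallyIntegrable φ volume →
        localMorrey d ((d - p) / (p - 1)) q T φ ≤ ENNReal.ofReal C₂ →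
        ∃ u : Sp N → ℝ → ℝ, IsSolution d p φ T u := by
  obtain ⟨η, hη, _, _, hsol⟩ := exists_isSolution_of_isMajorant hN hd hp
  obtain ⟨A₀, hA₀, -, hH⟩ := exists_kerBound_heatKernel hN hd
  have hd0 : 0 < d := by linarith
  have hp1 : 0 < p - 1 := by linarith
  have hp0 : 0 < p := by linarith
  have hdi : 1 / d < 1 := by rw [div_lt_one hd0]; exact hd
  have hm := majMass_pos (N := N)
  have hK := morC_pos (N := N)
  set K := morC N
  -- r ≤ q is needed to use the Morrey condition, r ≤ p to have p/r ≥ 1, and r > 1 to have l < 1.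
  set r : ℝ := min q p with hr
  have hr1 : 1 < r := lt_min hq hp
  have hr0 : 0 < r := by linarith
  have hrq : r ≤ q := min_le_left _ _
  have hrp : r ≤ p := min_le_right _ _
  set b : ℝ := (d - p) / (p - 1) with hb
  have hb0 : 0 < b := div_pos (by linarith) hp1
  have hbp : b * (p - 1) = d - p := div_mul_cancel₀ _ hp1.ne'
  set l : ℝ := (p + b * (p - r)) / d with hl
  have hpr : 0 ≤ p - r := by linarith
  have hl0 : 0 ≤ l := by positivity
  have hl1 : l < 1 := by
    rw [hl, div_lt_one hd0]
    nlinarith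
  set A : ℝ := A₀ * majMass N ^ (1 - 1 / r) with hA
  have hA0 : 0 < A := by positivity
  set D : ℝ := 2 ^ (N + 2) * majMass N with hD
  have hD0 : 0 < D := by positivity
  have hB := betaC_pos hdi hl1
  have hB0 := betaC_pos zero_lt_one hl1
  obtain ⟨ε, hε, hεη⟩ := exists_rpow_le (e := p - 1) hη hp1
    (c := A ^ (p - 1) * K ^ (p / r - 1) * betaC (1 / d) l * D * K ^ (1 - 1 / r)) (by positivity)
  refine ⟨ε, hε, fun T φ hφ hM => ?_⟩
  have hφm := hφ.aestronglyMeasurable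
  let f : Sp N → ℝ≥0∞ := fun y => ‖φ y‖ₑ ^ r
  have hfm : AEMeasurable f := hφm.enorm.pow_const r
  have hQ : ∀ x t, 0 < t → ENNReal.ofReal t < T →
      pot (t ^ (1 / d)) f x ≤ ENNReal.ofReal (K * (ε * t ^ (-(b / d))) ^ r) := fun x t ht htT =>
    pot_le_of_localMorrey hd0 hφm hr0 hrq hε.le hM ht htT x
  have hQr : ∀ x t, 0 < t → ENNReal.ofReal t < T → pot (t ^ (1 / d)) f x ^ (1 / r) ≤
      ENNReal.ofReal (K ^ (1 / r) * ε * t ^ (-(b / d))) := fun x t ht htT => by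
    refine (ENNReal.rpow_le_rpow (hQ x t ht htT) (by positivity)).trans (le_of_eq ?_)
    rw [ENNReal.ofReal_rpow_of_pos (by positivity), Real.mul_rpow hK.le (by positivity),
      ← Real.rpow_mul (by positivity), mul_one_div_cancel hr0.ne', Real.rpow_one, mul_assoc]
  set W : Sp N → ℝ → ℝ≥0∞ := fun x t =>
    ENNReal.ofReal (A * t ^ (-(1 / d))) * pot (t ^ (1 / d)) f x ^ (1 / r) with hW
  set B : ℝ := A ^ p * K ^ (p / r - 1) * ε ^ (p - r) with hBd
  have hB1 : 0 < B := by positivity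
  have hWp : ∀ s, 0 < s → ENNReal.ofReal s < T → ∀ y, W y s ^ p ≤
      ENNReal.ofReal (B * s ^ (-l)) * pot (s ^ (1 / d)) f y := by
    intro s hs hsT y
    rw [hW, ofReal_mul_rpow (by positivity) hp0.le, ← ENNReal.rpow_mul,
      show 1 / r * p = p / r by ring]
    refine (mul_le_mul_right (ennreal_rpow_le (by positivity) (hQ y s hs hsT)
      ((one_le_div hr0).2 hrp)) _).trans (le_of_eq ?_)
    rw [← mul_assoc, ← ENNReal.ofReal_mul (by positivity)]
    congr 2
    rw [Real.mul_rpow hA0.le (by positivity), Real.mul_rpow hK.le (by positivity),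
      ← Real.rpow_mul (x := ε * s ^ (-(b / d))) (by positivity), show r * (p / r - 1) = p - r by field_simp,
      Real.mul_rpow hε.le (by positivity), ← Real.rpow_mul hs.le, ← Real.rpow_mul hs.le, hBd]
    have : s ^ (-l) = s ^ (-(1 / d) * p) * s ^ (-(b / d) * (p - r)) := by
      rw [← Real.rpow_add hs, hl]
      congr 1
      field_simp
      ring
    rw [this]
    ring
  have hduh : ∀ κ, 0 ≤ κ → κ < 1 → ∀ x t, 0 < t → ENNReal.ofReal t < T → duhMaj d κ p W x t ≤
      ENNReal.ofReal (B * betaC κ l * D * t ^ (1 - κ - l)) * pot (t ^ (1 / d)) f x := by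
    intro κ hκ0 hκ1 x t ht htT
    exact duhMaj_le_pot_rpow hd hκ0 hκ1 hl0 hl1 hB1.le hfm ht
      (fun s hs hst y => hWp s hs ((ENNReal.ofReal_le_ofReal hst.le).trans_lt htT) y) x
  have hpφ : ∀ x t, 0 < t → pot (t ^ (1 / d)) (fun y => ‖φ y‖ₑ) x ≤
      ENNReal.ofReal (majMass N ^ (1 - 1 / r)) * pot (t ^ (1 / d)) f x ^ (1 / r) := fun x t ht =>
    pot_le_pot_rpow (by positivity) hr1.le hφm.enorm x
  have hmono : ∀ {τ t e : ℝ}, 0 < τ → τ < t → 0 ≤ e → t ^ (-e) ≤ τ ^ (-e) := fun hτ ht he =>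
    Real.rpow_le_rpow_of_nonpos hτ ht.le (by linarith)
  have hbd : 0 ≤ b / d := by positivity
  obtain ⟨u, hu, -⟩ := hsol T φ W
    { meas := hφm
      pot_bdd := fun τ hτ => by
        refine ⟨ENNReal.ofReal (majMass N ^ (1 - 1 / r)) *
          ENNReal.ofReal (K ^ (1 / r) * ε * τ ^ (-(b / d))),
          ENNReal.mul_ne_top ENNReal.ofReal_ne_top ENNReal.ofReal_ne_top, fun x t ht htT => ?_⟩
        refine (hpφ x t (hτ.trans ht)).trans
          (mul_le_mul_right ((hQr x t (hτ.trans ht) htT).trans (ENNReal.ofReal_le_ofReal ?_)) _)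
        have := hmono hτ ht hbd
        gcongr
      initial := fun x t ht htT => by
        refine (enorm_initial_le hH φ ht).trans ((mul_le_mul_right (mul_le_mul_right
          (hpφ x t ht) _) _).trans (le_of_eq ?_))
        rw [← mul_assoc, ← mul_assoc, ← ENNReal.ofReal_mul hA₀.le,
          ← ENNReal.ofReal_mul (by positivity)]
        simp only [hW, hA]
        congr 2
        ring
      bdd := fun τ hτ => by
        refine ⟨ENNReal.ofReal (A * τ ^ (-(1 / d))) *
          ENNReal.ofReal (K ^ (1 / r) * ε * τ ^ (-(b / d))),
          ENNReal.mul_ne_top ENNReal.ofReal_ne_top ENNReal.ofReal_ne_top, fun x t ht htT => ?_⟩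
        have h1 := hmono hτ ht hbd
        have h2 := hmono hτ ht (e := 1 / d) (by positivity)
        refine mul_le_mul' (ENNReal.ofReal_le_ofReal (by gcongr))
          ((hQr x t (hτ.trans ht) htT).trans (ENNReal.ofReal_le_ofReal (by gcongr)))
      small := fun x t ht htT => by
        refine (hduh (1 / d) (by positivity) hdi x t ht htT).trans ?_
        have h1 : pot (t ^ (1 / d)) f x = (pot (t ^ (1 / d)) f x ^ (1 / r)) ^ r := by
          rw [← ENNReal.rpow_mul, one_div_mul_cancel hr0.ne', ENNReal.rpow_one]
        have h2 := ennreal_rpow_le (by positivity) (hQr x t ht htT) hr1.le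
        rw [← h1] at h2
        refine (mul_le_mul_right h2 _).trans ?_
        refine le_of_le_of_eq ?_ (mul_assoc _ _ _)
        rw [← mul_assoc, ← ENNReal.ofReal_mul (by positivity), ← ENNReal.ofReal_mul hη.le]
        refine mul_le_mul_left (ENNReal.ofReal_le_ofReal ?_) _
        rw [Real.mul_rpow (by positivity) (by positivity), Real.mul_rpow (by positivity) hε.le,
          ← Real.rpow_mul ht.le, ← Real.rpow_mul hK.le,
          show 1 / r * (r - 1) = 1 - 1 / r by field_simp, hBd]
        have e1 : A ^ p = A ^ (p - 1) * A := by
          rw [← Real.rpow_add_one hA0.ne', sub_add_cancel]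
        have e2 : ε ^ (p - 1) = ε ^ (p - r) * ε ^ (r - 1) := by
          rw [← Real.rpow_add hε]; congr 1; ring
        -- Scale invariance: b(p-1) = d - p makes the exponents agree exactly.
        have e3 : t ^ (-(1 / d)) = t ^ (1 - 1 / d - l) * t ^ (-(b / d) * (r - 1)) := by
          rw [← Real.rpow_add ht, hl]
          congr 1
          field_simp
          linarith
        calc _ = (A ^ (p - 1) * K ^ (p / r - 1) * betaC (1 / d) l * D * K ^ (1 - 1 / r)
              * ε ^ (p - 1)) * (A * t ^ (-(1 / d))) := by
              rw [e1, e2, e3]; ring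
          _ ≤ η * (A * t ^ (-(1 / d))) := by gcongr
      duh_bdd := fun τ hτ => by
        refine ⟨ENNReal.ofReal (B * betaC 0 l * D * (K * ε ^ r) * τ ^ (-(b / d))),
          ENNReal.ofReal_ne_top, fun x t ht htT => ?_⟩
        have ht0 := hτ.trans ht
        refine (hduh 0 le_rfl zero_lt_one x t ht0 htT).trans
          ((mul_le_mul_right (hQ x t ht0 htT) _).trans ?_)
        rw [← ENNReal.ofReal_mul (by positivity)]
        refine ENNReal.ofReal_le_ofReal ?_
        have h1 := hmono hτ ht hbd
        have e3 : t ^ (-(b / d)) = t ^ (1 - 0 - l) * t ^ (-(b / d) * r) := by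
          rw [← Real.rpow_add ht0, hl]
          congr 1
          field_simp
          linarith
        calc _ = B * betaC 0 l * D * (K * ε ^ r) * t ^ (-(b / d)) := by
              rw [Real.mul_rpow hε.le (by positivity), ← Real.rpow_mul ht0.le, e3]; ring
          _ ≤ _ := by gcongr }
  exact ⟨u, hu⟩

/-! ### Initial data with a weak gradient -/

lemma IsWeakGradient.integral_mul_fderiv {φ : Sp N → ℝ} {g : Sp N → Sp N}
    (h : IsWeakGradient φ g) {η : Sp N → ℝ} (hη : ContDiff ℝ ∞ η) (hc : HasCompactSupport η)
    (v : Sp N) : ∫ y, φ y * fderiv ℝ η y v = -∫ y, η y * inner ℝ v (g y) := by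
  obtain ⟨h1, h2, h3⟩ := h
  have hg : Continuous (gradient η) :=
    (InnerProductSpace.toDual ℝ (Sp N)).symm.continuous.comp (hη.continuous_fderiv (by simp))
  have hgc : HasCompactSupport (gradient η) :=
    (hc.fderiv (𝕜 := ℝ)).comp_left (g := (InnerProductSpace.toDual ℝ (Sp N)).symm) (by simp)
  have i1 : Integrable fun y => φ y • gradient η y :=
    h1.integrable_smul_right_of_hasCompactSupport hg hgc
  have i2 : Integrable fun y => η y • g y :=
    h2.integrable_smul_left_of_hasCompactSupport hη.continuous hc
  have e1 := integral_inner (𝕜 := ℝ) i1 v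
  have e2 := integral_inner (𝕜 := ℝ) i2 v
  rw [h3 η hη hc, inner_neg_right, ← e2] at e1
  simp only [real_inner_smul_right] at e1
  rw [← e1]
  congr 1; ext y
  rw [real_inner_comm, gradient, InnerProductSpace.toDual_symm_apply]

/-- Integration by parts against a smooth function without compact support. -/
lemma IsWeakGradient.integral_mul_fderiv_of_integrable {φ : Sp N → ℝ} {g : Sp N → Sp N}
    (h : IsWeakGradient φ g) {k : Sp N → ℝ} (hk : ContDiff ℝ ∞ k) (v : Sp N)
    (i0 : Integrable fun y => φ y * k y) (i1 : Integrable fun y => φ y * fderiv ℝ k y v)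
    (i2 : Integrable fun y => k y * inner ℝ v (g y)) :
    ∫ y, φ y * fderiv ℝ k y v = -∫ y, k y * inner ℝ v (g y) := by
  let χ : ContDiffBump (0 : Sp N) := ⟨1, 2, one_pos, one_lt_two⟩
  have hχ : ContDiff ℝ ∞ χ := χ.contDiff
  have hχd : Differentiable ℝ χ := hχ.differentiable (by simp)
  have hkd : Differentiable ℝ k := hk.differentiable (by simp)
  obtain ⟨B, hB⟩ : ∃ B, ∀ y, ‖fderiv ℝ χ y‖ ≤ B :=
    (χ.hasCompactSupport.fderiv (𝕜 := ℝ)).exists_bound_of_continuous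
      (hχ.continuous_fderiv (by simp))
  have hB0 : 0 ≤ B := (norm_nonneg _).trans (hB 0)
  -- The cut-offs χ(y/(n+1)) tend to 1, and their gradients, of size 1/(n+1), multiply the
  -- integrable function φk and disappear in the limit.
  let c : ℕ → ℝ := fun n => ((n : ℝ) + 1)⁻¹
  have hc0 : ∀ n, 0 < c n := fun n => by positivity
  have hc1 : ∀ n, c n ≤ 1 := fun n => inv_le_one_of_one_le₀ (by linarith [n.cast_nonneg (α := ℝ)])
  have hcl : Filter.Tendsto c Filter.atTop (nhds 0) := by
    simpa [c, one_div] using tendsto_one_div_add_atTop_nhds_zero_nat (𝕜 := ℝ)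
  have hcy : ∀ y : Sp N, ∀ᶠ n in Filter.atTop, χ (c n • y) = 1 := by
    intro y
    have : Filter.Tendsto (fun n => ‖c n • y‖) Filter.atTop (nhds 0) := by
      have := (hcl.smul_const y).norm
      simpa using this
    filter_upwards [this (Iio_mem_nhds one_pos)] with n hn
    exact χ.one_of_mem_closedBall (by simpa [χ] using le_of_lt hn)
  have hder : ∀ n y, fderiv ℝ (fun y => χ (c n • y) * k y) y v =
      χ (c n • y) * fderiv ℝ k y v + c n * fderiv ℝ χ (c n • y) v * k y := by
    intro n y
    have e1 : HasFDerivAt (fun y => χ (c n • y)) (c n • fderiv ℝ χ (c n • y)) y := by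
      have := (hχd (c n • y)).hasFDerivAt.comp y ((hasFDerivAt_id y).const_smul (c n))
      refine this.congr_fderiv ?_
      ext w; simp
    rw [fderiv_fun_mul e1.differentiableAt (hkd y), e1.fderiv]
    simp [mul_comm]
  have key : ∀ n, ∫ y, φ y * (χ (c n • y) * fderiv ℝ k y v + c n * fderiv ℝ χ (c n • y) v * k y) =
      -∫ y, χ (c n • y) * k y * inner ℝ v (g y) := by
    intro n
    have hs : ContDiff ℝ ∞ fun y => χ (c n • y) * k y :=
      (hχ.comp (contDiff_const_smul (c n))).mul hk
    have hsc : HasCompactSupport fun y => χ (c n • y) * k y := by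
      have : HasCompactSupport fun y => χ (c n • y) :=
        χ.hasCompactSupport.comp_smul (hc0 n).ne'
      exact this.mul_right
    rw [← h.integral_mul_fderiv hs hsc v]
    simp only [hder]
  have hφm := h.1.aestronglyMeasurable
  have hgm := h.2.1.aestronglyMeasurable
  have hχb : ∀ n y, |χ (c n • y)| ≤ 1 := fun n y => by
    rw [abs_of_nonneg χ.nonneg]; exact χ.le_one
  have hχn : ∀ n, Continuous fun y => χ (c n • y) := fun n => χ.continuous.comp (by fun_prop)
  have hfχ : ∀ n, Continuous fun y => fderiv ℝ χ (c n • y) v := fun n => by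
    have := (hχ.continuous_fderiv (by simp)).comp (continuous_const_smul (c n) : Continuous
      fun y : Sp N => c n • y)
    exact this.clm_apply continuous_const
  have hfk : Continuous fun y => fderiv ℝ k y v :=
    (hk.continuous_fderiv (by simp)).clm_apply continuous_const
  have t1 : Filter.Tendsto (fun n => ∫ y, φ y * (χ (c n • y) * fderiv ℝ k y v +
      c n * fderiv ℝ χ (c n • y) v * k y)) Filter.atTop
      (nhds (∫ y, φ y * fderiv ℝ k y v)) := by
    refine tendsto_integral_of_dominated_convergence
      (fun y => ‖φ y * fderiv ℝ k y v‖ + B * ‖v‖ * ‖φ y * k y‖) (fun n => ?_)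
      (i1.norm.add (i0.norm.const_mul _)) (fun n => Filter.Eventually.of_forall fun y => ?_)
      (Filter.Eventually.of_forall fun y => ?_)
    · refine hφm.mul (Continuous.aestronglyMeasurable ?_)
      exact ((hχn n).mul hfk).add ((continuous_const.mul (hfχ n)).mul hk.continuous)
    · have b1 : ‖fderiv ℝ χ (c n • y) v‖ ≤ B * ‖v‖ :=
        (ContinuousLinearMap.le_opNorm _ _).trans (by gcongr; exact hB _)
      calc ‖φ y * (χ (c n • y) * fderiv ℝ k y v + c n * fderiv ℝ χ (c n • y) v * k y)‖
          = ‖χ (c n • y) * (φ y * fderiv ℝ k y v) +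
              c n * (fderiv ℝ χ (c n • y) v * (φ y * k y))‖ := by congr 1; ring
        _ ≤ |χ (c n • y)| * ‖φ y * fderiv ℝ k y v‖ +
              |c n| * (‖fderiv ℝ χ (c n • y) v‖ * ‖φ y * k y‖) := by
            refine (norm_add_le _ _).trans ?_
            rw [norm_mul (χ (c n • y)), norm_mul (c n), norm_mul (fderiv ℝ χ (c n • y) v),
              Real.norm_eq_abs (χ (c n • y)), Real.norm_eq_abs (c n)]
        _ ≤ 1 * ‖φ y * fderiv ℝ k y v‖ + 1 * (B * ‖v‖ * ‖φ y * k y‖) := by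
            rw [abs_of_pos (hc0 n)]
            gcongr
            exacts [hχb n y, hc1 n]
        _ = _ := by ring
    · have l1 : Filter.Tendsto (fun n => c n * fderiv ℝ χ (c n • y) v) Filter.atTop (nhds 0) := by
        refine squeeze_zero_norm (a := fun n => c n * (B * ‖v‖)) (fun n => ?_) (by
          simpa using hcl.mul_const (B * ‖v‖))
        rw [norm_mul, Real.norm_of_nonneg (hc0 n).le]
        have := hc0 n
        gcongr
        exact (ContinuousLinearMap.le_opNorm _ _).trans (by gcongr; exact hB _)
      have l2 : Filter.Tendsto (fun n => χ (c n • y)) Filter.atTop (nhds 1) :=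
        (Filter.tendsto_congr' (hcy y)).2 tendsto_const_nhds
      have := ((l2.mul_const (fderiv ℝ k y v)).add (l1.mul_const (k y))).const_mul (φ y)
      simpa using this
  have t2 : Filter.Tendsto (fun n => ∫ y, χ (c n • y) * k y * inner ℝ v (g y)) Filter.atTop
      (nhds (∫ y, k y * inner ℝ v (g y))) := by
    refine tendsto_integral_of_dominated_convergence
      (fun y => ‖k y * inner ℝ v (g y)‖) (fun n => ?_)
      i2.norm (fun n => Filter.Eventually.of_forall fun y => ?_)
      (Filter.Eventually.of_forall fun y => ?_)
    · exact (((hχn n).mul hk.continuous).aestronglyMeasurable).mul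
        (aestronglyMeasurable_const.inner hgm)
    · rw [mul_assoc, norm_mul, Real.norm_eq_abs]
      exact mul_le_of_le_one_left (norm_nonneg _) (hχb n y)
    · refine (Filter.tendsto_congr' ?_).2 tendsto_const_nhds
      filter_upwards [hcy y] with n hn
      rw [hn, one_mul]
  exact tendsto_nhds_unique t1 (by simpa only [key] using t2.neg)

/-- Integration by parts moves the derivative from the kernel to φ, which saves the factor t^(-1/d).
-/
lemma IsWeakGradient.enorm_initial_le (hN : 1 ≤ N) {d C : ℝ} (hd : 1 < d)
    (hG : KerBound d 0 C (heatKernel d : Sp N → ℝ → ℝ))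
    (hH : KerBound d (1 / d) C (heatDer d : Sp N → ℝ → (Sp N →L[ℝ] ℝ)))
    {φ : Sp N → ℝ} {g : Sp N → Sp N} (h : IsWeakGradient φ g) {x : Sp N} {t : ℝ} (ht : 0 < t)
    (hφt : pot (t ^ (1 / d)) (fun y => ‖φ y‖ₑ) x ≠ ⊤)
    (hgt : pot (t ^ (1 / d)) (fun y => ‖g y‖ₑ) x ≠ ⊤) :
    ‖∫ y, φ y • heatDer d (x - y) t‖ₑ ≤
      ENNReal.ofReal C * pot (t ^ (1 / d)) (fun y => ‖g y‖ₑ) x := by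
  have hφm := h.1.aestronglyMeasurable
  have hgm := h.2.1.aestronglyMeasurable
  have hev : ∀ᵐ _ : Sp N, (0 : ℝ) < t := Filter.Eventually.of_forall fun _ => ht
  have j0 : Integrable fun y => φ y • heatKernel d (x - y) t := by
    have := hG.integrable (μ := volume) (Y := id) (S := fun _ : Sp N => (0 : ℝ)) measurable_id
      measurable_const hφm hev x
      (by rw [wInt_initial ht]; exact ENNReal.mul_ne_top ENNReal.ofReal_ne_top hφt)
    simpa using this
  have j1 : Integrable fun y => φ y • heatDer d (x - y) t := by
    have := hH.integrable (μ := volume) (Y := id) (S := fun _ : Sp N => (0 : ℝ)) measurable_id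
      measurable_const hφm hev x
      (by rw [wInt_initial ht]; exact ENNReal.mul_ne_top ENNReal.ofReal_ne_top hφt)
    simpa using this
  have j2 : Integrable fun y => ‖g y‖ * heatKernel d (x - y) t := by
    have := hG.integrable (μ := volume) (Y := id) (S := fun _ : Sp N => (0 : ℝ)) measurable_id
      measurable_const hgm.norm hev x
      (by
        rw [wInt_initial ht]; simp only [enorm_norm]
        exact ENNReal.mul_ne_top ENNReal.ofReal_ne_top hgt)
    simpa using this
  have hk : ContDiff ℝ ∞ fun y : Sp N => heatKernel d (x - y) t :=
    (contDiff_heatKernel hN hd ht).comp (contDiff_const.sub contDiff_id)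
  have hkd : ∀ y v, fderiv ℝ (fun y : Sp N => heatKernel d (x - y) t) y v =
      -heatDer d (x - y) t v := fun y v => by
    have := (hasFDerivAt_heatKernel hN hd ht (x - y)).comp y ((hasFDerivAt_id y).const_sub x)
    have e : fderiv ℝ (fun y : Sp N => heatKernel d (x - y) t) y = _ := this.fderiv
    rw [e]; simp
  have hin : ∀ v, Integrable fun y => heatKernel d (x - y) t * inner ℝ v (g y) := fun v => by
    refine (j2.norm.const_mul ‖v‖).mono'
      (hk.continuous.aestronglyMeasurable.mul (aestronglyMeasurable_const.inner hgm))
      (Filter.Eventually.of_forall fun y => ?_)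
    rw [norm_mul, norm_mul, norm_norm]
    calc ‖heatKernel d (x - y) t‖ * ‖inner ℝ v (g y)‖
        ≤ ‖heatKernel d (x - y) t‖ * (‖v‖ * ‖g y‖) := by gcongr; exact norm_inner_le_norm _ _
      _ = _ := by ring
  have key : ∀ v, (∫ y, φ y • heatDer d (x - y) t) v =
      ∫ y, heatKernel d (x - y) t * inner ℝ v (g y) := fun v => by
    have i1 : Integrable fun y => φ y * heatDer d (x - y) t v := by
      simpa using (ContinuousLinearMap.apply ℝ ℝ v).integrable_comp j1
    have e := h.integral_mul_fderiv_of_integrable hk v (by simpa using j0)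
      (by simp only [hkd, mul_neg]; exact i1.neg) (hin v)
    simp only [hkd, mul_neg, integral_neg, neg_inj] at e
    rw [ContinuousLinearMap.integral_apply j1, ← e]
    simp
  have hI : ‖∫ y, φ y • heatDer d (x - y) t‖ ≤ ∫ y, ‖‖g y‖ * heatKernel d (x - y) t‖ := by
    refine ContinuousLinearMap.opNorm_le_bound _ (integral_nonneg fun _ => norm_nonneg _)
      fun v => ?_
    rw [key, ← integral_mul_const]
    refine norm_integral_le_of_norm_le (j2.norm.mul_const _)
      (Filter.Eventually.of_forall fun y => ?_)
    rw [norm_mul, norm_mul, norm_norm]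
    calc ‖heatKernel d (x - y) t‖ * ‖inner ℝ v (g y)‖
        ≤ ‖heatKernel d (x - y) t‖ * (‖v‖ * ‖g y‖) := by gcongr; exact norm_inner_le_norm _ _
      _ = _ := by ring
  calc ‖∫ y, φ y • heatDer d (x - y) t‖ₑ
      ≤ ENNReal.ofReal (∫ y, ‖‖g y‖ * heatKernel d (x - y) t‖) := by
        rw [← ofReal_norm]; exact ENNReal.ofReal_le_ofReal hI
    _ = ∫⁻ y, ‖‖g y‖ * heatKernel d (x - y) t‖ₑ := ofReal_integral_norm_eq_lintegral_enorm j2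
    _ ≤ ENNReal.ofReal C * pot (t ^ (1 / d)) (fun y => ‖g y‖ₑ) x := by
        rw [pot, ← lintegral_const_mul' _ _ ENNReal.ofReal_ne_top]
        refine lintegral_mono fun y => ?_
        have hb := hG.bound (x - y) t ht
        have hm := majKer_pos (τ := t ^ (1 / d)) (by positivity) (x - y)
        simp only [wker, neg_zero, Real.rpow_zero, one_mul] at hb
        rw [enorm_mul, enorm_norm, ← mul_assoc, ← ENNReal.ofReal_mul' hm.le, mul_comm]
        gcongr
        rw [← ofReal_norm]
        exact ENNReal.ofReal_le_ofReal hb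

lemma rpow_neg_le_rpow_neg {τ t e : ℝ} (hτ : 0 < τ) (ht : τ < t) (he : 0 ≤ e) :
    t ^ (-e) ≤ τ ^ (-e) :=
  Real.rpow_le_rpow_of_nonpos hτ ht.le (by linarith)

/-- A function bounded by `s^{-α}` near zero and by `s^{-β}` near infinity has finite integral. -/
lemma lintegral_min_rpow_ne_top {α β c₁ c₂ : ℝ} (hα : α < 1) (hβ : 1 < β) (hc₁ : 0 ≤ c₁) :
    ∫⁻ s in Ioi (0 : ℝ), min (ENNReal.ofReal (c₁ * s ^ (-α))) (ENNReal.ofReal (c₂ * s ^ (-β))) ≠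
      ⊤ := by
  rw [← Ioc_union_Ioi_eq_Ioi zero_le_one]
  refine ne_top_of_le_ne_top ?_ (lintegral_union_le _ _ _)
  refine ENNReal.add_ne_top.2 ⟨?_, ?_⟩
  · refine ne_top_of_le_ne_top ?_ (lintegral_mono fun s => min_le_left _ _)
    have h : ∫⁻ s in Ioc (0 : ℝ) 1, ENNReal.ofReal (c₁ * s ^ (-α)) =
        ∫⁻ s in Ioo (0 : ℝ) 1, ENNReal.ofReal (c₁ * s ^ (-α)) :=
      setLIntegral_congr Ioo_ae_eq_Ioc.symm
    rw [h]
    simp_rw [ENNReal.ofReal_mul hc₁]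
    rw [lintegral_const_mul' _ _ ENNReal.ofReal_ne_top, lintegral_rpow_Ioo hα zero_le_one]
    exact ENNReal.mul_ne_top ENNReal.ofReal_ne_top ENNReal.ofReal_ne_top
  · refine ne_top_of_le_ne_top ?_ (lintegral_mono fun s => min_le_right _ _)
    have h := ((integrableOn_Ioi_rpow_of_lt (a := -β) (by linarith) one_pos).const_mul c₂).2
    rw [hasFiniteIntegral_iff_enorm] at h
    refine ne_top_of_le_ne_top h.ne (lintegral_mono fun s => ?_)
    exact Real.ofReal_le_enorm _

/-- The exponent of the cap t^(-θ) used when p > d. With a = (d-1)/(p-1): θ > a/d makes the cap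
weaker than t^(-a/d) for t ≤ 1, θ < 1/d makes it weaker than t^(-1/d) for t ≥ 1, and θp > 1 makes
its p-th power integrable at infinity. -/
lemma exists_exponent {d p : ℝ} (hd : 1 < d) (hp : 1 < p) :
    ∃ θ : ℝ, 0 < θ ∧ θ < 1 / d ∧ (d < p → (d - 1) / (p - 1) / d < θ ∧ 1 / p < θ) := by
  have hd0 : 0 < d := by linarith
  rcases le_or_gt p d with h | h
  · exact ⟨1 / d / 2, by positivity, half_lt_self (by positivity), fun h' => by linarith⟩
  · have hp1 : 0 < p - 1 := by linarith
    have h1 : (d - 1) / (p - 1) / d < 1 / d := by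
      gcongr
      rw [div_lt_one hp1]; linarith
    have h2 : 1 / p < 1 / d := by gcongr
    obtain ⟨θ, h3, h4⟩ := exists_between (max_lt h1 h2)
    have h5 := (le_max_right _ _).trans_lt h3
    exact ⟨θ, lt_trans (by positivity) h5, h4, fun _ => ⟨(le_max_left _ _).trans_lt h3, h5⟩⟩

/-- The bound W₁ ≤ AKε t^(-a/d) satisfies (a/d)(p-1) = l = 1 - 1/d, so the Duhamel term for the
gradient keeps the size of W₁ and gains ε^(p-1). The Duhamel term for u itself is of order
t^((1-a)/d), bounded away from zero only if a ≥ 1, that is p ≤ d. For p > d the extra decay of the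
linear term due to φ ∈ L¹_uloc supplies the cap M t^(-θ). -/
theorem exists_isSolution_of_isWeakGradient (hN : 1 ≤ N) {d p : ℝ} (hd : 1 < d) (hp : 1 < p) :
    ∃ C₃ : ℝ, 0 < C₃ ∧ ∀ (T : ℝ≥0∞) (φ : Sp N → ℝ) (g : Sp N → Sp N),
        MemLuloc 1 φ → IsWeakGradient φ g →
        localMorrey d ((d - 1) / (p - 1)) 1 T g ≤ ENNReal.ofReal C₃ →
        ∃ u : Sp N → ℝ → ℝ, IsSolution d p φ T u := by
  obtain ⟨η, hη, _, _, hsol⟩ := exists_isSolution_of_isMajorant hN hd hp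
  obtain ⟨A, hA, hG, hH⟩ := exists_kerBound_heatKernel hN hd
  obtain ⟨θ, hθ0, hθd, hθ⟩ := exists_exponent hd hp
  have hd0 : 0 < d := by linarith
  have hp1 : 0 < p - 1 := by linarith
  have hp0 : 0 < p := by linarith
  have hdi : 1 / d < 1 := by rw [div_lt_one hd0]; exact hd
  have hdi0 : 0 < 1 / d := by positivity
  have hm := majMass_pos (N := N)
  have hK := morC_pos (N := N)
  set K := morC N
  set a : ℝ := (d - 1) / (p - 1) with ha
  have ha0 : 0 < a := div_pos (by linarith) hp1
  have hap : a * (p - 1) = d - 1 := div_mul_cancel₀ _ hp1.ne'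
  set l : ℝ := 1 - 1 / d with hl
  have hl0 : 0 ≤ l := by linarith
  have hl1 : l < 1 := by linarith
  have hlθ0 : 0 ≤ l + θ := by linarith
  have hlθ1 : l + θ < 1 := by linarith
  have hap' : a / d * (p - 1) = l := by
    rw [div_mul_eq_mul_div, hap, hl]; field_simp
  set D : ℝ := 2 ^ (N + 2) * majMass N with hD
  have hD0 : 0 < D := by positivity
  have hB := betaC_pos hdi hl1
  have hB0 := betaC_pos zero_lt_one hl1
  have hBθ := betaC_pos hdi hlθ1
  -- The sum of the two constants lets one ε give smallness both against W₁ and against the cap.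
  obtain ⟨ε, hε, hεη⟩ := exists_rpow_le (e := p - 1) hη hp1
    (c := (A * K) ^ (p - 1) * betaC (1 / d) l * D +
      (A * K) ^ (p - 1) * betaC (1 / d) (l + θ) * majMass N) (by positivity)
  have hε1 : (A * K * ε) ^ (p - 1) * betaC (1 / d) l * D ≤ η := by
    refine le_trans ?_ hεη
    rw [add_mul, Real.mul_rpow (by positivity) hε.le]
    have : 0 ≤ (A * K) ^ (p - 1) * betaC (1 / d) (l + θ) * majMass N * ε ^ (p - 1) := by positivity
    linarith
  have hε2 : (A * K * ε) ^ (p - 1) * betaC (1 / d) (l + θ) * majMass N ≤ η := by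
    refine le_trans ?_ hεη
    rw [add_mul, Real.mul_rpow (by positivity) hε.le]
    have : 0 ≤ (A * K) ^ (p - 1) * betaC (1 / d) l * D * ε ^ (p - 1) := by positivity
    linarith
  refine ⟨ε, hε, fun T φ g hφ hg hM => ?_⟩
  obtain ⟨S, hS, hSb⟩ := hφ.exists_lintegral_le
  have hφm : AEMeasurable fun y => ‖φ y‖ₑ := hφ.1.enorm
  have hgm := hg.2.1.aestronglyMeasurable
  let f : Sp N → ℝ≥0∞ := fun y => ‖g y‖ₑ
  have hfm : AEMeasurable f := hgm.enorm
  have hbdd : ∀ τ : ℝ, 0 < τ → ∃ M : ℝ≥0∞, M ≠ ⊤ ∧ ∀ (x : Sp N) (t : ℝ), τ < t →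
      pot (t ^ (1 / d)) (fun y => ‖φ y‖ₑ) x ≤ M := fun τ hτ =>
    pot_bdd_of_uloc hd hφm one_pos hSb hτ
  let W₁ : Sp N → ℝ → ℝ≥0∞ := fun x t => ENNReal.ofReal A * pot (t ^ (1 / d)) f x
  have hW₁ : ∀ x t, 0 < t → ENNReal.ofReal t < T →
      W₁ x t ≤ ENNReal.ofReal (A * K * ε * t ^ (-(a / d))) := fun x t ht htT => by
    have h := pot_le_of_localMorrey hd0 hgm one_pos le_rfl hε.le hM ht htT x
    simp only [ENNReal.rpow_one, Real.rpow_one] at h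
    refine (mul_le_mul_right h _).trans (le_of_eq ?_)
    rw [← ENNReal.ofReal_mul hA.le]
    congr 1; ring
  have hinit : ∀ x t, 0 < t → ENNReal.ofReal t < T →
      ‖∫ y, φ y • heatDer d (x - y) t‖ₑ ≤ W₁ x t := fun x t ht htT => by
    obtain ⟨M, hM', h⟩ := hbdd (t / 2) (by linarith)
    refine hg.enorm_initial_le hN hd hG hH ht (ne_top_of_le_ne_top hM' (h x t (by linarith))) ?_
    have h1 := ne_top_of_le_ne_top ENNReal.ofReal_ne_top (hW₁ x t ht htT)
    intro h2
    refine h1 ?_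
    simp only [W₁, f, h2]
    exact ENNReal.mul_top (by simpa using hA)
  have hW₁p : ∀ s, 0 < s → ENNReal.ofReal s < T → ∀ y, W₁ y s ^ (p - 1) ≤
      ENNReal.ofReal ((A * K * ε) ^ (p - 1) * s ^ (-l)) := fun s hs hsT y => by
    refine (ENNReal.rpow_le_rpow (hW₁ y s hs hsT) hp1.le).trans (le_of_eq ?_)
    rw [ENNReal.ofReal_rpow_of_pos (by positivity), Real.mul_rpow (by positivity) (by positivity),
      ← Real.rpow_mul hs.le, neg_mul, hap']
  have hpow : ∀ w : ℝ≥0∞, w ^ p = w ^ (p - 1) * w := fun w => by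
    conv_rhs => rw [← ENNReal.rpow_one w, ← ENNReal.rpow_mul, one_mul,
      ← ENNReal.rpow_add_of_nonneg _ _ hp1.le (by norm_num), sub_add_cancel]
  have hB1 : 0 < (A * K * ε) ^ (p - 1) * A := by positivity
  have hduh : ∀ κ, 0 ≤ κ → κ < 1 → ∀ W : Sp N → ℝ → ℝ≥0∞, (∀ x t, W x t ≤ W₁ x t) →
      ∀ x t, 0 < t → ENNReal.ofReal t < T → duhMaj d κ p W x t ≤
      ENNReal.ofReal ((A * K * ε) ^ (p - 1) * betaC κ l * D * t ^ (1 - κ - l)) * W₁ x t := by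
    intro κ hκ0 hκ1 W hW x t ht htT
    refine (duhMaj_le_pot_rpow hd hκ0 hκ1 hl0 hl1 hB1.le hfm ht (fun s hs hst y => ?_) x).trans
      (le_of_eq ?_)
    · refine (ENNReal.rpow_le_rpow (hW y s) hp0.le).trans ?_
      rw [hpow]
      refine (mul_le_mul_left (hW₁p s hs ((ENNReal.ofReal_le_ofReal hst.le).trans_lt htT) y)
        _).trans (le_of_eq ?_)
      simp only [W₁]
      rw [← mul_assoc, ← ENNReal.ofReal_mul (by positivity)]
      congr 2; ring
    · have := betaC_pos hκ1 hl1
      simp only [W₁]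
      refine Eq.trans ?_ (mul_assoc _ _ _)
      rw [← ENNReal.ofReal_mul (by positivity)]
      congr 2; ring
  have hsmall : ∀ W : Sp N → ℝ → ℝ≥0∞, (∀ x t, W x t ≤ W₁ x t) →
      ∀ x t, 0 < t → ENNReal.ofReal t < T →
        duhMaj d (1 / d) p W x t ≤ ENNReal.ofReal η * W₁ x t := by
    intro W hW x t ht htT
    refine (hduh (1 / d) hdi0.le hdi W hW x t ht htT).trans
      (mul_le_mul_left (ENNReal.ofReal_le_ofReal ?_) _)
    rw [show 1 - 1 / d - l = 0 by rw [hl]; ring, Real.rpow_zero, mul_one]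
    exact hε1
  have had : 0 ≤ a / d := by positivity
  have hWbdd : ∀ τ : ℝ, 0 < τ → ∃ M : ℝ≥0∞, M ≠ ⊤ ∧ ∀ (x : Sp N) (t : ℝ), τ < t →
      ENNReal.ofReal t < T → W₁ x t ≤ M := fun τ hτ => by
    refine ⟨ENNReal.ofReal (A * K * ε * τ ^ (-(a / d))), ENNReal.ofReal_ne_top,
      fun x t ht htT => (hW₁ x t (hτ.trans ht) htT).trans (ENNReal.ofReal_le_ofReal ?_)⟩
    have := rpow_neg_le_rpow_neg hτ ht had
    gcongr
  have hpotbdd : ∀ τ : ℝ, 0 < τ → ∃ M : ℝ≥0∞, M ≠ ⊤ ∧ ∀ (x : Sp N) (t : ℝ), τ < t →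
      ENNReal.ofReal t < T → pot (t ^ (1 / d)) (fun y => ‖φ y‖ₑ) x ≤ M := fun τ hτ => by
    obtain ⟨M, hM, h⟩ := hbdd τ hτ
    exact ⟨M, hM, fun x t ht _ => h x t ht⟩
  rcases le_or_gt p d with hpd | hpd
  · obtain ⟨u, hu, -⟩ := hsol T φ W₁
      { meas := hφ.1
        pot_bdd := hpotbdd
        initial := hinit
        bdd := hWbdd
        small := hsmall W₁ fun _ _ => le_rfl
        duh_bdd := fun τ hτ => by
          refine ⟨ENNReal.ofReal ((A * K * ε) ^ (p - 1) * betaC 0 l * D * (A * K * ε) *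
            τ ^ (-(a / d - 1 / d))), ENNReal.ofReal_ne_top, fun x t ht htT => ?_⟩
          have ht0 := hτ.trans ht
          refine (hduh 0 le_rfl zero_lt_one W₁ (fun _ _ => le_rfl) x t ht0 htT).trans
            ((mul_le_mul_right (hW₁ x t ht0 htT) _).trans ?_)
          rw [← ENNReal.ofReal_mul (by positivity)]
          refine ENNReal.ofReal_le_ofReal ?_
          have ha1 : 1 ≤ a := by rw [ha, one_le_div hp1]; linarith
          have h1 := rpow_neg_le_rpow_neg hτ ht (e := a / d - 1 / d) (by
            rw [← sub_div]; exact div_nonneg (by linarith) hd0.le)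
          have e : t ^ (-(a / d - 1 / d)) = t ^ (1 - 0 - l) * t ^ (-(a / d)) := by
            rw [← Real.rpow_add ht0, hl]; congr 1; ring
          calc _ = (A * K * ε) ^ (p - 1) * betaC 0 l * D * (A * K * ε) *
                t ^ (-(a / d - 1 / d)) := by rw [e]; ring
            _ ≤ _ := by gcongr }
    exact ⟨u, hu⟩
  · obtain ⟨hθa, hθp⟩ := hθ hpd
    have hθp1 : 1 < θ * p := by rwa [div_lt_iff₀ hp0] at hθp
    -- The bound holds for times strictly beyond its threshold; the threshold 1/2 makes it available
    -- for all t ≥ 1.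
    obtain ⟨M₀, hM₀, hM₀b⟩ := hbdd (1 / 2) (by norm_num)
    set M : ℝ := A * K * ε + A * M₀.toReal with hMdef
    have hM0 : 0 < M := by positivity
    let W : Sp N → ℝ → ℝ≥0∞ := fun x t => min (W₁ x t) (ENNReal.ofReal (M * t ^ (-θ)))
    have hWW : ∀ x t, W x t ≤ W₁ x t := fun x t => min_le_left _ _
    have hWV : ∀ x t, W x t ≤ ENNReal.ofReal (M * t ^ (-θ)) := fun x t => min_le_right _ _
    obtain ⟨u, hu, -⟩ := hsol T φ W
      { meas := hφ.1
        pot_bdd := hpotbdd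
        initial := fun x t ht htT => by
          refine le_min (hinit x t ht htT) ?_
          rcases le_total t 1 with h1 | h1
          · refine (hinit x t ht htT).trans ((hW₁ x t ht htT).trans (ENNReal.ofReal_le_ofReal ?_))
            have h2 : t ^ (-(a / d)) ≤ t ^ (-θ) :=
              Real.rpow_le_rpow_of_exponent_ge ht h1 (by linarith)
            have h3 : A * K * ε ≤ M := le_add_of_nonneg_right (by positivity)
            gcongr
          · refine (VHJ.enorm_initial_le hH φ ht).trans ((mul_le_mul_right (mul_le_mul_right
              (hM₀b x t (by linarith)) _) _).trans ?_)
            rw [← ENNReal.ofReal_toReal hM₀, ← ENNReal.ofReal_mul (by positivity),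
              ← ENNReal.ofReal_mul (by positivity)]
            refine ENNReal.ofReal_le_ofReal ?_
            have h2 : t ^ (-(1 / d)) ≤ t ^ (-θ) :=
              Real.rpow_le_rpow_of_exponent_le h1 (by linarith)
            calc A * (t ^ (-(1 / d)) * M₀.toReal) = (A * M₀.toReal) * t ^ (-(1 / d)) := by ring
              _ ≤ M * t ^ (-θ) := by
                  gcongr
                  rw [hMdef]
                  exact le_add_of_nonneg_left (by positivity)
        bdd := fun τ hτ => by
          obtain ⟨M', h1, h2⟩ := hWbdd τ hτ
          exact ⟨M', h1, fun x t ht htT => (hWW x t).trans (h2 x t ht htT)⟩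
        small := fun x t ht htT => by
          -- Each of the two competitors in the minimum is reproduced separately. For the cap, p - 1
          -- powers of W are bounded through W₁ and one by t^(-θ); the Beta integral returns
          -- t^(1-1/d-l-θ) = t^(-θ).
          have h1 : duhMaj d (1 / d) p W x t ≤
              ENNReal.ofReal η * ENNReal.ofReal (M * t ^ (-θ)) := by
            refine (duhMaj_le_const (c := fun s => ENNReal.ofReal ((A * K * ε) ^ (p - 1) * M) *
              ENNReal.ofReal (s ^ (-(l + θ)))) (by fun_prop) (fun s hs hst y => ?_) x).trans ?_
            · rw [hpow]
              refine (mul_le_mul' ((ENNReal.rpow_le_rpow (hWW y s) hp1.le).trans (hW₁p s hs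
                ((ENNReal.ofReal_le_ofReal hst.le).trans_lt htT) y)) (hWV y s)).trans (le_of_eq ?_)
              rw [← ENNReal.ofReal_mul (by positivity), ← ENNReal.ofReal_mul (by positivity),
                neg_add, Real.rpow_add hs]
              congr 1; ring
            · have h2 : ∫⁻ s in Ioo 0 t, ENNReal.ofReal ((t - s) ^ (-(1 / d))) *
                  (ENNReal.ofReal ((A * K * ε) ^ (p - 1) * M) *
                    ENNReal.ofReal (s ^ (-(l + θ)))) ≤
                  ENNReal.ofReal ((A * K * ε) ^ (p - 1) * M) *
                    ENNReal.ofReal (betaC (1 / d) (l + θ) * t ^ (1 - 1 / d - (l + θ))) := by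
                refine le_trans (le_of_eq ?_)
                  (mul_le_mul_right (lintegral_beta_le hdi0.le hdi hlθ0 hlθ1 ht) _)
                rw [← lintegral_const_mul' _ _ ENNReal.ofReal_ne_top]
                congr 1; ext s
                ring
              refine (mul_le_mul_left h2 _).trans ?_
              rw [← ENNReal.ofReal_mul (by positivity), ← ENNReal.ofReal_mul (by positivity),
                ← ENNReal.ofReal_mul hη.le]
              refine ENNReal.ofReal_le_ofReal ?_
              rw [show 1 - 1 / d - (l + θ) = -θ by rw [hl]; ring]
              calc _ = ((A * K * ε) ^ (p - 1) * betaC (1 / d) (l + θ) * majMass N) *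
                    (M * t ^ (-θ)) := by ring
                _ ≤ _ := by gcongr
          have h3 := hsmall W hWW x t ht htT
          simp only [W]
          rcases min_choice (W₁ x t) (ENNReal.ofReal (M * t ^ (-θ))) with h | h <;> rw [h]
          exacts [h3, h1]
        duh_bdd := fun τ hτ => by
          have hα : a * p / d < 1 := by
            rw [div_lt_one hd0]
            have : a < 1 := by rw [ha, div_lt_one hp1]; linarith
            nlinarith
          refine ⟨(∫⁻ s in Ioi (0 : ℝ), min (ENNReal.ofReal ((A * K * ε) ^ p * s ^ (-(a * p / d))))
            (ENNReal.ofReal (M ^ p * s ^ (-(θ * p))))) * ENNReal.ofReal (majMass N),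
            ENNReal.mul_ne_top (lintegral_min_rpow_ne_top hα hθp1 (by positivity))
              ENNReal.ofReal_ne_top, fun x t ht htT => ?_⟩
          refine (duhMaj_le_const (c := fun s =>
            min (ENNReal.ofReal ((A * K * ε) ^ p * s ^ (-(a * p / d))))
              (ENNReal.ofReal (M ^ p * s ^ (-(θ * p))))) (by fun_prop)
              (fun s hs hst y => le_min ?_ ?_) x).trans (mul_le_mul_left ?_ _)
          · refine (ENNReal.rpow_le_rpow ((hWW y s).trans (hW₁ y s hs
              ((ENNReal.ofReal_le_ofReal hst.le).trans_lt htT))) hp0.le).trans (le_of_eq ?_)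
            rw [ENNReal.ofReal_rpow_of_pos (by positivity),
              Real.mul_rpow (by positivity) (by positivity), ← Real.rpow_mul hs.le]
            congr 3; ring
          · refine (ENNReal.rpow_le_rpow (hWV y s) hp0.le).trans (le_of_eq ?_)
            rw [ENNReal.ofReal_rpow_of_pos (by positivity),
              Real.mul_rpow (by positivity) (by positivity), ← Real.rpow_mul hs.le]
            congr 3; ring
          · simp only [neg_zero, Real.rpow_zero, ENNReal.ofReal_one, one_mul]
            exact lintegral_mono_set Ioo_subset_Ioi_self }
    exact ⟨u, hu⟩

/-! ### Logarithmic weights -/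

lemma one_le_log_exp_add {x : ℝ} (hx : 0 ≤ x) : 1 ≤ Real.log (Real.exp 1 + x) := by
  rw [Real.le_log_iff_exp_le (by positivity)]
  linarith

lemma log_exp_add_pos {x : ℝ} (hx : 0 ≤ x) : 0 < Real.log (Real.exp 1 + x) :=
  one_pos.trans_le (one_le_log_exp_add hx)

lemma log_exp_add_mono {x y : ℝ} (hx : 0 ≤ x) (h : x ≤ y) :
    Real.log (Real.exp 1 + x) ≤ Real.log (Real.exp 1 + y) :=
  Real.log_le_log (by positivity) (by linarith)

lemma log_exp_add_rpow_le {x m : ℝ} (hx : 1 ≤ x) (hm : 0 ≤ m) :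
    Real.log (Real.exp 1 + x ^ m) ≤ (m + 1) * Real.log (Real.exp 1 + x) := by
  have he : 0 < Real.exp 1 := Real.exp_pos 1
  have hx0 : 0 < x := by linarith
  rw [← Real.log_rpow (by positivity)]
  refine Real.log_le_log (by positivity) ?_
  rw [Real.rpow_add_one (by positivity)]
  have h1 : x ^ m ≤ (Real.exp 1 + x) ^ m := by gcongr; linarith
  have h2 : 1 ≤ x ^ m := Real.one_le_rpow hx hm
  nlinarith

lemma log_exp_add_le_mul {δ x : ℝ} (hδ : 0 < δ) (hδ1 : δ ≤ 1) (hx : 0 ≤ x) :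
    Real.log (Real.exp 1 + x) ≤ (1 + Real.log (1 / δ)) * Real.log (Real.exp 1 + δ * x) := by
  have he : 0 < Real.exp 1 := Real.exp_pos 1
  have h1 : Real.exp 1 + x ≤ 1 / δ * (Real.exp 1 + δ * x) := by
    rw [div_mul_eq_mul_div, le_div_iff₀ hδ]
    nlinarith
  have h2 := Real.log_le_log (by positivity) h1
  rw [Real.log_mul (by positivity) (by positivity)] at h2
  have h3 : 0 ≤ Real.log (1 / δ) := Real.log_nonneg (by rw [le_div_iff₀ hδ]; linarith)
  have h4 := one_le_log_exp_add (x := δ * x) (by positivity)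
  nlinarith

/-- The logarithmic weight `log (e + r^{-1/d})`. -/
def ell (d r : ℝ) : ℝ := Real.log (Real.exp 1 + r ^ (-(1 / d)))

lemma one_le_ell {d r : ℝ} (hr : 0 < r) : 1 ≤ ell d r := one_le_log_exp_add (by positivity)

lemma ell_pos {d r : ℝ} (hr : 0 < r) : 0 < ell d r := one_pos.trans_le (one_le_ell hr)

lemma ell_anti {d r r' : ℝ} (hd : 0 < d) (hr : 0 < r) (h : r ≤ r') : ell d r' ≤ ell d r :=
  log_exp_add_mono (Real.rpow_nonneg (hr.le.trans h) _)
    (Real.rpow_le_rpow_of_nonpos hr h (by simp; positivity))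

/-- Inside the logarithm a small factor δ costs only log(1/δ), which is at most a multiple of
δ^(-1/(2β)); after the power β this is δ^(-1/2). Since the loss is less than one power of δ,
smallness survives at the critical exponent. -/
lemma exists_log_rpow_le {d β ε : ℝ} (hd : 0 < d) (hβ : 0 < β) (hε : 0 < ε) :
    ∃ C : ℝ, 0 < C ∧ ∀ δ r : ℝ, 0 < δ → δ ≤ 1 → 0 < r → r ≤ 1 →
      (Real.log (Real.exp 1 + δ * r ^ (-ε))) ^ (-β) ≤ C * δ ^ (-(1 / 2 : ℝ)) * ell d r ^ (-β) := by
  set m : ℝ := 1 / (d * ε) with hm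
  have hm0 : 0 < m := by positivity
  set a : ℝ := 1 / (2 * β) with ha
  have ha0 : 0 < a := by positivity
  refine ⟨((m + 1) * (1 + 1 / a)) ^ β, by positivity, fun δ r hδ hδ1 hr hr1 => ?_⟩
  have h1 : (r ^ (-ε)) ^ m = r ^ (-(1 / d)) := by
    rw [← Real.rpow_mul hr.le, hm]; congr 1; field_simp
  have h2 : 1 ≤ r ^ (-ε) := Real.one_le_rpow_of_pos_of_le_one_of_nonpos hr hr1 (by linarith)
  have h3 := log_exp_add_rpow_le h2 hm0.le
  rw [h1] at h3
  have h4 := log_exp_add_le_mul hδ hδ1 (x := r ^ (-ε)) (by positivity)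
  have h5 : 1 + Real.log (1 / δ) ≤ (1 + 1 / a) * δ ^ (-a) := by
    have e1 := Real.log_le_rpow_div (x := 1 / δ) (by positivity) ha0
    have e2 : (1 / δ) ^ a = δ ^ (-a) := by
      rw [one_div, Real.inv_rpow hδ.le, Real.rpow_neg hδ.le]
    rw [e2] at e1
    have e3 : 1 ≤ δ ^ (-a) := Real.one_le_rpow_of_pos_of_le_one_of_nonpos hδ hδ1 (by linarith)
    calc _ ≤ δ ^ (-a) + δ ^ (-a) / a := by linarith
      _ = _ := by ring
  set Λ := Real.log (Real.exp 1 + δ * r ^ (-ε)) with hΛ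
  have hΛ0 : 0 < Λ := log_exp_add_pos (by positivity)
  have h6 : ell d r ≤ ((m + 1) * (1 + 1 / a)) * δ ^ (-a) * Λ := by
    calc ell d r ≤ (m + 1) * Real.log (Real.exp 1 + r ^ (-ε)) := h3
      _ ≤ (m + 1) * ((1 + Real.log (1 / δ)) * Λ) := by gcongr
      _ ≤ (m + 1) * (((1 + 1 / a) * δ ^ (-a)) * Λ) := by gcongr
      _ = _ := by ring
  have h7 := Real.rpow_le_rpow (ell_pos hr).le h6 hβ.le
  rw [Real.mul_rpow (by positivity) hΛ0.le, Real.mul_rpow (by positivity) (by positivity),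
    ← Real.rpow_mul hδ.le, show -a * β = -(1 / 2 : ℝ) by rw [ha]; field_simp] at h7
  have hE := Real.rpow_pos_of_pos (ell_pos (d := d) hr) β
  have hL := Real.rpow_pos_of_pos hΛ0 β
  rw [Real.rpow_neg hΛ0.le, Real.rpow_neg (ell_pos hr).le, ← div_eq_mul_inv, inv_eq_one_div,
    div_le_div_iff₀ hL hE, one_mul]
  exact h7

/-- The constant in `lintegral_inv_mul_ell_le`. -/
def ellC (d β : ℝ) : ℝ := d * (Real.exp 1 + 1) / β

lemma hasDerivAt_ell_rpow {d β T s : ℝ} (hT : 0 < T) (hs : 0 < s) :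
    HasDerivAt (fun s => ell d (s / T) ^ (-β))
      (β / d * (s⁻¹ * ell d (s / T) ^ (-β - 1) *
        ((s / T) ^ (-(1 / d)) / (Real.exp 1 + (s / T) ^ (-(1 / d)))))) s := by
  have he : 0 < Real.exp 1 := Real.exp_pos 1
  have hsT : 0 < s / T := by positivity
  have h1 : HasDerivAt (fun s : ℝ => s / T) (1 / T) s := (hasDerivAt_id s).div_const T
  have h2 := ((h1.rpow_const (p := -(1 / d)) (Or.inl hsT.ne')).const_add (Real.exp 1)).log
    (by positivity)
  have h3 := h2.rpow_const (p := -β) (Or.inl (ell_pos (d := d) hsT).ne')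
  refine h3.congr_deriv ?_
  have e : (s / T) ^ (-(1 / d) - 1) = (s / T) ^ (-(1 / d)) * (T / s) := by
    rw [Real.rpow_sub_one hsT.ne', div_div_eq_mul_div, mul_div_assoc]
  simp only [ell]
  rw [e]
  field_simp

/-- The derivative of `ell`^(-β) is (β/d) s⁻¹ `ell`^(-β-1) times the quotient of (s/T)^(-1/d) by e +
(s/T)^(-1/d). For s ≤ T this quotient is at least 1/(e+1), so `ell`^(-β) is a primitive up to a
constant. Integration lowers the logarithmic power by exactly one. -/
lemma lintegral_inv_mul_ell_le {d β T t : ℝ} (hd : 0 < d) (hβ : 0 < β) (hT : 0 < T) (ht : 0 < t)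
    (htT : t ≤ T) :
    ∫⁻ s in Ioo 0 t, ENNReal.ofReal (s⁻¹ * ell d (s / T) ^ (-β - 1)) ≤
      ENNReal.ofReal (ellC d β * ell d (t / T) ^ (-β)) := by
  have he : 0 < Real.exp 1 := Real.exp_pos 1
  have hC : 0 < ellC d β := by unfold ellC; positivity
  let g' : ℝ → ℝ := fun s => ellC d β * (β / d * (s⁻¹ * ell d (s / T) ^ (-β - 1) *
        ((s / T) ^ (-(1 / d)) / (Real.exp 1 + (s / T) ^ (-(1 / d))))))
  let g : ℝ → ℝ := fun s => ellC d β * ell d (s / T) ^ (-β)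
  have hg : ∀ s, 0 < s → HasDerivAt g (g' s) s := fun s hs =>
    (hasDerivAt_ell_rpow hT hs).const_mul _
  have hg0 : ∀ s, 0 < s → 0 ≤ g s := fun s hs => by
    have := ell_pos (d := d) (div_pos hs hT)
    positivity
  have hg'0 : ∀ s, 0 < s → 0 ≤ g' s := fun s hs => by
    have := ell_pos (d := d) (div_pos hs hT)
    simp only [g']
    positivity
  have hle : ∀ s, 0 < s → s ≤ T → s⁻¹ * ell d (s / T) ^ (-β - 1) ≤ g' s := by
    intro s hs hsT
    have hl := ell_pos (d := d) (div_pos hs hT)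
    have h1 : 1 ≤ (s / T) ^ (-(1 / d)) :=
      Real.one_le_rpow_of_pos_of_le_one_of_nonpos (by positivity) ((div_le_one hT).2 hsT)
        (by simp; positivity)
    have h2 : 1 ≤ (Real.exp 1 + 1) * ((s / T) ^ (-(1 / d)) / (Real.exp 1 + (s / T) ^ (-(1 / d)))) := by
      rw [← mul_div_assoc, le_div_iff₀ (by positivity)]
      nlinarith
    have h3 : 0 ≤ s⁻¹ * ell d (s / T) ^ (-β - 1) := by positivity
    calc s⁻¹ * ell d (s / T) ^ (-β - 1) ≤ s⁻¹ * ell d (s / T) ^ (-β - 1) *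
          ((Real.exp 1 + 1) * ((s / T) ^ (-(1 / d)) / (Real.exp 1 + (s / T) ^ (-(1 / d))))) :=
          le_mul_of_one_le_right h3 h2
      _ = g' s := by simp only [g', ellC]; field_simp
  have key : ∀ a, 0 < a → a ≤ t →
      ∫⁻ s in Ioo a t, ENNReal.ofReal (s⁻¹ * ell d (s / T) ^ (-β - 1)) ≤ ENNReal.ofReal (g t) := by
    intro a ha hat
    have hcont : ContinuousOn g (Icc a t) := fun s hs =>
      (hg s (ha.trans_le hs.1)).continuousAt.continuousWithinAt
    have hder : ∀ s ∈ Ioo a t, HasDerivAt g (g' s) s := fun s hs => hg s (ha.trans hs.1)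
    have hint := intervalIntegral.integrableOn_deriv_of_nonneg hcont hder
      (fun s hs => hg'0 s (ha.trans hs.1))
    have hft := intervalIntegral.integral_eq_sub_of_hasDerivAt_of_le hat hcont hder
      ((intervalIntegrable_iff_integrableOn_Ioc_of_le hat).2 hint)
    rw [intervalIntegral.integral_of_le hat, integral_Ioc_eq_integral_Ioo] at hft
    calc ∫⁻ s in Ioo a t, ENNReal.ofReal (s⁻¹ * ell d (s / T) ^ (-β - 1))
        ≤ ∫⁻ s in Ioo a t, ENNReal.ofReal (g' s) :=
          setLIntegral_mono' measurableSet_Ioo fun s hs =>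
            ENNReal.ofReal_le_ofReal (hle s (ha.trans hs.1) (hs.2.le.trans htT))
      _ = ENNReal.ofReal (∫ s in Ioo a t, g' s) := by
          rw [ofReal_integral_eq_lintegral_ofReal (hint.mono_set Ioo_subset_Ioc_self)]
          exact (ae_restrict_mem measurableSet_Ioo).mono fun s hs => hg'0 s (ha.trans hs.1)
      _ ≤ ENNReal.ofReal (g t) := by
          rw [hft]
          exact ENNReal.ofReal_le_ofReal (by linarith [hg0 a ha])
  -- The fundamental theorem is applied on [a, t] with a > 0; its bound does not depend on a, so an
  -- increasing exhaustion reaches 0.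
  have hU : Ioo 0 t = ⋃ n : ℕ, Ioo (t / ((n : ℝ) + 1)) t := by
    ext s
    simp only [mem_iUnion, mem_Ioo]
    constructor
    · rintro ⟨h1, h2⟩
      obtain ⟨n, hn⟩ := exists_nat_gt (t / s)
      refine ⟨n, ?_, h2⟩
      rw [div_lt_iff₀ h1] at hn
      rw [div_lt_iff₀ (by positivity)]
      nlinarith
    · rintro ⟨n, h1, h2⟩
      exact ⟨lt_trans (by positivity) h1, h2⟩
  rw [hU, setLIntegral_iUnion_of_directed]
  · refine iSup_le fun n => key _ (by positivity) (div_le_self ht.le ?_)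
    linarith [n.cast_nonneg (α := ℝ)]
  · refine Monotone.directed_le fun n m hnm => Ioo_subset_Ioo_left ?_
    gcongr

/-- The constant in `lintegral_sub_rpow_ell_le`. -/
def ellBetaC (d κ β : ℝ) : ℝ := 2 ^ κ * ellC d β + 2 / (1 - κ)

lemma ellBetaC_pos {d κ β : ℝ} (hd : 0 < d) (hκ : κ < 1) (hβ : 0 < β) : 0 < ellBetaC d κ β := by
  have : 0 < 1 - κ := by linarith
  have := Real.exp_pos 1
  unfold ellBetaC ellC
  positivity

lemma lintegral_sub_rpow_ell_le {d κ β T t : ℝ} (hd : 0 < d) (hκ0 : 0 ≤ κ) (hκ : κ < 1)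
    (hβ : 0 < β) (hT : 0 < T) (ht : 0 < t) (htT : t ≤ T) :
    ∫⁻ s in Ioo 0 t, ENNReal.ofReal ((t - s) ^ (-κ)) *
        ENNReal.ofReal (s⁻¹ * ell d (s / T) ^ (-β - 1)) ≤
      ENNReal.ofReal (ellBetaC d κ β * t ^ (-κ) * ell d (t / T) ^ (-β)) := by
  have hκ1 : 0 < 1 - κ := by linarith
  have he : 0 < Real.exp 1 := Real.exp_pos 1
  have hl := ell_pos (d := d) (div_pos ht hT)
  have hC : 0 < ellC d β := by unfold ellC; positivity
  have hM : ∀ s, t / 2 ≤ s → s < t → ENNReal.ofReal (s⁻¹ * ell d (s / T) ^ (-β - 1)) ≤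
      ENNReal.ofReal (2 * t⁻¹ * ell d (t / T) ^ (-β)) := by
    intro s hs hst
    have hs0 : 0 < s := by linarith
    have h1 : ell d (t / T) ≤ ell d (s / T) := ell_anti hd (by positivity) (by gcongr)
    have h2 : ell d (s / T) ^ (-β - 1) ≤ ell d (t / T) ^ (-β) := by
      calc _ ≤ ell d (t / T) ^ (-β - 1) := Real.rpow_le_rpow_of_nonpos hl h1 (by linarith)
        _ ≤ _ := Real.rpow_le_rpow_of_exponent_le (one_le_ell (by positivity)) (by linarith)
    have h3 : s⁻¹ ≤ 2 * t⁻¹ := by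
      rw [inv_le_comm₀ hs0 (by positivity), mul_inv, inv_inv]; linarith
    have : 0 < ell d (s / T) := hl.trans_le h1
    exact ENNReal.ofReal_le_ofReal (by gcongr)
  have hmeas : Measurable fun s => ENNReal.ofReal (s⁻¹ * ell d (s / T) ^ (-β - 1)) := by
    unfold ell; fun_prop
  refine (lintegral_sub_rpow_mul_le hκ0 hκ ht hmeas hM).trans ?_
  refine (add_le_add_left (mul_le_mul_right (lintegral_inv_mul_ell_le hd hβ hT ht htT) _) _).trans
    (le_of_eq ?_)
  rw [← ENNReal.ofReal_mul (by positivity), ← ENNReal.ofReal_mul (by positivity),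
    ← ENNReal.ofReal_add (by positivity) (by positivity), half_rpow_neg ht, ellBetaC,
    show (1 - κ) = -κ + 1 by ring, Real.rpow_add_one ht.ne']
  congr 1
  rw [show (-κ + 1) = 1 - κ by ring]
  field_simp

/-! ### The critical exponent -/

lemma add_rpow_le_two_mul {a b : ℝ≥0∞} {p : ℝ} (hp : 0 ≤ p) :
    (a + b) ^ p ≤ (2 * a) ^ p + (2 * b) ^ p := by
  rcases le_total a b with h | h
  · refine le_add_left (ENNReal.rpow_le_rpow ?_ hp)
    rw [two_mul]; gcongr
  · refine le_add_right (ENNReal.rpow_le_rpow ?_ hp)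
    rw [two_mul]; gcongr

lemma duhMaj_le_add {d κ p : ℝ} {W V : Sp N → ℝ → ℝ≥0∞} {w : ℝ → ℝ≥0∞} (hw : Measurable w)
    {t : ℝ} (hW : ∀ s, 0 < s → s < t → ∀ y, W y s ^ p ≤ w s + V y s ^ p) (x : Sp N) :
    duhMaj d κ p W x t ≤ (∫⁻ s in Ioo 0 t, ENNReal.ofReal ((t - s) ^ (-κ)) * w s) *
      ENNReal.ofReal (majMass N) + duhMaj d κ p V x t := by
  have hm : Measurable fun s => ENNReal.ofReal ((t - s) ^ (-κ)) * w s :=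
    Measurable.mul (by fun_prop) hw
  rw [duhMaj, duhMaj, ← lintegral_mul_const _ hm, ← lintegral_add_left (hm.mul_const _)]
  refine setLIntegral_mono' measurableSet_Ioo fun s hs => ?_
  have hs1 : 0 < t - s := by linarith [hs.2]
  have hk : Measurable fun y : Sp N => ENNReal.ofReal (wker d κ (t - s) (x - y)) :=
    ((measurable_wker (N := N) (d := d) (κ := κ)).comp
      (by fun_prop : Measurable fun y : Sp N => (x - y, t - s))).ennreal_ofReal
  calc ∫⁻ y, ENNReal.ofReal (wker d κ (t - s) (x - y)) * W y s ^ p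
      ≤ ∫⁻ y, (ENNReal.ofReal (wker d κ (t - s) (x - y)) * w s +
          ENNReal.ofReal (wker d κ (t - s) (x - y)) * V y s ^ p) := by
        refine lintegral_mono fun y => ?_
        rw [← mul_add]
        gcongr
        exact hW s hs.1 hs.2 y
    _ = _ := by
        rw [lintegral_add_left (hk.mul_const _), lintegral_mul_const _ hk, lintegral_wker hs1]
        congr 1
        ring

/-- Both parts of the profile fit under the weight required of u: in the first, the spare power
r^(ν-ε) absorbs the logarithm; in the second, μ ≥ ν and |log(r/2)| ≤ (1+d) `ell`. -/
lemma exists_weight_le {d μ ν ε : ℝ} (hd : 0 < d) (hν : 0 < ν) (hνμ : ν ≤ μ) (hεν : ε < ν) :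
    ∃ C : ℝ, 0 < C ∧ ∀ r : ℝ, 0 < r → r < 1 →
      r ^ (-ε) + ell d r ^ (-μ) * r ^ (-ν) ≤ C * (r ^ (-ν) * |Real.log (r / 2)| ^ (-ν)) := by
  set a : ℝ := (ν - ε) / ν with ha
  have ha0 : 0 < a := div_pos (by linarith) hν
  refine ⟨2 ^ (ν - ε) / a ^ ν + (1 + d) ^ ν, by positivity, fun r hr hr1 => ?_⟩
  have hΛe : |Real.log (r / 2)| = Real.log (2 / r) := by
    rw [abs_of_nonpos (Real.log_nonpos (by positivity) (by linarith)), ← Real.log_inv, inv_div]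
  set Λ := Real.log (2 / r) with hΛ
  have hΛ0 : 0 < Λ := Real.log_pos (by rw [lt_div_iff₀ hr]; linarith)
  rw [hΛe, add_mul]
  refine add_le_add ?_ ?_
  · have h1 := Real.log_le_rpow_div (x := 2 / r) (by positivity) ha0
    have h2 := Real.rpow_le_rpow hΛ0.le h1 hν.le
    rw [Real.div_rpow (by positivity) ha0.le, ← Real.rpow_mul (by positivity),
      show a * ν = ν - ε by rw [ha]; field_simp, Real.div_rpow (by norm_num) hr.le] at h2
    have h3 : r ^ (-ε) = r ^ (-ν) * r ^ (ν - ε) := by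
      rw [← Real.rpow_add hr]; congr 1; ring
    rw [h3, Real.rpow_neg hΛ0.le, mul_left_comm]
    have hrν : 0 < r ^ (ν - ε) := by positivity
    have hΛν : 0 < Λ ^ ν := by positivity
    have haν : 0 < a ^ ν := by positivity
    refine mul_le_mul_of_nonneg_left ?_ (by positivity)
    rw [← div_eq_mul_inv, le_div_iff₀ hΛν]
    calc r ^ (ν - ε) * Λ ^ ν ≤ r ^ (ν - ε) * (2 ^ (ν - ε) / r ^ (ν - ε) / a ^ ν) := by gcongr
      _ = _ := by field_simp
  · have hl := one_le_ell (d := d) hr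
    have hl0 : 0 < ell d r := by linarith
    have h1 : Λ ≤ (1 + d) * ell d r := by
      have e1 : Λ = Real.log 2 + d * Real.log (r ^ (-(1 / d))) := by
        rw [hΛ, Real.log_div (by norm_num) hr.ne', Real.log_rpow hr]; field_simp; ring
      have e2 : Real.log (r ^ (-(1 / d))) ≤ ell d r :=
        Real.log_le_log (by positivity) (by linarith [Real.exp_pos 1])
      have e3 : Real.log 2 ≤ 1 := by linarith [Real.log_two_lt_d9]
      rw [e1]
      nlinarith
    have h2 : ell d r ^ (-μ) ≤ (1 + d) ^ ν * Λ ^ (-ν) := by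
      calc ell d r ^ (-μ) ≤ ell d r ^ (-ν) :=
            Real.rpow_le_rpow_of_exponent_le hl (by linarith)
        _ = (1 + d) ^ ν * ((1 + d) * ell d r) ^ (-ν) := by
            rw [Real.mul_rpow (by positivity) hl0.le, ← mul_assoc, ← Real.rpow_add (by positivity)]
            simp
        _ ≤ _ := mul_le_mul_of_nonneg_left
            (Real.rpow_le_rpow_of_nonpos hΛ0 h1 (neg_nonpos.2 hν.le)) (by positivity)
    calc ell d r ^ (-μ) * r ^ (-ν) ≤ (1 + d) ^ ν * Λ ^ (-ν) * r ^ (-ν) := by gcongr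
      _ = _ := by ring

/-- Either a ≤ b, or log(e+a) ≥ log(e+b) and then Φ(a) ≥ a log(e+b)^β. This linear inequality in Φ
replaces Jensen's inequality for Φ. -/
lemma le_add_log_mul_Phi {β a b : ℝ} (hβ : 0 < β) (ha : 0 ≤ a) (hb : 0 ≤ b) :
    a ≤ b + Real.log (Real.exp 1 + b) ^ (-β) * Phi β a := by
  have hL := log_exp_add_pos hb
  have hLa := log_exp_add_pos ha
  rcases le_total a b with h | h
  · have : 0 ≤ Real.log (Real.exp 1 + b) ^ (-β) * Phi β a := by unfold Phi; positivity
    linarith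
  · have h1 := Real.rpow_le_rpow hL.le (log_exp_add_mono hb h) hβ.le
    have h2 : 1 ≤ Real.log (Real.exp 1 + b) ^ (-β) * Real.log (Real.exp 1 + a) ^ β := by
      rw [Real.rpow_neg hL.le, inv_mul_eq_div, le_div_iff₀ (by positivity), one_mul]
      exact h1
    have : a ≤ Real.log (Real.exp 1 + b) ^ (-β) * Phi β a := by
      unfold Phi
      nlinarith
    linarith

lemma eq_pHJ_iff {d p : ℝ} : p = pHJ N d ↔ p + N * (p - 1) = d := by
  rw [pHJ, eq_div_iff (by positivity)]
  constructor <;> intro h <;> linarith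

/-- The potential of the initial datum is controlled by that of `Φ(T^{N/d} |φ|)`. -/
lemma pot_enorm_le {d β ε δ B T t : ℝ} (hβ : 0 < β) (hδ : 0 < δ)
    (hT : 0 < T) (ht : 0 < t)
    (hB : Real.log (Real.exp 1 + δ * (t / T) ^ (-ε)) ^ (-β) ≤ B * ell d (t / T) ^ (-β))
    (hB0 : 0 ≤ B) {φ : Sp N → ℝ} (hφ : AEStronglyMeasurable φ volume) (x : Sp N) :
    pot (t ^ (1 / d)) (fun y => ‖φ y‖ₑ) x ≤ ENNReal.ofReal (T ^ (-(N / d : ℝ)) * (majMass N + 1)) *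
      (ENNReal.ofReal (δ * (t / T) ^ (-ε)) + ENNReal.ofReal (B * ell d (t / T) ^ (-β)) *
        pot (t ^ (1 / d)) (fun y => ENNReal.ofReal (Phi β (T ^ (N / d : ℝ) * |φ y|))) x) := by
  have hl := ell_pos (d := d) (div_pos ht hT)
  have hr : 0 < t / T := by positivity
  have hm := majMass_pos (N := N)
  have hτ : 0 < t ^ (1 / d) := by positivity
  have hfm : AEMeasurable fun y => ENNReal.ofReal (Phi β (T ^ (N / d : ℝ) * |φ y|)) := by
    have := hφ.aemeasurable
    unfold Phi
    fun_prop
  have h1 : ∀ y, ‖φ y‖ₑ ≤ ENNReal.ofReal (T ^ (-(N / d : ℝ))) * (ENNReal.ofReal (δ * (t / T) ^ (-ε)) +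
      ENNReal.ofReal (B * ell d (t / T) ^ (-β)) *
        ENNReal.ofReal (Phi β (T ^ (N / d : ℝ) * |φ y|))) := by
    intro y
    have h2 := le_add_log_mul_Phi hβ (a := T ^ (N / d : ℝ) * |φ y|) (b := δ * (t / T) ^ (-ε))
      (by positivity) (by positivity)
    have hP : 0 ≤ Phi β (T ^ (N / d : ℝ) * |φ y|) := by
      have := log_exp_add_pos (x := T ^ (N / d : ℝ) * |φ y|) (by positivity)
      unfold Phi; positivity
    rw [← ENNReal.ofReal_mul (by positivity), ← ENNReal.ofReal_add (by positivity) (by positivity),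
      ← ENNReal.ofReal_mul (by positivity), ← ofReal_norm, Real.norm_eq_abs]
    refine ENNReal.ofReal_le_ofReal ?_
    calc |φ y| = T ^ (-(N / d : ℝ)) * (T ^ (N / d : ℝ) * |φ y|) := by
          rw [← mul_assoc, ← Real.rpow_add hT]; simp
      _ ≤ T ^ (-(N / d : ℝ)) * (δ * (t / T) ^ (-ε) +
          Real.log (Real.exp 1 + δ * (t / T) ^ (-ε)) ^ (-β) *
            Phi β (T ^ (N / d : ℝ) * |φ y|)) := by gcongr
      _ ≤ _ := by gcongr
  refine (pot_mono (Filter.Eventually.of_forall h1) x).trans ?_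
  rw [pot_const_mul hτ _ (AEMeasurable.const_add (hfm.const_mul _) _),
    pot_add hτ _ _ aemeasurable_const, pot_const hτ, pot_const_mul hτ _ hfm,
    ENNReal.ofReal_mul (show 0 ≤ T ^ (-(N / d : ℝ)) by positivity), mul_assoc]
  gcongr
  rw [mul_add]
  refine add_le_add ?_ ?_
  · gcongr; linarith
  · refine le_mul_of_one_le_left (zero_le) ?_
    rw [ENNReal.one_le_ofReal]; linarith

/-- The profile of the gradient majorant at the critical exponent. -/
def critZ (d β ε δ B T : ℝ) (f : Sp N → ℝ≥0∞) (x : Sp N) (t : ℝ) : ℝ≥0∞ :=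
  ENNReal.ofReal (δ * (t / T) ^ (-ε)) +
    ENNReal.ofReal (B * ell d (t / T) ^ (-β)) * pot (t ^ (1 / d)) f x

/-- The gradient majorant at the critical exponent. -/
def critW (d β ε ν δ B A T : ℝ) (f : Sp N → ℝ≥0∞) (x : Sp N) (t : ℝ) : ℝ≥0∞ :=
  ENNReal.ofReal (A * t ^ (-(1 / d)) * T ^ (-ν)) * critZ d β ε δ B T f x t

lemma mul_rpow_four {x y z w q : ℝ} (hx : 0 ≤ x) (hy : 0 ≤ y) (hz : 0 ≤ z) (hw : 0 ≤ w) :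
    (x * y * z * w) ^ q = x ^ q * y ^ q * z ^ q * w ^ q := by
  rw [Real.mul_rpow (by positivity) hw, Real.mul_rpow (by positivity) hz, Real.mul_rpow hx hy]

/-! ### Self-reproduction of the critical majorant -/

section Critical

variable {d p β ν μ ε l δ B A T K : ℝ}

lemma critW_rpow_le (hp : 0 < p) (hT : 0 < T) (hA : 0 < A) (hδ : 0 < δ)
    (hl : l = p / d + ε * p) (f : Sp N → ℝ≥0∞) {s : ℝ} (hs : 0 < s) (y : Sp N) :
    critW d β ε ν δ B A T f y s ^ p ≤
      ENNReal.ofReal ((2 * A * δ) ^ p * T ^ (-ν - (ν * (p - 1) - ε * p)) * s ^ (-l)) +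
      (ENNReal.ofReal (2 * (A * s ^ (-(1 / d)) * T ^ (-ν)) * (B * ell d (s / T) ^ (-β))) *
        pot (s ^ (1 / d)) f y) ^ p := by
  have h0 := ell_pos (d := d) (div_pos hs hT)
  have h2 : (2 : ℝ≥0∞) = ENNReal.ofReal 2 := by simp
  rw [critW, critZ, mul_add]
  refine (add_rpow_le_two_mul hp.le).trans (le_of_eq ?_)
  congr 1
  · rw [h2, ← ENNReal.ofReal_mul (by positivity), ← ENNReal.ofReal_mul (by positivity),
      ENNReal.ofReal_rpow_of_pos (by positivity)]
    congr 1
    have e : 2 * (A * s ^ (-(1 / d)) * T ^ (-ν) * (δ * (s / T) ^ (-ε))) =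
        (2 * A * δ) * T ^ (-ν + ε) * s ^ (-(1 / d) - ε) := by
      rw [Real.div_rpow hs.le hT.le, Real.rpow_neg hT.le ε, div_inv_eq_mul, Real.rpow_add hT,
        sub_eq_add_neg, Real.rpow_add hs]
      ring
    rw [e, Real.mul_rpow (by positivity) (by positivity),
      Real.mul_rpow (by positivity) (by positivity), ← Real.rpow_mul hT.le,
      ← Real.rpow_mul hs.le, hl]
    congr 3
    · ring
    · ring
  · congr 1
    rw [h2, ← mul_assoc, ← mul_assoc, ← ENNReal.ofReal_mul (by positivity),
      ← ENNReal.ofReal_mul (by positivity)]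

/-- The powers of s combine to s⁻¹ by p/d + ν(p-1) = 1, and those of the logarithm to -βp +
(β-μ)(p-1) = -β-1 by μ(p-1) = 1. This is the integrand of `lintegral_inv_mul_ell_le`. -/
lemma crit_rpow_le (hp : 1 < p) (hT : 0 < T) (hA : 0 < A) (hB : 0 < B) (hδ : 0 < δ) (hK : 0 < K)
    (hνp : ν * (p - 1) = 1 - p / d) (hμp : μ * (p - 1) = 1) {f : Sp N → ℝ≥0∞} {s : ℝ} (hs : 0 < s)
    {y : Sp N} (hf : pot (s ^ (1 / d)) f y ≤
      ENNReal.ofReal (K * δ * ell d (s / T) ^ (β - μ) * (s / T) ^ (-ν))) :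
    (ENNReal.ofReal (2 * (A * s ^ (-(1 / d)) * T ^ (-ν)) * (B * ell d (s / T) ^ (-β))) *
        pot (s ^ (1 / d)) f y) ^ p ≤
      ENNReal.ofReal ((2 * A * B) ^ p * (K * δ) ^ (p - 1) * T ^ (-ν)) *
        ENNReal.ofReal (s⁻¹ * ell d (s / T) ^ (-β - 1)) * pot (s ^ (1 / d)) f y := by
  have h0 := ell_pos (d := d) (div_pos hs hT)
  rw [ofReal_mul_rpow (by positivity) (by linarith)]
  refine (mul_le_mul_right (ennreal_rpow_le (by positivity) hf hp.le) _).trans (le_of_eq ?_)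
  rw [← mul_assoc, ← ENNReal.ofReal_mul (by positivity), ← ENNReal.ofReal_mul (by positivity)]
  congr 2
  have e1 : 2 * (A * s ^ (-(1 / d)) * T ^ (-ν)) * (B * ell d (s / T) ^ (-β)) =
      (2 * A * B) * s ^ (-(1 / d)) * T ^ (-ν) * ell d (s / T) ^ (-β) := by ring
  have e2 : K * δ * ell d (s / T) ^ (β - μ) * (s / T) ^ (-ν) =
      (K * δ) * ell d (s / T) ^ (β - μ) * s ^ (-ν) * T ^ ν := by
    rw [Real.div_rpow hs.le hT.le, Real.rpow_neg hT.le ν, div_inv_eq_mul]; ring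
  have e3 : s⁻¹ = s ^ (-(1 / d) * p) * s ^ (-ν * (p - 1)) := by
    rw [← Real.rpow_add hs, neg_mul, neg_mul, hνp, ← Real.rpow_neg_one]
    congr 1; ring
  have e4 : T ^ (-ν) = T ^ (-ν * p) * T ^ (ν * (p - 1)) := by
    rw [← Real.rpow_add hT]; congr 1; ring
  have e5 : ell d (s / T) ^ (-β - 1) =
      ell d (s / T) ^ (-β * p) * ell d (s / T) ^ ((β - μ) * (p - 1)) := by
    rw [← Real.rpow_add h0]; congr 1; linarith
  rw [e1, e2, mul_rpow_four (by positivity) (by positivity) (by positivity) (by positivity),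
    mul_rpow_four (by positivity) (by positivity) (by positivity) (by positivity),
    ← Real.rpow_mul hs.le, ← Real.rpow_mul hs.le, ← Real.rpow_mul hT.le, ← Real.rpow_mul hT.le,
    ← Real.rpow_mul h0.le, ← Real.rpow_mul h0.le, e3, e4, e5]
  ring

/-- The coefficient of the Duhamel integral of `critW` with a singularity of order `κ`. -/
def critE (N : ℕ) (d p β l A c κ : ℝ) : ℝ :=
  (2 * A) ^ p * (majMass N * betaC κ l +
    c ^ (p - 1) * ellBetaC d κ β * (2 ^ (N + 2) * majMass N))

lemma critE_pos {c κ : ℝ} (hd : 0 < d) (hβ : 0 < β) (hA : 0 < A) (hc : 0 < c) (hl : l < 1)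
    (hκ : κ < 1) : 0 < critE N d p β l A c κ := by
  have := betaC_pos hκ hl
  have := ellBetaC_pos hd hκ hβ
  have := majMass_pos (N := N)
  unfold critE; positivity

/-- The product Bδ equals C₀δ^(1/2), so p - 1 copies of it leave a positive power of δ although B is
large. -/
lemma crit_coeff_eq {C₀ : ℝ} (hA : 0 < A) (hδ : 0 < δ) (hK : 0 < K) (hC₀ : 0 < C₀)
    (hB : B = C₀ * δ ^ (-(1 / 2 : ℝ))) :
    (2 * A * B) ^ p * (K * δ) ^ (p - 1) =
      (2 * A) ^ p * (C₀ * K) ^ (p - 1) * δ ^ ((p - 1) / 2) * B := by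
  have hB0 : 0 < B := by rw [hB]; positivity
  have e6 : B * (K * δ) = C₀ * K * δ ^ (1 / 2 : ℝ) := by
    have : δ ^ (-(1 / 2 : ℝ)) * δ = δ ^ (1 / 2 : ℝ) := by
      rw [← Real.rpow_add_one hδ.ne']; norm_num
    rw [hB, ← this]; ring
  have e7 : B ^ p * (K * δ) ^ (p - 1) = (B * (K * δ)) ^ (p - 1) * B := by
    rw [Real.mul_rpow hB0.le (by positivity),
      show B ^ p = B ^ (p - 1) * B by rw [← Real.rpow_add_one hB0.ne', sub_add_cancel]]
    ring
  rw [Real.mul_rpow (by positivity) hB0.le, mul_assoc, e7, e6,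
    Real.mul_rpow (x := C₀ * K) (by positivity) (by positivity), ← Real.rpow_mul hδ.le,
    show 1 / 2 * (p - 1) = (p - 1) / 2 by ring]
  ring

/-- The two parts of the profile reproduce themselves: the one constant in space through the Beta
integral, the potential through the logarithmic integral. Both gain δ^((p-1)/2). -/
lemma duhMaj_critW_le {C₀ κ t : ℝ} (hd : 1 < d) (hp : 1 < p) (hβ : 0 < β) (hT : 0 < T)
    (hA : 0 < A) (hδ : 0 < δ) (hδ1 : δ ≤ 1) (hK : 0 < K) (hC₀ : 0 < C₀)
    (hB : B = C₀ * δ ^ (-(1 / 2 : ℝ))) (hνp : ν * (p - 1) = 1 - p / d)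
    (hμp : μ * (p - 1) = 1) (hl : l = p / d + ε * p) (hl0 : 0 ≤ l) (hl1 : l < 1) (hεν : ε ≤ ν)
    (hκ0 : 0 ≤ κ) (hκ1 : κ < 1) {f : Sp N → ℝ≥0∞} (hfm : AEMeasurable f)
    (hf : ∀ y s, 0 < s → s < T → pot (s ^ (1 / d)) f y ≤
      ENNReal.ofReal (K * δ * ell d (s / T) ^ (β - μ) * (s / T) ^ (-ν)))
    (ht : 0 < t) (htT : t < T) (x : Sp N) :
    duhMaj d κ p (critW d β ε ν δ B A T f) x t ≤
      ENNReal.ofReal (critE N d p β l A (C₀ * K) κ * δ ^ ((p - 1) / 2) * t ^ (-κ) * T ^ (-ν)) *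
        critZ d β ε δ B T f x t := by
  have hd0 : 0 < d := by linarith
  have hB0 : 0 < B := by rw [hB]; positivity
  have h0 := ell_pos (d := d) (div_pos ht hT)
  have hb := betaC_pos hκ1 hl1
  have hb' := ellBetaC_pos hd0 hκ1 hβ
  have hm := majMass_pos (N := N)
  have hrt : 0 < t / T := by positivity
  have hE := critE_pos (N := N) (p := p) hd0 hβ hA (mul_pos hC₀ hK) hl1 hκ1
  set cW := (2 * A * δ) ^ p * T ^ (-ν - (ν * (p - 1) - ε * p)) with hcW
  set cV := (2 * A * B) ^ p * (K * δ) ^ (p - 1) * T ^ (-ν) with hcV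
  refine (duhMaj_le_add (w := fun s => ENNReal.ofReal (cW * s ^ (-l))) (V := fun y s =>
    ENNReal.ofReal (2 * (A * s ^ (-(1 / d)) * T ^ (-ν)) * (B * ell d (s / T) ^ (-β))) *
      pot (s ^ (1 / d)) f y) (by fun_prop)
    (fun s hs hst y => critW_rpow_le (by linarith) hT hA hδ hl f hs y) x).trans ?_
  rw [critZ, mul_add]
  refine add_le_add ?_ ?_
  · have h1 : ∫⁻ s in Ioo 0 t, ENNReal.ofReal ((t - s) ^ (-κ)) * ENNReal.ofReal (cW * s ^ (-l)) ≤
        ENNReal.ofReal cW * ENNReal.ofReal (betaC κ l * t ^ (1 - κ - l)) := by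
      refine le_trans (le_of_eq ?_)
        (mul_le_mul_right (lintegral_beta_le hκ0 hκ1 hl0 hl1 ht) (ENNReal.ofReal cW))
      rw [← lintegral_const_mul' _ _ ENNReal.ofReal_ne_top]
      congr 1; ext s
      rw [ENNReal.ofReal_mul (by positivity)]
      ring
    refine (mul_le_mul_left h1 _).trans ?_
    rw [← ENNReal.ofReal_mul (by positivity), ← ENNReal.ofReal_mul (by positivity),
      ← ENNReal.ofReal_mul (by positivity)]
    refine ENNReal.ofReal_le_ofReal ?_
    have e1 : t ^ (1 - κ - l) = t ^ (-κ) * t ^ (ν * (p - 1) - ε * p) := by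
      rw [← Real.rpow_add ht, hνp, hl]; congr 1; ring
    have e2 : T ^ (-ν - (ν * (p - 1) - ε * p)) =
        T ^ (-ν) * (T ^ (ν * (p - 1) - ε * p))⁻¹ := by
      rw [sub_eq_add_neg, Real.rpow_add hT, Real.rpow_neg hT.le (ν * (p - 1) - ε * p)]
    have e3 : (t / T) ^ (ν * (p - 1) - ε * p) ≤ (t / T) ^ (-ε) := by
      refine Real.rpow_le_rpow_of_exponent_ge hrt ((div_lt_one hT).2 htT).le ?_
      nlinarith
    have e4 : δ ^ p ≤ δ ^ ((p - 1) / 2) * δ := by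
      rw [← Real.rpow_add_one hδ.ne']
      exact Real.rpow_le_rpow_of_exponent_ge hδ hδ1 (by linarith)
    have e5 : (2 * A) ^ p * (majMass N * betaC κ l) ≤ critE N d p β l A (C₀ * K) κ := by
      unfold critE
      gcongr
      exact le_add_of_nonneg_right (by positivity)
    calc cW * (betaC κ l * t ^ (1 - κ - l)) * majMass N
        = ((2 * A) ^ p * (majMass N * betaC κ l)) * δ ^ p * t ^ (-κ) * T ^ (-ν) *
          (t / T) ^ (ν * (p - 1) - ε * p) := by
          rw [hcW, e1, e2, Real.mul_rpow (by positivity) hδ.le, Real.div_rpow ht.le hT.le,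
            div_eq_mul_inv]
          ring
      _ ≤ critE N d p β l A (C₀ * K) κ * (δ ^ ((p - 1) / 2) * δ) * t ^ (-κ) * T ^ (-ν) * (t / T) ^ (-ε) := by
          gcongr
      _ = _ := by ring
  · refine (duhMaj_le_pot hd hfm (c := fun s => ENNReal.ofReal cV *
      ENNReal.ofReal (s⁻¹ * ell d (s / T) ^ (-β - 1))) (by unfold ell; fun_prop)
      (fun s hs hst y => crit_rpow_le hp hT hA hB0 hδ hK hνp hμp hs (hf y s hs (hst.trans htT))) x).trans ?_
    have h1 : ∫⁻ s in Ioo 0 t, ENNReal.ofReal ((t - s) ^ (-κ)) *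
        (ENNReal.ofReal cV * ENNReal.ofReal (s⁻¹ * ell d (s / T) ^ (-β - 1))) ≤
        ENNReal.ofReal cV *
          ENNReal.ofReal (ellBetaC d κ β * t ^ (-κ) * ell d (t / T) ^ (-β)) := by
      refine le_trans (le_of_eq ?_) (mul_le_mul_right
        (lintegral_sub_rpow_ell_le hd0 hκ0 hκ1 hβ hT ht htT.le) (ENNReal.ofReal cV))
      rw [← lintegral_const_mul' _ _ ENNReal.ofReal_ne_top]
      congr 1; ext s
      ring
    refine (mul_le_mul_left h1 _).trans ?_
    rw [← mul_assoc, ← mul_assoc, ← ENNReal.ofReal_mul (by positivity),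
      ← ENNReal.ofReal_mul (by positivity),
      ← ENNReal.ofReal_mul (by positivity)]
    refine mul_le_mul_left (ENNReal.ofReal_le_ofReal ?_) _
    have e4 := crit_coeff_eq (p := p) hA hδ hK hC₀ hB
    have e5 : (2 * A) ^ p * ((C₀ * K) ^ (p - 1) * ellBetaC d κ β * (2 ^ (N + 2) * majMass N)) ≤ critE N d p β l A (C₀ * K) κ := by
      unfold critE
      gcongr
      exact le_add_of_nonneg_left (by positivity)
    calc cV * (ellBetaC d κ β * t ^ (-κ) * ell d (t / T) ^ (-β)) * (2 ^ (N + 2) * majMass N)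
        = ((2 * A) ^ p * ((C₀ * K) ^ (p - 1) * ellBetaC d κ β * (2 ^ (N + 2) * majMass N))) * δ ^ ((p - 1) / 2) *
          t ^ (-κ) * T ^ (-ν) * (B * ell d (t / T) ^ (-β)) := by
          rw [hcV, e4]; ring
      _ ≤ _ := by gcongr

end Critical

/-- Existence at the critical exponent, under a bound on the integrals of `Φ(T^{N/d} |φ|)` over
small balls. -/
theorem exists_isSolution_of_lintegral_Phi_le (hN : 1 ≤ N) {d p β : ℝ} (hd : 1 < d) (hp : 1 < p)
    (hpp : p = pHJ N d) (hβ : 0 < β) :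
    ∃ δ : ℝ, 0 < δ ∧ ∃ C : ℝ, 0 < C ∧ ∀ (T : ℝ) (φ : Sp N → ℝ), 0 < T →
      AEStronglyMeasurable φ volume →
      (∀ (z : Sp N) (σ : ℝ), 0 < σ → σ < T ^ (1 / d) →
        ∫⁻ y in ball z σ, ENNReal.ofReal (Phi β (T ^ ((N : ℝ) / d) * |φ y|)) ≤
          ENNReal.ofReal (δ * T ^ ((N : ℝ) / d) *
            Real.log (Real.exp 1 + (σ * T ^ (-(1 / d)))⁻¹) ^ (β - N / (d - p)))) →
      ∃ u : Sp N → ℝ → ℝ, IsSolution d p φ (ENNReal.ofReal T) u ∧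
        ∀ (x : Sp N) (t : ℝ), 0 < t → t < T →
          |u x t| ≤ C * t ^ (-((N : ℝ) / d)) *
            |Real.log (t / (2 * T))| ^ (-((N : ℝ) / d)) ∧
          ‖gradient (fun y => u y t) x‖ ≤ C * t ^ (-((N : ℝ) / d) - 1 / d) *
            |Real.log (t / (2 * T))| ^ (-((N : ℝ) / d)) := by
  obtain ⟨η, hη, Cs, hCs, hsol⟩ := exists_isSolution_of_isMajorant hN hd hp
  obtain ⟨A₀, hA₀, -, hH⟩ := exists_kerBound_heatKernel hN hd
  have hd0 : 0 < d := by linarith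
  have hp1 : 0 < p - 1 := by linarith
  have hp0 : 0 < p := by linarith
  have hN0 : 0 < (N : ℝ) := by exact_mod_cast hN
  have hdi : 1 / d < 1 := by rw [div_lt_one hd0]; exact hd
  have hdi0 : 0 < 1 / d := by positivity
  have hpN : p + N * (p - 1) = d := eq_pHJ_iff.1 hpp
  have hpd : p < d := by nlinarith
  have hm := majMass_pos (N := N)
  have hK := potC_pos (N := N)
  set m := majMass N with hmdef
  set K := potC N with hKdef
  set ν : ℝ := N / d with hν
  have hν0 : 0 < ν := by positivity
  have hνp : ν * (p - 1) = 1 - p / d := by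
    rw [hν]; field_simp; linarith
  set μ : ℝ := N / (d - p) with hμ
  have hμp : μ * (p - 1) = 1 := by
    rw [hμ, div_mul_eq_mul_div, div_eq_one_iff_eq (by linarith)]; linarith
  have hμ0 : 0 < μ := div_pos hN0 (by linarith)
  have hνμ : ν ≤ μ := by
    rw [hν, hμ]
    exact div_le_div_of_nonneg_left hN0.le (by linarith) (by linarith)
  -- Half of the available room: l = p/d + εp = 1 - ν(p-1)/2 < 1, while ε < ν.
  set ε : ℝ := ν * (p - 1) / (2 * p) with hε
  have hε0 : 0 < ε := by positivity
  have hεp : ε * p = ν * (p - 1) / 2 := by rw [hε]; field_simp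
  have hεν : ε < ν := by
    rw [hε, div_lt_iff₀ (by positivity)]
    nlinarith
  set l : ℝ := p / d + ε * p with hl
  have hl0 : 0 ≤ l := by positivity
  have hl1 : l < 1 := by
    have : 0 < ν * (p - 1) := by positivity
    linarith
  obtain ⟨C₀, hC₀, hlog⟩ := exists_log_rpow_le hd0 hβ hε0
  obtain ⟨C₁, hC₁, hweight⟩ := exists_weight_le hd0 hν0 hνμ hεν
  set A : ℝ := A₀ * (m + 1) with hA
  have hA0 : 0 < A := by positivity
  set E : ℝ → ℝ := critE N d p β l A (C₀ * K) with hE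
  have hE0 : ∀ κ, κ < 1 → 0 < E κ := fun κ hκ => critE_pos hd0 hβ hA0 (mul_pos hC₀ hK) hl1 hκ
  obtain ⟨δ₀, hδ₀, hδ₀η⟩ := exists_rpow_le (e := (p - 1) / 2) (η := η * A) (by positivity)
    (by positivity) (hE0 (1 / d) hdi)
  set δ : ℝ := min δ₀ 1 with hδdef
  have hδ : 0 < δ := lt_min hδ₀ one_pos
  have hδ1 : δ ≤ 1 := min_le_right _ _
  have hδη : E (1 / d) * δ ^ ((p - 1) / 2) ≤ η * A := by
    have := hE0 (1 / d) hdi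
    refine le_trans ?_ hδ₀η
    gcongr
    exact min_le_left _ _
  set B : ℝ := C₀ * δ ^ (-(1 / 2 : ℝ)) with hB
  have hB0 : 0 < B := by positivity
  set Q : ℝ := (δ + B * (K * δ)) * C₁ with hQdef
  have hQ0 : 0 < Q := by positivity
  refine ⟨δ, hδ, Cs * (m + 1 + E 0) * Q + 2 * A * Q, by
    have := hE0 0 one_pos
    positivity, fun T φ hT hφ hball => ?_⟩
  let f : Sp N → ℝ≥0∞ := fun y => ENNReal.ofReal (Phi β (T ^ ν * |φ y|))
  have hfm : AEMeasurable f := by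
    have := hφ.aemeasurable
    simp only [f, Phi]
    fun_prop
  set Z : Sp N → ℝ → ℝ≥0∞ := critZ d β ε δ B T f with hZdef
  set W : Sp N → ℝ → ℝ≥0∞ := critW d β ε ν δ B A T f with hWdef
  have hW : ∀ x t, W x t = ENNReal.ofReal (A * t ^ (-(1 / d)) * T ^ (-ν)) * Z x t := fun _ _ => rfl
  have hr : ∀ {t : ℝ}, 0 < t → 0 < t / T := fun ht => by positivity
  have hr1 : ∀ {t : ℝ}, t < T → t / T < 1 := fun ht => (div_lt_one hT).2 ht
  have hell : ∀ {t : ℝ}, 0 < t → 0 < ell d (t / T) := fun ht => ell_pos (hr ht)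
  have hpotφ : ∀ x t, 0 < t → t < T → pot (t ^ (1 / d)) (fun y => ‖φ y‖ₑ) x ≤
      ENNReal.ofReal (T ^ (-ν) * (m + 1)) * Z x t := fun x t ht htT =>
    pot_enorm_le hβ hδ hT ht (hlog δ (t / T) hδ hδ1 (hr ht) (hr1 htT).le) hB0.le hφ x
  have hpotf : ∀ x t, 0 < t → t < T → pot (t ^ (1 / d)) f x ≤
      ENNReal.ofReal (K * δ * ell d (t / T) ^ (β - μ) * (t / T) ^ (-ν)) := fun x t ht htT => by
    refine (pot_le_rpow (by positivity) le_rfl hfm (fun z => hball z _ (by positivity)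
      (Real.rpow_lt_rpow ht.le htT hdi0)) x).trans (le_of_eq ?_)
    have e1 : (t ^ (1 / d) * T ^ (-(1 / d)))⁻¹ = (t / T) ^ (-(1 / d)) := by
      rw [Real.div_rpow ht.le hT.le, Real.rpow_neg ht.le, Real.rpow_neg hT.le]
      field_simp
    have e2 : (t / T) ^ (-ν) = t ^ (-ν) * T ^ ν := by
      rw [Real.div_rpow ht.le hT.le, Real.rpow_neg hT.le, div_inv_eq_mul]
    have e3 : (t ^ (1 / d)) ^ (-(N : ℝ)) = t ^ (-ν) := by
      rw [← Real.rpow_mul ht.le, hν]; congr 1; ring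
    rw [e1, e2, e3, ell]
    congr 1; ring
  have hZ : ∀ x t, 0 < t → t < T → Z x t ≤
      ENNReal.ofReal (Q * ((t / T) ^ (-ν) * |Real.log (t / T / 2)| ^ (-ν))) := by
    intro x t ht htT
    have h0 := hell ht
    have h1 := hr ht
    refine (add_le_add_right (mul_le_mul_right (hpotf x t ht htT) _) _).trans ?_
    rw [← ENNReal.ofReal_mul (by positivity), ← ENNReal.ofReal_add (by positivity) (by positivity)]
    refine ENNReal.ofReal_le_ofReal ?_
    have e1 : ell d (t / T) ^ (-μ) = ell d (t / T) ^ (-β) * ell d (t / T) ^ (β - μ) := by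
      rw [← Real.rpow_add h0]; congr 1; ring
    calc _ = δ * (t / T) ^ (-ε) + B * (K * δ) * (ell d (t / T) ^ (-μ) * (t / T) ^ (-ν)) := by
          rw [e1]; ring
      _ ≤ (δ + B * (K * δ)) * (t / T) ^ (-ε) +
          (δ + B * (K * δ)) * (ell d (t / T) ^ (-μ) * (t / T) ^ (-ν)) := by
          gcongr
          · exact le_add_of_nonneg_right (by positivity)
          · exact le_add_of_nonneg_left hδ.le
      _ = (δ + B * (K * δ)) * ((t / T) ^ (-ε) + ell d (t / T) ^ (-μ) * (t / T) ^ (-ν)) := by ring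
      _ ≤ (δ + B * (K * δ)) * (C₁ * ((t / T) ^ (-ν) * |Real.log (t / T / 2)| ^ (-ν))) := by
          gcongr
          exact hweight _ h1 (hr1 htT)
      _ = _ := by rw [hQdef]; ring
  have hduh : ∀ κ, 0 ≤ κ → κ < 1 → ∀ x t, 0 < t → t < T → duhMaj d κ p W x t ≤
      ENNReal.ofReal (E κ * δ ^ ((p - 1) / 2) * t ^ (-κ) * T ^ (-ν)) * Z x t :=
    fun κ hκ0 hκ1 x t ht htT => duhMaj_critW_le hd hp hβ hT hA0 hδ hδ1 hK hC₀ hB hνp hμp hl hl0 hl1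
      hεν.le hκ0 hκ1 hfm hpotf ht htT x
  have hδp : δ ^ ((p - 1) / 2) ≤ 1 := Real.rpow_le_one hδ.le hδ1 (by positivity)
  have hduh0 : ∀ x t, 0 < t → t < T → duhMaj d 0 p W x t ≤
      ENNReal.ofReal (T ^ (-ν) * E 0) * Z x t := fun x t ht htT => by
    refine (hduh 0 le_rfl one_pos x t ht htT).trans
      (mul_le_mul_left (ENNReal.ofReal_le_ofReal ?_) _)
    have := hE0 0 one_pos
    rw [neg_zero, Real.rpow_zero, mul_one]
    calc E 0 * δ ^ ((p - 1) / 2) * T ^ (-ν) ≤ E 0 * 1 * T ^ (-ν) := by gcongr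
      _ = _ := by ring
  have hrange : ∀ {t}, ENNReal.ofReal t < ENNReal.ofReal T → t < T := fun ht =>
    (ENNReal.ofReal_lt_ofReal_iff hT).1 ht
  have hZb : ∀ τ : ℝ, 0 < τ → ∃ M : ℝ≥0∞, M ≠ ⊤ ∧ ∀ (x : Sp N) (t : ℝ), τ < t → t < T →
      Z x t ≤ M := by
    intro τ hτ
    have hl2 : 0 < Real.log 2 := Real.log_pos one_lt_two
    refine ⟨ENNReal.ofReal (Q * ((τ / T) ^ (-ν) * Real.log 2 ^ (-ν))), ENNReal.ofReal_ne_top,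
      fun x t ht htT => (hZ x t (hτ.trans ht) htT).trans (ENNReal.ofReal_le_ofReal ?_)⟩
    have ht0 := hτ.trans ht
    have h1 : (t / T) ^ (-ν) ≤ (τ / T) ^ (-ν) :=
      rpow_neg_le_rpow_neg (by positivity) (by gcongr) hν0.le
    have h2 : Real.log 2 ≤ |Real.log (t / T / 2)| := by
      have h3 : Real.log (t / T / 2) ≤ -Real.log 2 := by
        rw [← Real.log_inv]
        have := hr1 htT
        exact Real.log_le_log (by have := hr ht0; positivity) (by linarith)
      exact (le_neg.2 h3).trans (neg_le_abs _)
    have h3 : |Real.log (t / T / 2)| ^ (-ν) ≤ Real.log 2 ^ (-ν) :=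
      Real.rpow_le_rpow_of_nonpos hl2 h2 (neg_nonpos.2 hν0.le)
    gcongr
  obtain ⟨u, hu, hub⟩ := hsol (ENNReal.ofReal T) φ W
    { meas := hφ
      pot_bdd := fun τ hτ => by
        obtain ⟨M, hM, h⟩ := hZb τ hτ
        exact ⟨_, ENNReal.mul_ne_top ENNReal.ofReal_ne_top hM, fun x t ht htT =>
          (hpotφ x t (hτ.trans ht) (hrange htT)).trans (mul_le_mul_right (h x t ht (hrange htT)) _)⟩
      initial := fun x t ht htT => by
        refine (enorm_initial_le hH φ ht).trans ((mul_le_mul_right (mul_le_mul_right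
          (hpotφ x t ht (hrange htT)) _) _).trans (le_of_eq ?_))
        rw [hW, ← mul_assoc, ← mul_assoc, ← ENNReal.ofReal_mul hA₀.le,
          ← ENNReal.ofReal_mul (by positivity), hA]
        congr 2
        ring
      bdd := fun τ hτ => by
        obtain ⟨M, hM, h⟩ := hZb τ hτ
        refine ⟨ENNReal.ofReal (A * τ ^ (-(1 / d)) * T ^ (-ν)) * M,
          ENNReal.mul_ne_top ENNReal.ofReal_ne_top hM, fun x t ht htT => ?_⟩
        have h1 := rpow_neg_le_rpow_neg hτ ht hdi0.le
        rw [hW]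
        exact mul_le_mul' (ENNReal.ofReal_le_ofReal (by gcongr)) (h x t ht (hrange htT))
      small := fun x t ht htT => by
        refine (hduh (1 / d) hdi0.le hdi x t ht (hrange htT)).trans ?_
        rw [hW, ← mul_assoc, ← ENNReal.ofReal_mul hη.le]
        refine mul_le_mul_left (ENNReal.ofReal_le_ofReal ?_) _
        calc E (1 / d) * δ ^ ((p - 1) / 2) * t ^ (-(1 / d)) * T ^ (-ν)
            ≤ η * A * t ^ (-(1 / d)) * T ^ (-ν) := by gcongr
          _ = _ := by ring
      duh_bdd := fun τ hτ => by
        obtain ⟨M, hM, h⟩ := hZb τ hτ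
        exact ⟨_, ENNReal.mul_ne_top ENNReal.ofReal_ne_top hM, fun x t ht htT =>
          (hduh0 x t (hτ.trans ht) (hrange htT)).trans
            (mul_le_mul_right (h x t ht (hrange htT)) _)⟩ }
  refine ⟨u, hu, fun x t ht htT => ?_⟩
  obtain ⟨h1, h2⟩ := hub x t ht ((ENNReal.ofReal_lt_ofReal_iff hT).2 htT)
  have hE00 := hE0 0 one_pos
  have hrt := hr ht
  have e1 : t / (2 * T) = t / T / 2 := by rw [mul_comm, div_div]
  have e2 : t ^ (-ν) = T ^ (-ν) * (t / T) ^ (-ν) := by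
    rw [← Real.mul_rpow hT.le hrt.le, mul_div_cancel₀ _ hT.ne']
  set Λ : ℝ := |Real.log (t / T / 2)| ^ (-ν) with hΛ
  have hΛ0 : 0 ≤ Λ := by positivity
  constructor
  · have h3 : ‖u x t‖ₑ ≤ ENNReal.ofReal (Cs * (m + 1 + E 0) * Q * t ^ (-ν) * Λ) := by
      refine h1.trans ?_
      calc _ ≤ ENNReal.ofReal Cs * (ENNReal.ofReal (T ^ (-ν) * (m + 1)) * Z x t +
            ENNReal.ofReal (T ^ (-ν) * E 0) * Z x t) := by
            gcongr
            exacts [hpotφ x t ht htT, hduh0 x t ht htT]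
        _ = ENNReal.ofReal (Cs * (m + 1 + E 0) * T ^ (-ν)) * Z x t := by
            rw [← add_mul, ← ENNReal.ofReal_add (by positivity) (by positivity), ← mul_assoc,
              ← ENNReal.ofReal_mul hCs.le]
            congr 2; ring
        _ ≤ ENNReal.ofReal (Cs * (m + 1 + E 0) * T ^ (-ν)) *
            ENNReal.ofReal (Q * ((t / T) ^ (-ν) * Λ)) := by
            gcongr
            exact hZ x t ht htT
        _ = _ := by
            rw [← ENNReal.ofReal_mul (by positivity), e2]
            congr 1; ring
    rw [← ofReal_norm, ENNReal.ofReal_le_ofReal_iff (by positivity), Real.norm_eq_abs] at h3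
    rw [e1, ← hΛ]
    refine h3.trans ?_
    gcongr
    exact le_add_of_nonneg_right (by positivity)
  · have h3 : ‖gradient (fun y => u y t) x‖ₑ ≤
        ENNReal.ofReal (2 * A * Q * t ^ (-ν - 1 / d) * Λ) := by
      refine h2.trans ?_
      calc 2 * W x t ≤ 2 * (ENNReal.ofReal (A * t ^ (-(1 / d)) * T ^ (-ν)) *
            ENNReal.ofReal (Q * ((t / T) ^ (-ν) * Λ))) := by
            rw [hW]
            gcongr
            exact hZ x t ht htT
        _ = _ := by
            rw [show (2 : ℝ≥0∞) = ENNReal.ofReal 2 by simp, ← ENNReal.ofReal_mul (by positivity),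
              ← ENNReal.ofReal_mul (by positivity), sub_eq_add_neg, Real.rpow_add ht, e2]
            congr 1; ring
    rw [← ofReal_norm, ENNReal.ofReal_le_ofReal_iff (by positivity)] at h3
    rw [e1, ← hΛ]
    refine h3.trans ?_
    gcongr
    exact le_add_of_nonneg_left (by positivity)

/-! ### The weight Φ, its inverse, and the sharp condition of (b) -/

lemma Phi_nonneg {β s : ℝ} (hs : 0 ≤ s) : 0 ≤ Phi β s := by
  have := log_exp_add_pos hs
  unfold Phi; positivity

lemma Phi_mono {β s s' : ℝ} (hβ : 0 < β) (hs : 0 ≤ s) (h : s ≤ s') : Phi β s ≤ Phi β s' := by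
  have h1 := log_exp_add_pos hs
  have h2 := log_exp_add_mono hs h
  have h3 := hs.trans h
  unfold Phi
  gcongr

lemma Phi_mul_le {β c s : ℝ} (hβ : 0 < β) (hc : 0 ≤ c) (hc1 : c ≤ 1) (hs : 0 ≤ s) :
    Phi β (c * s) ≤ c * Phi β s := by
  have h2 := log_exp_add_mono (mul_nonneg hc hs) (mul_le_of_le_one_left hs hc1)
  have h1 := log_exp_add_pos (mul_nonneg hc hs)
  unfold Phi
  rw [mul_assoc]
  gcongr

lemma Phi_add_le {β a b : ℝ} (hβ : 0 < β) (ha : 0 ≤ a) (hb : 0 ≤ b) :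
    Phi β (a + b) ≤ Phi β (2 * a) + Phi β (2 * b) := by
  have h1 := Phi_nonneg (β := β) (mul_nonneg zero_le_two ha)
  have h2 := Phi_nonneg (β := β) (mul_nonneg zero_le_two hb)
  rcases le_total a b with h | h
  · linarith [Phi_mono hβ (add_nonneg ha hb) (show a + b ≤ 2 * b by linarith)]
  · linarith [Phi_mono hβ (add_nonneg ha hb) (show a + b ≤ 2 * a by linarith)]

lemma exists_Phi_eq {β a : ℝ} (hβ : 0 < β) (ha : 0 ≤ a) : ∃ s ∈ Ici (0 : ℝ), Phi β s = a := by
  have hc : ContinuousOn (Phi β) (Icc 0 a) := by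
    unfold Phi
    refine continuousOn_id.mul (ContinuousOn.rpow_const (ContinuousOn.log (by fun_prop) ?_) ?_)
    · intro x hx
      have := Real.exp_pos 1
      linarith [hx.1]
    · exact fun x hx => Or.inr hβ.le
  have h0 : Phi β 0 = 0 := by simp [Phi]
  have h1 : a ≤ Phi β a := by
    have := Real.one_le_rpow (one_le_log_exp_add ha) hβ.le
    unfold Phi
    nlinarith
  obtain ⟨s, hs, h⟩ := intermediate_value_Icc ha hc ⟨by rw [h0]; exact ha, h1⟩
  exact ⟨s, hs.1, h⟩

lemma le_Phi_of_PhiInv_le {β a b : ℝ} (hβ : 0 < β) (ha : 0 ≤ a) (h : PhiInv β a ≤ b) :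
    a ≤ Phi β b := by
  have h1 := exists_Phi_eq hβ ha
  have h2 : 0 ≤ PhiInv β a := Function.invFunOn_mem h1
  have h3 : Phi β (PhiInv β a) = a := Function.invFunOn_eq h1
  rw [← h3]
  exact Phi_mono hβ h2 h

lemma log_exp_add_rpow_neg_le (hN : 1 ≤ N) {s : ℝ} (hs : 0 < s) :
    Real.log (Real.exp 1 + s ^ (-(N : ℝ))) ≤ (N + 1) * Real.log (Real.exp 1 + s⁻¹) := by
  have hN1 : (1 : ℝ) ≤ N := by exact_mod_cast hN
  rcases le_total s 1 with h | h
  · have := log_exp_add_rpow_le (x := s⁻¹) (m := N) ((one_le_inv₀ hs).2 h) (by positivity)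
    rwa [Real.inv_rpow hs.le, ← Real.rpow_neg hs.le] at this
  · have h1 : s ^ (-(N : ℝ)) ≤ 1 := Real.rpow_le_one_of_one_le_of_nonpos h (by simp)
    have h2 := one_le_log_exp_add (x := s⁻¹) (by positivity)
    have h3 : Real.log (Real.exp 1 + s ^ (-(N : ℝ))) ≤ 2 := by
      rw [Real.log_le_iff_le_exp (by positivity), show (2 : ℝ) = 1 + 1 by norm_num, Real.exp_add]
      nlinarith [Real.add_one_le_exp (1 : ℝ)]
    nlinarith

/-- The logarithm of ρ(s) is comparable with log(e+1/s), so Φ multiplies ρ by at most a constant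
times the β-th power of that logarithm. -/
lemma Phi_rho_le (hN : 1 ≤ N) {d p β s : ℝ} (hβ : 0 < β) (hdp : p < d) (hs : 0 < s) :
    Phi β (rho N d p s) ≤ (N + 1) ^ β * s ^ (-(N : ℝ)) *
      Real.log (Real.exp 1 + s⁻¹) ^ (β - N / (d - p)) := by
  have hL := one_le_log_exp_add (x := s⁻¹) (by positivity)
  set Λ := Real.log (Real.exp 1 + s⁻¹) with hΛ
  have hΛ0 : 0 < Λ := by linarith
  have hdp' : 0 < d - p := by linarith
  have hρ0 : 0 ≤ rho N d p s := by unfold rho; positivity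
  have hρ : rho N d p s ≤ s ^ (-(N : ℝ)) := by
    unfold rho
    refine mul_le_of_le_one_right (by positivity) (Real.rpow_le_one_of_one_le_of_nonpos hL ?_)
    simp only [Left.neg_nonpos_iff]; positivity
  have h1 : Real.log (Real.exp 1 + rho N d p s) ≤ (N + 1) * Λ :=
    (log_exp_add_mono hρ0 hρ).trans (log_exp_add_rpow_neg_le hN hs)
  have h2 := log_exp_add_pos hρ0
  calc Phi β (rho N d p s) ≤ rho N d p s * ((N + 1) * Λ) ^ β := by
        unfold Phi; gcongr
    _ = _ := by
        rw [Real.mul_rpow (by positivity) hΛ0.le, rho, ← hΛ, sub_eq_add_neg β, Real.rpow_add hΛ0]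
        ring

theorem exists_isSolution_of_PhiInv_le (hN : 1 ≤ N) {d p β : ℝ} (hd : 1 < d) (hp : 1 < p)
    (hpp : p = pHJ N d) (hβ : 0 < β) :
    ∃ γ : ℝ, 0 < γ ∧ ∃ C : ℝ, 0 < C ∧
        ∀ (T : ℝ) (φ : Sp N → ℝ), 0 < T → LocallyIntegrable φ volume →
          (∀ (x : Sp N) (σ : ℝ), 0 < σ → σ < T ^ (1 / d) →
            IntegrableOn (fun y => Phi β (T ^ ((N : ℝ) / d) * |φ y|)) (ball x σ) volume ∧
            PhiInv β (⨍ y in ball x σ, Phi β (T ^ ((N : ℝ) / d) * |φ y|)) ≤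
              γ * rho N d p (σ * T ^ (-(1 / d)))) →
          ∃ u : Sp N → ℝ → ℝ, IsSolution d p φ (ENNReal.ofReal T) u ∧
            ∀ (x : Sp N) (t : ℝ), 0 < t → t < T →
              |u x t| ≤ C * t ^ (-((N : ℝ) / d)) *
                |Real.log (t / (2 * T))| ^ (-((N : ℝ) / d)) ∧
              ‖gradient (fun y => u y t) x‖ ≤ C * t ^ (-((N : ℝ) / d) - 1 / d) *
                |Real.log (t / (2 * T))| ^ (-((N : ℝ) / d)) := by
  obtain ⟨δ, hδ, C, hC, hsol⟩ := exists_isSolution_of_lintegral_Phi_le hN hd hp hpp hβ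
  have hd0 : 0 < d := by linarith
  have hN1 : (1 : ℝ) ≤ N := by exact_mod_cast hN
  have hpd : p < d := by nlinarith [eq_pHJ_iff.1 hpp]
  set v := (volume (ball (0 : Sp N) 1)).toReal with hv
  have hv0 : 0 < v :=
    ENNReal.toReal_pos (measure_ball_pos _ _ one_pos).ne' measure_ball_lt_top.ne
  -- γ ≤ 1 allows Φ(γρ) ≤ γΦ(ρ); the second entry makes the resulting mass on a ball at most the
  -- admissible δ.
  set γ : ℝ := min 1 (δ / ((N + 1) ^ β * v)) with hγ
  have hγ0 : 0 < γ := lt_min one_pos (by positivity)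
  have hγδ : γ * ((N + 1) ^ β * v) ≤ δ := by
    rw [← le_div_iff₀ (by positivity)]; exact min_le_right _ _
  refine ⟨γ, hγ0, C, hC, fun T φ hT hφ h => hsol T φ hT hφ.aestronglyMeasurable
    fun z σ hσ hσT => ?_⟩
  obtain ⟨hi, hle⟩ := h z σ hσ hσT
  have hnn : ∀ y, 0 ≤ Phi β (T ^ ((N : ℝ) / d) * |φ y|) := fun y => Phi_nonneg (by positivity)
  have hvol : volume.real (ball z σ) = σ ^ (N : ℝ) * v := by
    rw [Measure.real, volume_ball_eq hσ, ENNReal.toReal_mul, ENNReal.toReal_ofReal (by positivity)]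
  set s := σ * T ^ (-(1 / d)) with hs
  have hs0 : 0 < s := by positivity
  have hL := log_exp_add_pos (x := s⁻¹) (by positivity)
  have hρ0 : 0 ≤ rho N d p s := by unfold rho; positivity
  have hav : ⨍ y in ball z σ, Phi β (T ^ ((N : ℝ) / d) * |φ y|) =
      (σ ^ (N : ℝ) * v)⁻¹ * ∫ y in ball z σ, Phi β (T ^ ((N : ℝ) / d) * |φ y|) := by
    rw [setAverage_eq, hvol, smul_eq_mul]
  have hav0 : 0 ≤ ⨍ y in ball z σ, Phi β (T ^ ((N : ℝ) / d) * |φ y|) := by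
    rw [hav]
    exact mul_nonneg (by positivity) (integral_nonneg hnn)
  have h1 := ((le_Phi_of_PhiInv_le hβ hav0 hle).trans
    (Phi_mul_le hβ hγ0.le (min_le_left _ _) hρ0)).trans
    (mul_le_mul_of_nonneg_left (Phi_rho_le hN hβ hpd hs0) hγ0.le)
  rw [← ofReal_integral_eq_lintegral_ofReal hi (Filter.Eventually.of_forall hnn)]
  refine ENNReal.ofReal_le_ofReal ?_
  rw [hav, inv_mul_le_iff₀ (by positivity)] at h1
  refine h1.trans ?_
  have e1 : σ ^ (N : ℝ) * s ^ (-(N : ℝ)) = T ^ ((N : ℝ) / d) := by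
    rw [hs, Real.mul_rpow hσ.le (by positivity), ← mul_assoc, ← Real.rpow_add hσ,
      ← Real.rpow_mul hT.le]
    simp only [add_neg_cancel, Real.rpow_zero, one_mul]
    congr 1; ring
  calc _ = γ * ((N + 1) ^ β * v) * (σ ^ (N : ℝ) * s ^ (-(N : ℝ))) *
        Real.log (Real.exp 1 + s⁻¹) ^ (β - N / (d - p)) := by ring
    _ ≤ δ * T ^ ((N : ℝ) / d) * Real.log (Real.exp 1 + s⁻¹) ^ (β - N / (d - p)) := by
        rw [e1]; gcongr

/-! ### Initial data with a critical point singularity -/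

lemma ell_one (s : ℝ) : ell 1 s = Real.log (Real.exp 1 + s⁻¹) := by
  rw [ell, div_one, Real.rpow_neg_one]

/-- The radial profile `s^{-N} [log (e + 1/s)]^{-β-1}`. -/
def sing (N : ℕ) (β s : ℝ) : ℝ := s ^ (-(N : ℝ)) * ell 1 s ^ (-β - 1)

lemma measurable_sing (N : ℕ) (β : ℝ) : Measurable (sing N β) := by
  unfold sing ell; fun_prop

lemma sing_nonneg {β s : ℝ} (hs : 0 ≤ s) : 0 ≤ sing N β s := by
  have := log_exp_add_pos (x := s⁻¹) (by positivity)
  rw [sing, ell_one]; positivity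

lemma lintegral_ball_fun_norm_le (hN : 1 ≤ N) {k : ℝ → ℝ} (hk : Measurable k)
    (hk0 : ∀ r, 0 ≤ r → 0 ≤ k r) {σ M : ℝ} (hM : 0 ≤ M)
    (h : ∫⁻ r in Ioo 0 σ, ENNReal.ofReal (r ^ (N - 1) * k r) ≤ ENNReal.ofReal M) :
    ∫⁻ y in ball (0 : Sp N) σ, ENNReal.ofReal (k ‖y‖) ≤
      ENNReal.ofReal (N * ((volume (ball (0 : Sp N) 1)).toReal * M)) := by
  have : Nonempty (Fin N) := ⟨⟨0, hN⟩⟩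
  have hfin : Module.finrank ℝ (Sp N) = N := by simp
  have hg0 : ∀ r ∈ Ioo 0 σ, 0 ≤ r ^ (N - 1) * k r := fun r hr =>
    mul_nonneg (pow_nonneg hr.1.le _) (hk0 r hr.1.le)
  have hg0' : 0 ≤ᵐ[volume.restrict (Ioo 0 σ)] fun r => r ^ (N - 1) * k r :=
    (ae_restrict_mem measurableSet_Ioo).mono hg0
  have hgi : IntegrableOn (fun r => r ^ (N - 1) * k r) (Ioo 0 σ) := by
    refine ⟨(by fun_prop : Measurable fun r => r ^ (N - 1) * k r).aestronglyMeasurable, ?_⟩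
    rw [hasFiniteIntegral_iff_ofReal hg0']
    exact h.trans_lt ENNReal.ofReal_lt_top
  have hgM : ∫ r in Ioo 0 σ, r ^ (N - 1) * k r ≤ M := by
    rw [← ofReal_integral_eq_lintegral_ofReal hgi hg0'] at h
    exact (ENNReal.ofReal_le_ofReal_iff hM).1 h
  have hi : IntegrableOn (fun y : Sp N => k ‖y‖) (ball 0 σ) := by
    rw [integrableOn_fun_norm_addHaar, hfin]
    exact hgi
  rw [← ofReal_integral_eq_lintegral_ofReal hi
    (Filter.Eventually.of_forall fun y => hk0 _ (norm_nonneg y))]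
  refine ENNReal.ofReal_le_ofReal ?_
  have e1 : ∫ y in ball (0 : Sp N) σ, k ‖y‖ = ∫ y : Sp N, (Iio σ).indicator k ‖y‖ := by
    rw [← integral_indicator measurableSet_ball]
    congr 1; ext y
    simp [indicator]
  have e2 : ∫ r in Ioi (0 : ℝ), r ^ (N - 1) • (Iio σ).indicator k r =
      ∫ r in Ioo 0 σ, r ^ (N - 1) * k r := by
    have : (fun r : ℝ => r ^ (N - 1) • (Iio σ).indicator k r) =
        (Iio σ).indicator fun r => r ^ (N - 1) * k r := by
      ext r; by_cases hr : r < σ <;> simp [hr]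
    rw [this, setIntegral_indicator measurableSet_Iio, Ioi_inter_Iio]
  rw [e1, integral_fun_norm_addHaar, hfin, e2, nsmul_eq_mul, smul_eq_mul]
  exact mul_le_mul_of_nonneg_left (mul_le_mul_of_nonneg_left hgM ENNReal.toReal_nonneg)
    (Nat.cast_nonneg N)

/-- In polar coordinates r^(N-1) r^(-N) = r⁻¹, and the logarithmic integral applies with d = 1 and T
= 1. -/
lemma lintegral_ball_zero_sing_le (hN : 1 ≤ N) {β σ : ℝ} (hβ : 0 < β) (hσ : 0 < σ) (hσ1 : σ ≤ 1) :
    ∫⁻ y in ball (0 : Sp N) σ, ENNReal.ofReal (sing N β ‖y‖) ≤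
      ENNReal.ofReal (N * ((volume (ball (0 : Sp N) 1)).toReal *
        (ellC 1 β * ell 1 σ ^ (-β)))) := by
  have hC : 0 < ellC 1 β := by have := Real.exp_pos 1; unfold ellC; positivity
  have hl := ell_pos (d := 1) hσ
  refine lintegral_ball_fun_norm_le hN (measurable_sing N β) (fun r hr => sing_nonneg hr)
    (by positivity) ?_
  have h := lintegral_inv_mul_ell_le (d := 1) one_pos hβ one_pos hσ hσ1
  simp only [div_one] at h
  refine le_trans (le_of_eq ?_) h
  refine setLIntegral_congr_fun measurableSet_Ioo fun r hr => ?_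
  have hr0 : 0 < r := hr.1
  have e : r ^ (N - 1) * r ^ (-(N : ℝ)) = r⁻¹ := by
    rw [← Real.rpow_natCast, ← Real.rpow_add hr0, Nat.cast_sub hN, ← Real.rpow_neg_one]
    congr 1
    push_cast
    ring
  simp only [sing]
  rw [← mul_assoc, e]

/-- The profile is almost decreasing: passing from σ to s ≥ σ, the logarithmic factor loses at most
a multiple of s/σ, and s^(-N) with N ≥ 1 pays for it. -/
lemma exists_sing_le (hN : 1 ≤ N) {β : ℝ} (hβ : 0 < β) :
    ∃ C : ℝ, 0 < C ∧ ∀ σ s : ℝ, 0 < σ → σ ≤ s →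
      sing N β s ≤ C * (σ ^ (-(N : ℝ)) * ell 1 σ ^ (-β)) := by
  have hN1 : (1 : ℝ) ≤ N := by exact_mod_cast hN
  set a : ℝ := 1 / β with ha
  have ha0 : 0 < a := by positivity
  refine ⟨(1 + 1 / a) ^ β, by positivity, fun σ s hσ hs => ?_⟩
  have hs0 : 0 < s := hσ.trans_le hs
  have hx : 1 ≤ s / σ := (one_le_div hσ).2 hs
  have hls := one_le_ell (d := 1) hs0
  have hls0 : 0 < ell 1 s := by linarith
  have hlσ := ell_pos (d := 1) hσ
  have h1 : ell 1 σ ≤ (1 + 1 / a) * (s / σ) ^ a * ell 1 s := by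
    have he := Real.exp_pos 1
    have e1 : Real.exp 1 + σ⁻¹ ≤ s / σ * (Real.exp 1 + s⁻¹) := by
      have : s / σ * (Real.exp 1 + s⁻¹) = s / σ * Real.exp 1 + σ⁻¹ := by field_simp
      rw [this]
      nlinarith
    have e2 := Real.log_le_log (by positivity) e1
    rw [Real.log_mul (by positivity) (by positivity), ← ell_one, ← ell_one] at e2
    have e3 := Real.log_le_rpow_div (x := s / σ) (by positivity) ha0
    have e4 : 1 ≤ (s / σ) ^ a := Real.one_le_rpow hx ha0.le
    calc ell 1 σ ≤ (s / σ) ^ a / a + ell 1 s := by linarith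
      _ ≤ (s / σ) ^ a / a * ell 1 s + (s / σ) ^ a * ell 1 s := by
          refine add_le_add (le_mul_of_one_le_right (by positivity) hls)
            (le_mul_of_one_le_left hls0.le e4)
      _ = _ := by ring
  have h2 : ell 1 σ ^ β ≤ (1 + 1 / a) ^ β * (s / σ) * ell 1 s ^ β := by
    refine (Real.rpow_le_rpow hlσ.le h1 hβ.le).trans (le_of_eq ?_)
    rw [Real.mul_rpow (by positivity) hls0.le, Real.mul_rpow (by positivity) (by positivity),
      ← Real.rpow_mul (by positivity), ha, one_div_mul_cancel hβ.ne', Real.rpow_one]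
  have h3 : ell 1 s ^ (-β) ≤ (1 + 1 / a) ^ β * (s / σ) * ell 1 σ ^ (-β) := by
    have p1 : 0 < ell 1 s ^ β := by positivity
    have p2 : 0 < ell 1 σ ^ β := by positivity
    rw [Real.rpow_neg hls0.le, Real.rpow_neg hlσ.le, ← div_eq_mul_inv, inv_eq_one_div,
      div_le_div_iff₀ p1 p2, one_mul]
    exact h2
  have h4 : s ^ (-(N : ℝ)) * (s / σ) ≤ σ ^ (-(N : ℝ)) := by
    have e1 : s ^ (-(N : ℝ)) = σ ^ (-(N : ℝ)) * (s / σ) ^ (-(N : ℝ)) := by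
      rw [← Real.mul_rpow hσ.le (by positivity), mul_div_cancel₀ _ hσ.ne']
    have e2 : (s / σ) ^ (-(N : ℝ)) * (s / σ) ≤ 1 := by
      rw [← Real.rpow_add_one (by positivity)]
      exact Real.rpow_le_one_of_one_le_of_nonpos hx (by linarith)
    rw [e1, mul_assoc]
    exact mul_le_of_le_one_right (by positivity) e2
  calc sing N β s ≤ s ^ (-(N : ℝ)) * ell 1 s ^ (-β) := by
        unfold sing
        gcongr
        linarith
    _ ≤ s ^ (-(N : ℝ)) * ((1 + 1 / a) ^ β * (s / σ) * ell 1 σ ^ (-β)) := by gcongr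
    _ = (1 + 1 / a) ^ β * ((s ^ (-(N : ℝ)) * (s / σ)) * ell 1 σ ^ (-β)) := by ring
    _ ≤ _ := by gcongr

/-- The part of the ball within σ of the origin is covered by the radial computation; on the rest
|y| ≥ σ and the pointwise bound at σ suffices. -/
lemma exists_lintegral_ball_sing_le (hN : 1 ≤ N) {β : ℝ} (hβ : 0 < β) :
    ∃ C : ℝ, 0 < C ∧ ∀ (z : Sp N) (σ : ℝ), 0 < σ → σ ≤ 1 →
      ∫⁻ y in ball z σ, ENNReal.ofReal (sing N β ‖y‖) ≤ ENNReal.ofReal (C * ell 1 σ ^ (-β)) := by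
  obtain ⟨C, hC, h⟩ := exists_sing_le hN hβ
  set v := (volume (ball (0 : Sp N) 1)).toReal with hv
  have hv0 : 0 < v :=
    ENNReal.toReal_pos (measure_ball_pos _ _ one_pos).ne' measure_ball_lt_top.ne
  have hC' : 0 < ellC 1 β := by have := Real.exp_pos 1; unfold ellC; positivity
  refine ⟨N * (v * ellC 1 β) + C * v, by positivity, fun z σ hσ hσ1 => ?_⟩
  have hl := ell_pos (d := 1) hσ
  have hsub : ball z σ ⊆ ball 0 σ ∪ (ball z σ \ ball 0 σ) := by
    rw [union_sdiff_self]; exact subset_union_right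
  refine (lintegral_mono_set hsub).trans ((lintegral_union_le _ _ _).trans ?_)
  have h2 : ∫⁻ y in ball z σ \ ball 0 σ, ENNReal.ofReal (sing N β ‖y‖) ≤
      ENNReal.ofReal (C * v * ell 1 σ ^ (-β)) := by
    calc ∫⁻ y in ball z σ \ ball 0 σ, ENNReal.ofReal (sing N β ‖y‖)
        ≤ ∫⁻ _ in ball z σ \ ball 0 σ,
            ENNReal.ofReal (C * (σ ^ (-(N : ℝ)) * ell 1 σ ^ (-β))) := by
          refine setLIntegral_mono' (measurableSet_ball.diff measurableSet_ball) fun y hy => ?_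
          refine ENNReal.ofReal_le_ofReal (h σ ‖y‖ hσ ?_)
          simpa using hy.2
      _ ≤ ENNReal.ofReal (C * (σ ^ (-(N : ℝ)) * ell 1 σ ^ (-β))) * volume (ball z σ) := by
          rw [setLIntegral_const]
          gcongr
          exact sdiff_subset
      _ = _ := by
          rw [volume_ball_eq hσ, ← ENNReal.ofReal_toReal (measure_ball_lt_top (μ := volume)
            (x := (0 : Sp N)) (r := 1)).ne, ← hv, ← ENNReal.ofReal_mul (by positivity),
            ← ENNReal.ofReal_mul (by positivity)]
          congr 1
          rw [Real.rpow_neg hσ.le]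
          field_simp
  refine (add_le_add (lintegral_ball_zero_sing_le hN hβ hσ hσ1) h2).trans (le_of_eq ?_)
  rw [← ENNReal.ofReal_add (by positivity) (by positivity)]
  congr 1; ring

/-- For the bounded part of φ: its mass σ^N beats the logarithm with a power of σ to spare, and this
spare power becomes small with T. -/
lemma exists_rpow_mul_ell_le (hN : 1 ≤ N) {β : ℝ} (hβ : 0 < β) :
    ∃ C : ℝ, 0 < C ∧ ∀ σ : ℝ, 0 < σ → σ ≤ 1 →
      σ ^ (N : ℝ) ≤ C * σ ^ (1 / 2 : ℝ) * ell 1 σ ^ (-β) := by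
  have hN1 : (1 : ℝ) ≤ N := by exact_mod_cast hN
  have he := Real.exp_pos 1
  set a : ℝ := 1 / (2 * β) with ha
  have ha0 : 0 < a := by positivity
  refine ⟨((Real.exp 1 + 1) ^ a / a) ^ β, by positivity, fun σ hσ hσ1 => ?_⟩
  have hl := ell_pos (d := 1) hσ
  have h1 : ell 1 σ ≤ (Real.exp 1 + 1) ^ a / a * σ ^ (-a) := by
    rw [ell_one]
    refine (Real.log_le_rpow_div (by positivity) ha0).trans ?_
    have e1 : Real.exp 1 + σ⁻¹ ≤ (Real.exp 1 + 1) * σ⁻¹ := by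
      have : 1 ≤ σ⁻¹ := (one_le_inv₀ hσ).2 hσ1
      nlinarith
    calc (Real.exp 1 + σ⁻¹) ^ a / a ≤ ((Real.exp 1 + 1) * σ⁻¹) ^ a / a := by gcongr
      _ = _ := by
          rw [Real.mul_rpow (by positivity) (by positivity), Real.inv_rpow hσ.le,
            Real.rpow_neg hσ.le]
          ring
  have h2 := Real.rpow_le_rpow hl.le h1 hβ.le
  rw [Real.mul_rpow (by positivity) (by positivity), ← Real.rpow_mul hσ.le,
    show -a * β = -(1 / 2 : ℝ) by rw [ha]; field_simp] at h2
  have hlβ : 0 < ell 1 σ ^ β := by positivity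
  rw [Real.rpow_neg hl.le, ← div_eq_mul_inv, le_div_iff₀ hlβ]
  calc σ ^ (N : ℝ) * ell 1 σ ^ β
      ≤ σ ^ (1 : ℝ) * (((Real.exp 1 + 1) ^ a / a) ^ β * σ ^ (-(1 / 2 : ℝ))) :=
        mul_le_mul (Real.rpow_le_rpow_of_exponent_ge hσ hσ1 hN1) h2 hlβ.le (by positivity)
    _ = ((Real.exp 1 + 1) ^ a / a) ^ β * (σ ^ (1 : ℝ) * σ ^ (-(1 / 2 : ℝ))) := by ring
    _ = _ := by rw [← Real.rpow_add hσ]; norm_num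

lemma Phi_singular_le (hN : 1 ≤ N) {β μ c s : ℝ} (hβ : 0 < β) (hμ : μ = 2 * β) (hc : 0 ≤ c)
    (hc1 : c ≤ 1) (hs : 0 ≤ s) :
    Phi β (c * s ^ (-(N : ℝ)) * ell 1 s ^ (-μ - 1)) ≤ c * (N + 1) ^ β * sing N β s := by
  have hN0 : (N : ℝ) ≠ 0 := by exact_mod_cast (Nat.one_le_iff_ne_zero.1 hN)
  rcases hs.eq_or_lt with rfl | hs
  · have h := sing_nonneg (N := N) (β := β) le_rfl
    rw [Real.zero_rpow (neg_ne_zero.2 hN0), mul_zero, zero_mul]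
    simp only [Phi, zero_mul]
    positivity
  have hl := one_le_ell (d := 1) hs
  have hl0 : 0 < ell 1 s := by linarith
  have h1 : ell 1 s ^ (-μ - 1) ≤ 1 := Real.rpow_le_one_of_one_le_of_nonpos hl (by linarith)
  have h2 : c * s ^ (-(N : ℝ)) * ell 1 s ^ (-μ - 1) ≤ s ^ (-(N : ℝ)) := by
    exact (mul_le_of_le_one_right (by positivity) h1).trans
      (mul_le_of_le_one_left (by positivity) hc1)
  have h3 := log_exp_add_mono (by positivity) h2
  have h4 := log_exp_add_rpow_neg_le hN hs
  have h5 := log_exp_add_pos (x := c * s ^ (-(N : ℝ)) * ell 1 s ^ (-μ - 1)) (by positivity)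
  rw [← ell_one] at h4
  calc Phi β (c * s ^ (-(N : ℝ)) * ell 1 s ^ (-μ - 1))
      ≤ c * s ^ (-(N : ℝ)) * ell 1 s ^ (-μ - 1) * ((N + 1) * ell 1 s) ^ β := by
        unfold Phi
        gcongr
        exact h3.trans h4
    _ = _ := by
        rw [Real.mul_rpow (by positivity) hl0.le, sing,
          show -β - 1 = -μ - 1 + β by rw [hμ]; ring, Real.rpow_add hl0]
        ring

/-- Any β < μ with μ = N/(d-p) would match the exponents; β = μ/2 is taken, so that the ball masses
of Φ(|φ|), of order log^(β-μ), become log^(-β). The singular part is made small by C₁ and the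
bounded part by T. -/
theorem exists_hasLocalSolution_of_singularity (hN : 1 ≤ N) {d p : ℝ} (hd : 1 < d) (hp : 1 < p)
    (hpp : p = pHJ N d) :
    ∃ C₁ : ℝ, 0 < C₁ ∧ ∀ (C : ℝ) (φ : Sp N → ℝ), 0 < C → LocallyIntegrable φ volume →
        (∀ᵐ x : Sp N, |φ x| ≤ C₁ * ‖x‖ ^ (-(N : ℝ)) *
          (Real.log (Real.exp 1 + 1 / ‖x‖)) ^ (-((N : ℝ) / (d - p)) - 1) + C) →
        HasLocalSolution d p φ := by
  have hd0 : 0 < d := by linarith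
  have hN1 : (1 : ℝ) ≤ N := by exact_mod_cast hN
  have hpd : p < d := by nlinarith [eq_pHJ_iff.1 hpp]
  set μ : ℝ := N / (d - p) with hμ
  have hμ0 : 0 < μ := div_pos (by linarith) (by linarith)
  set β : ℝ := μ / 2 with hβdef
  have hβ : 0 < β := by positivity
  have hμβ : μ = 2 * β := by rw [hβdef]; ring
  obtain ⟨δ, hδ, _, _, hsol⟩ := exists_isSolution_of_lintegral_Phi_le hN hd hp hpp hβ
  obtain ⟨K, hK, hsing⟩ := exists_lintegral_ball_sing_le hN hβ
  obtain ⟨K', hK', hpow⟩ := exists_rpow_mul_ell_le hN hβ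
  set v := (volume (ball (0 : Sp N) 1)).toReal with hv
  have hv0 : 0 < v :=
    ENNReal.toReal_pos (measure_ball_pos _ _ one_pos).ne' measure_ball_lt_top.ne
  set c : ℝ := min 1 (δ / 2 / ((N + 1) ^ β * K)) with hc
  have hc0 : 0 < c := lt_min one_pos (by positivity)
  have hcδ : c * ((N + 1) ^ β * K) ≤ δ / 2 := by
    rw [← le_div_iff₀ (by positivity)]; exact min_le_right _ _
  -- Half of c, because splitting Φ of a sum doubles each summand.
  refine ⟨c / 2, by positivity, fun C φ hC hφ hle => ?_⟩
  have hPC : 0 < Phi β (2 * C) := by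
    have := log_exp_add_pos (x := 2 * C) (by positivity)
    unfold Phi; positivity
  -- T is chosen after C, so that C₁ does not depend on C.
  obtain ⟨T₀, hT₀, hT₀δ⟩ := exists_rpow_le (e := 1 / d * (1 / 2)) (η := δ / 2) (by positivity)
    (by positivity) (c := Phi β (2 * C) * v * K') (by positivity)
  set T : ℝ := min T₀ 1 with hTdef
  have hT : 0 < T := lt_min hT₀ one_pos
  have hT1 : T ≤ 1 := min_le_right _ _
  have hTδ : Phi β (2 * C) * v * K' * T ^ (1 / d * (1 / 2)) ≤ δ / 2 := by
    refine le_trans ?_ hT₀δ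
    gcongr
    exact min_le_left _ _
  suffices hball : ∀ (z : Sp N) (σ : ℝ), 0 < σ → σ < T ^ (1 / d) →
      ∫⁻ y in ball z σ, ENNReal.ofReal (Phi β (T ^ ((N : ℝ) / d) * |φ y|)) ≤
        ENNReal.ofReal (δ * T ^ ((N : ℝ) / d) *
          Real.log (Real.exp 1 + (σ * T ^ (-(1 / d)))⁻¹) ^ (β - μ)) by
    obtain ⟨u, hu, -⟩ := hsol T φ hT hφ.aestronglyMeasurable hball
    exact ⟨T, hT, u, hu⟩
  intro z σ hσ hσT
  have hTd : T ^ (1 / d) ≤ 1 := Real.rpow_le_one hT.le hT1 (by positivity)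
  have hTν : T ^ ((N : ℝ) / d) ≤ 1 := Real.rpow_le_one hT.le hT1 (by positivity)
  have hσ1 : σ ≤ 1 := hσT.le.trans hTd
  have hl := ell_pos (d := 1) hσ
  have hpt : ∀ᵐ y : Sp N, ENNReal.ofReal (Phi β (T ^ ((N : ℝ) / d) * |φ y|)) ≤
      ENNReal.ofReal (T ^ ((N : ℝ) / d)) *
        (ENNReal.ofReal (c * (N + 1) ^ β) * ENNReal.ofReal (sing N β ‖y‖) +
          ENNReal.ofReal (Phi β (2 * C))) := by
    filter_upwards [hle] with y hy
    have hs := sing_nonneg (N := N) (β := β) (norm_nonneg y)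
    rw [one_div, ← ell_one] at hy
    have hly : 0 < ell 1 ‖y‖ := by
      rw [ell_one]; exact log_exp_add_pos (by positivity)
    rw [← ENNReal.ofReal_mul (by positivity), ← ENNReal.ofReal_add (by positivity) hPC.le,
      ← ENNReal.ofReal_mul (by positivity)]
    refine ENNReal.ofReal_le_ofReal ?_
    refine (Phi_mul_le hβ (by positivity) hTν (abs_nonneg _)).trans
      (mul_le_mul_of_nonneg_left ?_ (by positivity))
    refine (Phi_mono hβ (abs_nonneg _) hy).trans ((Phi_add_le hβ (by positivity) hC.le).trans ?_)
    gcongr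
    have := Phi_singular_le hN hβ hμβ hc0.le (min_le_left _ _) (norm_nonneg y)
    rwa [show 2 * (c / 2 * ‖y‖ ^ (-(N : ℝ)) * ell 1 ‖y‖ ^ (-μ - 1)) =
      c * ‖y‖ ^ (-(N : ℝ)) * ell 1 ‖y‖ ^ (-μ - 1) by ring]
  have hball : ∫⁻ y in ball z σ, ENNReal.ofReal (Phi β (T ^ ((N : ℝ) / d) * |φ y|)) ≤
      ENNReal.ofReal (T ^ ((N : ℝ) / d)) * (ENNReal.ofReal (c * (N + 1) ^ β) *
        ENNReal.ofReal (K * ell 1 σ ^ (-β)) +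
          ENNReal.ofReal (Phi β (2 * C)) * ENNReal.ofReal (σ ^ (N : ℝ) * v)) := by
    refine (lintegral_mono_ae (ae_restrict_of_ae hpt)).trans ?_
    have hm : Measurable fun y : Sp N => ENNReal.ofReal (sing N β ‖y‖) :=
      ((measurable_sing N β).comp measurable_norm).ennreal_ofReal
    rw [lintegral_const_mul' _ _ ENNReal.ofReal_ne_top, lintegral_add_left (hm.const_mul _),
      lintegral_const_mul' _ _ ENNReal.ofReal_ne_top, setLIntegral_const]
    gcongr
    · exact hsing z σ hσ hσ1
    · rw [volume_ball_eq hσ, ENNReal.ofReal_mul (by positivity), hv,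
        ENNReal.ofReal_toReal measure_ball_lt_top.ne]
  refine hball.trans ?_
  rw [← ENNReal.ofReal_mul (by positivity), ← ENNReal.ofReal_mul (by positivity),
    ← ENNReal.ofReal_add (by positivity) (by positivity), ← ENNReal.ofReal_mul (by positivity)]
  refine ENNReal.ofReal_le_ofReal ?_
  have h1 : c * (N + 1) ^ β * (K * ell 1 σ ^ (-β)) ≤ δ / 2 * ell 1 σ ^ (-β) := by
    calc _ = c * ((N + 1) ^ β * K) * ell 1 σ ^ (-β) := by ring
      _ ≤ _ := by gcongr
  have h2 : Phi β (2 * C) * (σ ^ (N : ℝ) * v) ≤ δ / 2 * ell 1 σ ^ (-β) := by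
    have e1 : σ ^ (1 / 2 : ℝ) ≤ T ^ (1 / d * (1 / 2)) := by
      rw [Real.rpow_mul hT.le]
      gcongr
    calc Phi β (2 * C) * (σ ^ (N : ℝ) * v)
        ≤ Phi β (2 * C) * ((K' * σ ^ (1 / 2 : ℝ) * ell 1 σ ^ (-β)) * v) := by
          gcongr; exact hpow σ hσ hσ1
      _ ≤ Phi β (2 * C) * ((K' * T ^ (1 / d * (1 / 2)) * ell 1 σ ^ (-β)) * v) := by gcongr
      _ = (Phi β (2 * C) * v * K' * T ^ (1 / d * (1 / 2))) * ell 1 σ ^ (-β) := by ring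
      _ ≤ _ := by gcongr
  have hs0 : 0 < σ * T ^ (-(1 / d)) := by positivity
  -- T ≤ 1 gives σT^(-1/d) ≥ σ, so the rescaled logarithm is the smaller one and its negative power
  -- the larger.
  have h3 : ell 1 σ ^ (-β) ≤
      Real.log (Real.exp 1 + (σ * T ^ (-(1 / d)))⁻¹) ^ (β - μ) := by
    rw [show β - μ = -β by rw [hμβ]; ring]
    refine Real.rpow_le_rpow_of_nonpos (log_exp_add_pos (by positivity)) ?_ (by linarith)
    rw [ell_one]
    refine log_exp_add_mono (by positivity) ?_
    gcongr
    refine le_mul_of_one_le_right hσ.le ?_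
    exact Real.one_le_rpow_of_pos_of_le_one_of_nonpos hT hT1 (by simp; positivity)
  calc _ ≤ T ^ ((N : ℝ) / d) * (δ / 2 * ell 1 σ ^ (-β) + δ / 2 * ell 1 σ ^ (-β)) := by gcongr
    _ = δ * T ^ ((N : ℝ) / d) * ell 1 σ ^ (-β) := by ring
    _ ≤ _ := by gcongr

end VHJ

end

theorem theorem7p2 (N : ℕ) (hN : 1 ≤ N) (d p : ℝ) (hd : 1 < d) (hp : 1 < p) :
    -- (a)
    (p < VHJ.pHJ N d → ∀ φ : VHJ.Sp N → ℝ, VHJ.MemLuloc 1 φ → VHJ.HasLocalSolution d p φ) ∧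
    -- (b)
    (p = VHJ.pHJ N d →
      (∀ β : ℝ, 0 < β → ∃ γ : ℝ, 0 < γ ∧ ∃ C : ℝ, 0 < C ∧
        ∀ (T : ℝ) (φ : VHJ.Sp N → ℝ), 0 < T → LocallyIntegrable φ volume →
          (∀ (x : VHJ.Sp N) (σ : ℝ), 0 < σ → σ < T ^ (1 / d) →
            IntegrableOn (fun y => VHJ.Phi β (T ^ ((N : ℝ) / d) * |φ y|)) (ball x σ) volume ∧
            VHJ.PhiInv β (⨍ y in ball x σ, VHJ.Phi β (T ^ ((N : ℝ) / d) * |φ y|)) ≤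
              γ * VHJ.rho N d p (σ * T ^ (-(1 / d)))) →
          ∃ u : VHJ.Sp N → ℝ → ℝ, VHJ.IsSolution d p φ (ENNReal.ofReal T) u ∧
            ∀ (x : VHJ.Sp N) (t : ℝ), 0 < t → t < T →
              |u x t| ≤ C * t ^ (-((N : ℝ) / d)) *
                |Real.log (t / (2 * T))| ^ (-((N : ℝ) / d)) ∧
              ‖gradient (fun y => u y t) x‖ ≤ C * t ^ (-((N : ℝ) / d) - 1 / d) *
                |Real.log (t / (2 * T))| ^ (-((N : ℝ) / d))) ∧
      (∃ C₁ : ℝ, 0 < C₁ ∧ ∀ (C : ℝ) (φ : VHJ.Sp N → ℝ), 0 < C → LocallyIntegrable φ volume →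
        (∀ᵐ x : VHJ.Sp N, |φ x| ≤ C₁ * ‖x‖ ^ (-(N : ℝ)) *
          (Real.log (Real.exp 1 + 1 / ‖x‖)) ^ (-((N : ℝ) / (d - p)) - 1) + C) →
        VHJ.HasLocalSolution d p φ)) ∧
    -- (c)
    (VHJ.pHJ N d < p → p < d → ∀ q : ℝ, 1 < q → ∃ C₂ : ℝ, 0 < C₂ ∧
      ∀ (T : ℝ≥0∞) (φ : VHJ.Sp N → ℝ), 0 < T → LocallyIntegrable φ volume →
        VHJ.localMorrey d ((d - p) / (p - 1)) q T φ ≤ ENNReal.ofReal C₂ →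
        ∃ u : VHJ.Sp N → ℝ → ℝ, VHJ.IsSolution d p φ T u) ∧
    -- (d)
    (∃ C₃ : ℝ, 0 < C₃ ∧
      ∀ (T : ℝ≥0∞) (φ : VHJ.Sp N → ℝ) (g : VHJ.Sp N → VHJ.Sp N), 0 < T →
        VHJ.MemLuloc 1 φ → VHJ.IsWeakGradient φ g →
        VHJ.localMorrey d ((d - 1) / (p - 1)) 1 T g ≤ ENNReal.ofReal C₃ →
        ∃ u : VHJ.Sp N → ℝ → ℝ, VHJ.IsSolution d p φ T u) := by
  refine ⟨fun h φ hφ => VHJ.hasLocalSolution_of_lt_pHJ hN hd hp h hφ,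
    fun h => ⟨fun β hβ => VHJ.exists_isSolution_of_PhiInv_le hN hd hp h hβ,
      VHJ.exists_hasLocalSolution_of_singularity hN hd hp h⟩, fun _ hpd q hq => ?_, ?_⟩
  · obtain ⟨C₂, hC₂, h⟩ := VHJ.exists_isSolution_of_localMorrey hN hd hp hpd hq
    exact ⟨C₂, hC₂, fun T φ _ hφ hM => h T φ hφ hM⟩
  · obtain ⟨C₃, hC₃, h⟩ := VHJ.exists_isSolution_of_isWeakGradient hN hd hp
    exact ⟨C₃, hC₃, fun T φ g _ hφ hg hM => h T φ g hφ hg hM⟩
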